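/- **Setting.** Let $I\ge 1$ agents be given, and consider Problem (P): $$\min_{D\in\mathcal D,\;X_i\in\mathcal X_i}\; U(D,X)=F(D,X)+\sum_{i=1}^I g_i(X_i)+G(D),\qquad F(D,X)=\sum_{i=1}^I f_i(D,X_i),$$ with $D\in\mathbb R^{M\times K}$, $X_i\in\mathbb R^{K\times n_i}$, $X=[X_1,\dots,X_I]$. Matrices carry the Frobenius norm $\|\cdot\|$ and the inner product $\langle A,B\rangle=\mathrm{tr}(A^{\top}B)$; $\|A\|_{\infty,\infty}=\max_{p,q}|A_{pq}|$. Assume: * $\mathcal D\subseteq\mathcal O$ is compact and convex, each $\mathcal X_i\subseteq\mathcal O_i$ is closed and convex, where $\mathcal O$, $\mathcal O_i$ are open and convex; each $f_i:\mathcal O\times\mathcal O_i\to\mathbb R$ is $C^2$, bounded below, and biconvex (convex in each argument when the other is fixed); for every $D\in\mathcal D$, $\nabla_{X_i}f_i(D,\cdot)$ is Lipschitz on $\mathcal X_i$ with a constant $L_i(D)\ge 0$ that is continuous in $D\in\mathcal D$; * $G:\mathcal O\to\mathbb R$ is convex; for each $i$, either (i) $\mathcal X_i$ is compact and $g_i:\mathcal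 O_i\to\mathbb R$ is convex, or (ii) $g_i:\mathcal O_i\to\mathbb R$ is $\mu_i$-strongly convex for some $\mu_i>0$. A point $(D^*,X^*)$ with $D^*\in\mathcal D$, $X_i^*\in\mathcal X_i$ is *stationary* if $\langle\nabla_DF(D^*,X^*),D-D^*\rangle+G(D)-G(D^*)\ge0$ for all $D\in\mathcal D$, and $\langle\nabla_{X_i}f_i(D^*,X_i^*),X_i-X_i^*\rangle+g_i(X_i)-g_i(X_i^*)\ge0$ for all $X_i\in\mathcal X_i$ and all $i$. **Network and parameters.** $\mathcal G^\nu=(\{1,\dots,I\},\mathcal E^\nu)$, $\nu=0,1,\dots$, are digraphs such that for some integer $B>0$ and all $k\ge0$ the graph with edge set $\bigcup_{t=kB}^{(k+1)B-1}\mathcal E^t$ is strongly connected. For some $\kappa>0$ independent of $\nu$, the matrices $A^\nu=(a_{ij}^\nu)$ satisfy $a_{ii}^\nu\ge\kappa$; for $i\ne j$, $a^\nu_{ij}\ge\kappa$ if $(j,i)\in\mathcal E^\nu$ and $a^\nu_{ij}=0$ otherwise; and every column of $A^\nu$ sums to $1$. The step sizes satisfy $\gamma^\nu\in(0,1]$,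 $\sum_\nu\gamma^\nu=\infty$, $\sum_\nu(\gamma^\nu)^2<\infty$. **Algorithm D$^4$L.** Start from $\phi_i^0=1$, any $D_{(i)}^0\in\mathcal D$, $X_i^0\in\mathcal X_i$, and $\Theta_{(i)}^0=\nabla_Df_i(D_{(i)}^0,X_i^0)$. For $\nu=0,1,\dots$ and every $i$, $$\widetilde D_{(i)}^\nu=\arg\min_{D\in\mathcal D}\ \tilde f_i^\nu(D)+\langle I\,\Theta_{(i)}^\nu-\nabla_Df_i(D_{(i)}^\nu,X_i^\nu),D-D_{(i)}^\nu\rangle+G(D),\qquad V_{(i)}^\nu=D_{(i)}^\nu+\gamma^\nu(\widetilde D_{(i)}^\nu-D_{(i)}^\nu),$$ $$X_i^{\nu+1}=\arg\min_{X_i\in\mathcal X_i}\ \tilde h_i^\nu(X_i)+g_i(X_i),\qquad \phi_i^{\nu+1}=\sum_ja_{ij}^\nu\phi_j^\nu,\qquad D_{(i)}^{\nu+1}=\frac1{\phi_i^{\nu+1}}\sum_ja_{ij}^\nu\phi_j^\nu V_{(j)}^\nu,$$ $$\Theta_{(i)}^{\nu+1}=\frac1{\phi_i^{\nu+1}}\sum_ja_{ij}^\nu\phi_j^\nu\Theta_{(j)}^\nu+\frac1{\phi_i^{\nu+1}}\bigl(\nabla_Df_i(D_{(i)}^{\nu+1},X_i^{\nu+1})-\nabla_Df_i(D_{(i)}^\nu,X_i^\nu)\bigr).$$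 Here, for each $i$ and $\nu$, $\tilde f_i^\nu(D)$ is $\frac{\tau_{D,i}^\nu}2\|D-D_{(i)}^\nu\|^2$ plus either $f_i(D,X_i^\nu)$ or $\langle\nabla_Df_i(D_{(i)}^\nu,X_i^\nu),D-D_{(i)}^\nu\rangle$, and $\tilde h_i^\nu(X_i)$ is $\frac{\tau_{X,i}^\nu}2\|X_i-X_i^\nu\|^2$ plus either $f_i(V_{(i)}^\nu,X_i)$ or $\langle\nabla_{X_i}f_i(V_{(i)}^\nu,X_i^\nu),X_i-X_i^\nu\rangle$. The parameters are positive and satisfy $0<\inf_\nu\tau_{D,i}^\nu\le\sup_\nu\tau_{D,i}^\nu<\infty$, $\sup_\nu\tau_{X,i}^\nu<\infty$, and, for some $\epsilon>0$, $\tau_{X,i}^\nu\ge\frac12L_i(V_{(i)}^\nu)+\epsilon$ for all $\nu\ge1$ and all $i$. **Merit functions.** Let $\overline D^\nu=\frac1I\sum_iD_{(i)}^\nu$ and $e^\nu=\max_i\|D_{(i)}^\nu-\overline D^\nu\|_{\infty,\infty}$. For fixed constants $\hat\tau_D,\hat\tau_X>0$ let $$\widehat D(D,X)=\arg\min_{D'\in\mathcal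 D}\langle\nabla_DF(D,X),D'-D\rangle+\tfrac{\hat\tau_D}2\|D'-D\|^2+G(D'),$$ $$\widehat X_i(D,X_i)=\arg\min_{X_i'\in\mathcal X_i}\langle\nabla_{X_i}f_i(D,X_i),X_i'-X_i\rangle+\tfrac{\hat\tau_X}2\|X_i'-X_i\|^2+g_i(X_i'),$$ $\Delta_D(D,X)=\|\widehat D(D,X)-D\|_{\infty,\infty}$, $\Delta_X(D,X)=\max_i\|\widehat X_i(D,X_i)-X_i\|_{\infty,\infty}$ and $\Delta^\nu=\max\{\Delta_D(\overline D^\nu,X^\nu),\Delta_X(\overline D^\nu,X^\nu)\}$. **Theorem.** Under these assumptions the minimizers defining $\widehat D(D,X)$ and $\widehat X_i(D,X_i)$ exist and are unique for all $D\in\mathcal D$, $X_i\in\mathcal X_i$, and every sequence generated by D$^4$L satisfies: (a) $\lim_{\nu\to\infty}e^\nu=0$; (b) (i) $\{(\overline D^\nu,X^\nu)\}_\nu$ is bounded; (ii) $U(\overline D^\nu,X^\nu)$ converges to a finite value; (iii) $\lim_{\nu\to\infty}\Delta_X(\overline D^\nu,X^\nu)=0$; (iv) $\liminf_{\nu\to\infty}\Delta_D(\overline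 D^\nu,X^\nu)=0$; and $\{(\overline D^\nu,X^\nu)\}_\nu$ has at least one limit point that is a stationary solution of (P); (b') if, in addition, every $g_i$ is $\mu_i$-strongly convex on $\mathcal O_i$ with $\mu_i>0$, and for all $i$ both $\sum_{\nu}|\tau_{D,i}^{\nu+1}-\tau_{D,i}^\nu|<\infty$ and $\limsup_\nu|\tau_{X,i}^\nu-\tau_{X,i}^{\nu-1}|<\min_j\mu_j$, then also $\lim_{\nu\to\infty}\Delta^\nu=0$, and all limit points of $\{(\overline D^\nu,X^\nu)\}_\nu$ are stationary solutions of (P). -/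

import Mathlib

open Set Filter Topology
open scoped InnerProductSpace

/-- Real `m × k` matrices with the Frobenius norm and the trace inner product
`⟪A, B⟫ = tr (Aᵀ B) = ∑ p, A p * B p`; the index `p` runs over pairs (row, column). -/
abbrev RMat (m k : ℕ) : Type := EuclideanSpace ℝ (Fin m × Fin k)

/-- The entrywise maximum norm `max_p |A p|`. -/
noncomputable def maxAbs {m k : ℕ} (A : RMat m k) : ℝ := ⨆ p, |A p|

/-- `x` minimizes `φ` over `s`. -/
def IsArgmin {E : Type*} (s : Set E) (φ : E → ℝ) (x : E) : Prop :=
  x ∈ s ∧ ∀ y ∈ s, φ x ≤ φ y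

/-- A minimizer of `φ` over `s` (meaningful when there is exactly one). -/
noncomputable def argminOn {E : Type*} [Nonempty E] (s : Set E) (φ : E → ℝ) : E :=
  Classical.epsilon (IsArgmin s φ)

/-- The data of the problem: minimize `∑ i, f i D (X i) + ∑ i, g i (X i) + G D` over
`D ∈ Dset` and `X i ∈ Xset i`. The functions are to be looked at on `O` and `Oi i` only. -/
structure DLProblem (ι : Type*) (M K : ℕ) (n : ι → ℕ) where
  O : Set (RMat M K)
  Oi : (i : ι) → Set (RMat K (n i))
  Dset : Set (RMat M K)
  Xset : (i : ι) → Set (RMat K (n i))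
  f : (i : ι) → RMat M K → RMat K (n i) → ℝ
  g : (i : ι) → RMat K (n i) → ℝ
  G : RMat M K → ℝ

namespace DLProblem

variable {ι : Type*} {M K : ℕ} {n : ι → ℕ}

/-- `∇_D f_i (D, X_i)` -/
noncomputable def gradD (P : DLProblem ι M K n) (i : ι) (D : RMat M K) (Xi : RMat K (n i)) :
    RMat M K :=
  gradient (fun D' => P.f i D' Xi) D

/-- `∇_{X_i} f_i (D, X_i)` -/
noncomputable def gradX (P : DLProblem ι M K n) (i : ι) (D : RMat M K) (Xi : RMat K (n i)) :
    RMat K (n i) :=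
  gradient (fun X' => P.f i D X') Xi

/-- `F (D, X) = ∑ i, f_i (D, X_i)` -/
def F [Fintype ι] (P : DLProblem ι M K n) (D : RMat M K) (X : (i : ι) → RMat K (n i)) : ℝ :=
  ∑ i, P.f i D (X i)

/-- The objective `U (D, X)`. -/
def U [Fintype ι] (P : DLProblem ι M K n) (D : RMat M K) (X : (i : ι) → RMat K (n i)) : ℝ :=
  P.F D X + ∑ i, P.g i (X i) + P.G D

/-- `∇_D F (D, X)` -/
noncomputable def gradDF [Fintype ι] (P : DLProblem ι M K n) (D : RMat M K)
    (X : (i : ι) → RMat K (n i)) : RMat M K :=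
  gradient (fun D' => P.F D' X) D

/-- Standing assumptions on the problem. `L i D` is a Lipschitz constant of
`∇_{X_i} f_i (D, ·)` on `Xset i`. -/
structure Assumptions (P : DLProblem ι M K n) (L : ι → RMat M K → ℝ) : Prop where
  O_open : IsOpen P.O
  O_convex : Convex ℝ P.O
  Oi_open : ∀ i, IsOpen (P.Oi i)
  Oi_convex : ∀ i, Convex ℝ (P.Oi i)
  Dset_subset : P.Dset ⊆ P.O
  Xset_subset : ∀ i, P.Xset i ⊆ P.Oi i
  f_contDiff : ∀ i, ContDiffOn ℝ 2 (fun p : RMat M K × RMat K (n i) => P.f i p.1 p.2)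
    (P.O ×ˢ P.Oi i)
  f_lower : ∀ i, ∃ c : ℝ, ∀ D ∈ P.O, ∀ Xi ∈ P.Oi i, c ≤ P.f i D Xi
  f_convex_D : ∀ i, ∀ Xi ∈ P.Oi i, ConvexOn ℝ P.O (fun D => P.f i D Xi)
  f_convex_X : ∀ i, ∀ D ∈ P.O, ConvexOn ℝ (P.Oi i) (fun Xi => P.f i D Xi)
  L_nonneg : ∀ i, ∀ D ∈ P.Dset, 0 ≤ L i D
  L_lipschitz : ∀ i, ∀ D ∈ P.Dset, ∀ Y ∈ P.Xset i, ∀ Z ∈ P.Xset i,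
    ‖P.gradX i D Y - P.gradX i D Z‖ ≤ L i D * ‖Y - Z‖
  L_continuous : ∀ i, ContinuousOn (L i) P.Dset
  Dset_compact : IsCompact P.Dset
  Dset_convex : Convex ℝ P.Dset
  Xset_closed : ∀ i, IsClosed (P.Xset i)
  Xset_convex : ∀ i, Convex ℝ (P.Xset i)
  G_convex : ConvexOn ℝ P.O P.G
  g_cases : ∀ i, (IsCompact (P.Xset i) ∧ ConvexOn ℝ (P.Oi i) (P.g i)) ∨
    ∃ μ : ℝ, 0 < μ ∧ StrongConvexOn (P.Oi i) μ (P.g i)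

/-- Stationary solutions of the problem. -/
def IsStationary [Fintype ι] (P : DLProblem ι M K n) (D : RMat M K)
    (X : (i : ι) → RMat K (n i)) : Prop :=
  D ∈ P.Dset ∧ (∀ i, X i ∈ P.Xset i) ∧
  (∀ D' ∈ P.Dset, 0 ≤ ⟪P.gradDF D X, D' - D⟫_ℝ + P.G D' - P.G D) ∧
  (∀ i, ∀ X' ∈ P.Xset i, 0 ≤ ⟪P.gradX i D (X i), X' - X i⟫_ℝ + P.g i X' - P.g i (X i))

/-- Objective of the subproblem that defines `D̂ (D, X)`. -/
noncomputable def hatDObj [Fintype ι] (P : DLProblem ι M K n) (τD : ℝ) (D : RMat M K)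
    (X : (i : ι) → RMat K (n i)) (D' : RMat M K) : ℝ :=
  ⟪P.gradDF D X, D' - D⟫_ℝ + τD / 2 * ‖D' - D‖ ^ 2 + P.G D'

/-- Objective of the subproblem that defines `X̂_i (D, X_i)`. -/
noncomputable def hatXObj (P : DLProblem ι M K n) (τX : ℝ) (i : ι) (D : RMat M K)
    (Xi : RMat K (n i)) (X' : RMat K (n i)) : ℝ :=
  ⟪P.gradX i D Xi, X' - Xi⟫_ℝ + τX / 2 * ‖X' - Xi‖ ^ 2 + P.g i X'

/-- `Δ_D (D, X) = ‖D̂ (D, X) - D‖_{∞,∞}` -/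
noncomputable def DeltaD [Fintype ι] (P : DLProblem ι M K n) (τD : ℝ) (D : RMat M K)
    (X : (i : ι) → RMat K (n i)) : ℝ :=
  maxAbs (argminOn P.Dset (P.hatDObj τD D X) - D)

/-- `Δ_X (D, X) = ‖X̂ (D, X) - X‖_{∞,∞}` -/
noncomputable def DeltaX (P : DLProblem ι M K n) (τX : ℝ) (D : RMat M K)
    (X : (i : ι) → RMat K (n i)) : ℝ :=
  ⨆ i, maxAbs (argminOn (P.Xset i) (P.hatXObj τX i D (X i)) - X i)

/-- Surrogate in `D` that keeps `f_i`: `f_i (D, X_i) + τ/2 ‖D - D₀‖²`. -/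
noncomputable def surrDFull (P : DLProblem ι M K n) (i : ι) (τ : ℝ) (D₀ : RMat M K)
    (Xi : RMat K (n i)) (D : RMat M K) : ℝ :=
  P.f i D Xi + τ / 2 * ‖D - D₀‖ ^ 2

/-- Linearized surrogate in `D`: `⟪∇_D f_i (D₀, X_i), D - D₀⟫ + τ/2 ‖D - D₀‖²`. -/
noncomputable def surrDLin (P : DLProblem ι M K n) (i : ι) (τ : ℝ) (D₀ : RMat M K)
    (Xi : RMat K (n i)) (D : RMat M K) : ℝ :=
  ⟪P.gradD i D₀ Xi, D - D₀⟫_ℝ + τ / 2 * ‖D - D₀‖ ^ 2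

/-- Surrogate in `X_i` that keeps `f_i`: `f_i (V, X) + τ/2 ‖X - X₀‖²`. -/
noncomputable def surrXFull (P : DLProblem ι M K n) (i : ι) (τ : ℝ) (V : RMat M K)
    (X₀ : RMat K (n i)) (X : RMat K (n i)) : ℝ :=
  P.f i V X + τ / 2 * ‖X - X₀‖ ^ 2

/-- Linearized surrogate in `X_i`: `⟪∇_{X_i} f_i (V, X₀), X - X₀⟫ + τ/2 ‖X - X₀‖²`. -/
noncomputable def surrXLin (P : DLProblem ι M K n) (i : ι) (τ : ℝ) (V : RMat M K)
    (X₀ : RMat K (n i)) (X : RMat K (n i)) : ℝ :=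
  ⟪P.gradX i V X₀, X - X₀⟫_ℝ + τ / 2 * ‖X - X₀‖ ^ 2

end DLProblem

/-- `B`-strong connectivity of a digraph sequence; `E t a b` says that at time `t` there is a
link from `a` to `b`. On each window `kB ≤ t < (k+1)B` the union graph has a directed path from
every node to every node. -/
def BStronglyConnected {ι : Type*} (E : ℕ → ι → ι → Prop) : Prop :=
  ∃ B : ℕ, 0 < B ∧ ∀ k : ℕ, ∀ a b : ι,
    Relation.ReflTransGen (fun c d => ∃ t, k * B ≤ t ∧ t < (k + 1) * B ∧ E t c d) a b

/-- Conditions on the weight matrices: a uniform positive lower bound on the diagonal and on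
the links, zero elsewhere, columns summing to one. -/
structure WeightAssumptions {ι : Type*} [Fintype ι] (E : ℕ → ι → ι → Prop)
    (A : ℕ → Matrix ι ι ℝ) (κ : ℝ) : Prop where
  pos : 0 < κ
  diag : ∀ ν i, κ ≤ A ν i i
  link : ∀ ν i j, E ν j i → κ ≤ A ν i j
  nolink : ∀ ν i j, i ≠ j → ¬ E ν j i → A ν i j = 0
  colsum : ∀ ν j, ∑ i, A ν i j = 1

/-- Diminishing step size. -/
structure StepAssumptions (γ : ℕ → ℝ) : Prop where
  pos : ∀ ν, 0 < γ ν
  le_one : ∀ ν, γ ν ≤ 1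
  sum_infinite : Tendsto (fun N => ∑ ν ∈ Finset.range N, γ ν) atTop atTop
  sq_summable : Summable (fun ν => γ ν ^ 2)

/-- All the sequences produced by the algorithm, agent by agent:
local dictionaries `D`, subproblem solutions `Dt`, intermediate dictionaries `V`, private
variables `X`, push-sum scalars `φ`, gradient trackers `Θ`. -/
structure D4LIterates (ι : Type*) (M K : ℕ) (n : ι → ℕ) where
  D : ℕ → ι → RMat M K
  Dt : ℕ → ι → RMat M K
  V : ℕ → ι → RMat M K
  X : ℕ → (i : ι) → RMat K (n i)
  φ : ℕ → ι → ℝ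
  Θ : ℕ → ι → RMat M K

namespace D4LIterates

variable {ι : Type*} {M K : ℕ} {n : ι → ℕ}

/-- The average `D̄^ν` of the local dictionaries. -/
noncomputable def Dbar [Fintype ι] (S : D4LIterates ι M K n) (ν : ℕ) : RMat M K :=
  (1 / (Fintype.card ι : ℝ)) • ∑ i, S.D ν i

/-- The consensus error `e^ν`. -/
noncomputable def consErr [Fintype ι] (S : D4LIterates ι M K n) (ν : ℕ) : ℝ :=
  ⨆ i, maxAbs (S.D ν i - S.Dbar ν)

/-- `S` is a run of the algorithm on `P` with step sizes `γ`, weights `A`, and surrogates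
`ft ν i` (a function of `D`) and `ht ν i` (a function of `X_i`) used by agent `i` at iteration
`ν`. The weights vanish outside the in-neighborhoods, so the sums run over all agents. -/
structure IsRun [Fintype ι] (S : D4LIterates ι M K n) (P : DLProblem ι M K n)
    (γ : ℕ → ℝ) (A : ℕ → Matrix ι ι ℝ)
    (ft : ℕ → (i : ι) → RMat M K → ℝ) (ht : ℕ → (i : ι) → RMat K (n i) → ℝ) : Prop where
  φ_init : ∀ i, S.φ 0 i = 1
  D_init : ∀ i, S.D 0 i ∈ P.Dset
  X_init : ∀ i, S.X 0 i ∈ P.Xset i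
  Θ_init : ∀ i, S.Θ 0 i = P.gradD i (S.D 0 i) (S.X 0 i)
  Dt_argmin : ∀ ν i, IsArgmin P.Dset
    (fun D => ft ν i D
      + ⟪(Fintype.card ι : ℝ) • S.Θ ν i - P.gradD i (S.D ν i) (S.X ν i), D - S.D ν i⟫_ℝ
      + P.G D) (S.Dt ν i)
  V_update : ∀ ν i, S.V ν i = S.D ν i + γ ν • (S.Dt ν i - S.D ν i)
  X_update : ∀ ν i, IsArgmin (P.Xset i) (fun Xi => ht ν i Xi + P.g i Xi) (S.X (ν + 1) i)
  φ_update : ∀ ν i, S.φ (ν + 1) i = ∑ j, A ν i j * S.φ ν j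
  D_update : ∀ ν i, S.D (ν + 1) i
    = (1 / S.φ (ν + 1) i) • ∑ j, (A ν i j * S.φ ν j) • S.V ν j
  Θ_update : ∀ ν i, S.Θ (ν + 1) i
    = (1 / S.φ (ν + 1) i) • ∑ j, (A ν i j * S.φ ν j) • S.Θ ν j
      + (1 / S.φ (ν + 1) i) •
        (P.gradD i (S.D (ν + 1) i) (S.X (ν + 1) i) - P.gradD i (S.D ν i) (S.X ν i))

/-- Each surrogate is one of the two admissible choices. -/
structure SurrogateAssumptions (S : D4LIterates ι M K n) (P : DLProblem ι M K n)
    (τD τX : ℕ → ι → ℝ)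
    (ft : ℕ → (i : ι) → RMat M K → ℝ) (ht : ℕ → (i : ι) → RMat K (n i) → ℝ) : Prop where
  ft_eq : ∀ ν i, ft ν i = P.surrDFull i (τD ν i) (S.D ν i) (S.X ν i) ∨
    ft ν i = P.surrDLin i (τD ν i) (S.D ν i) (S.X ν i)
  ht_eq : ∀ ν i, ht ν i = P.surrXFull i (τX ν i) (S.V ν i) (S.X ν i) ∨
    ht ν i = P.surrXLin i (τX ν i) (S.V ν i) (S.X ν i)

/-- Basic conditions on the proximal parameters. -/
structure ProxAssumptions (S : D4LIterates ι M K n) (L : ι → RMat M K → ℝ)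
    (τD τX : ℕ → ι → ℝ) : Prop where
  τD_lower : ∀ i, ∃ c : ℝ, 0 < c ∧ ∀ ν, c ≤ τD ν i
  τD_upper : ∀ i, ∃ C : ℝ, ∀ ν, τD ν i ≤ C
  τX_pos : ∀ ν i, 0 < τX ν i
  τX_upper : ∀ i, ∃ C : ℝ, ∀ ν, τX ν i ≤ C
  τX_lower : ∃ ε : ℝ, 0 < ε ∧ ∀ i, ∀ ν, 1 ≤ ν → 1 / 2 * L i (S.V ν i) + ε ≤ τX ν i

end D4LIterates

/-! ### First-order conditions, growth of convex functions, proximal points -/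

section ConvexTools

variable {E : Type*} [NormedAddCommGroup E] [InnerProductSpace ℝ E]

/-! The method is a perturbed block descent on `U`. Over a fixed number of steps, push-sum averaging
contracts the spread of a mixed family up to the perturbations injected
(`WeightAssumptions.exists_contraction`). For the dictionaries these have size `γ`, so their spread
is square summable. For the trackers they are the increments of the local gradients, bounded by `γ`,
the dictionary spread and the moves of the private variables. The `φ`-weighted sum of the trackers
always equals the sum of the local gradients, so a small tracker spread means that each rescaled
tracker is close to `∇_D F`.

The gradients are not globally Lipschitz, so the private variables must first be shown bounded. If
`Xset i` is not compact, strong convexity of `g i` does this: the forward gradient step is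
nonexpansive as soon as `τ ≥ L/2` (`forward_step_nonexpansive`), and `μ` then pulls the update
towards a reference point (`exists_X_contraction`). All constants become uniform
(`exists_regularRun`).

The value `lyapunov`, taken at the `φ`-weighted mean, drops in each iteration from the second on by
a multiple of `γ ‖Dt - D‖²` and of the squared private moves, up to a summable error and a term `γ *
spread Θ`. The latter is not known to be summable in advance, since the trackers are themselves
driven by the private moves. `descent_summable` closes this loop: Young's inequality puts a small
factor on `spread Θ ^ 2`, whose sum is bounded by the sum of the squared private moves, and half of
the descent absorbs it.

Comparing the iterates with the exact proximal points bounds the merit values by moves and spreads.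
Hence `gapX` tends to zero and `γ * gapD ^ 2` is summable; as `∑ γ = ∞`, `gapD` is small infinitely
often, and compactness yields a stationary limit point.

For the full limit in the strongly convex case, successive private moves contract by a fixed factor,
so the path length over a block of iterations is at most a vanishing term plus a multiple of the
`γ`-mass of the block. An excursion of `gapD` from below `ε` to above `2ε` would then need a
definite `γ`-mass at times where `gapD ≥ ε`; the total of that mass is finite, so late excursions
are impossible (`tendsto_zero_of_no_oscillation`). -/

lemma segment_point_mem {s : Set E} (hs : Convex ℝ s) {x y : E} (hx : x ∈ s) (hy : y ∈ s)
    {t : ℝ} (h0 : 0 ≤ t) (h1 : t ≤ 1) : x + t • (y - x) ∈ s :=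
  hs.add_smul_sub_mem hx hy ⟨h0, h1⟩

lemma hasDerivAt_line [CompleteSpace E] {h : E → ℝ} {p x d : E} {t : ℝ}
    (hh : HasGradientAt h p (x + t • d)) :
    HasDerivAt (fun r : ℝ => h (x + r • d)) ⟪p, d⟫_ℝ t := by
  have h1 : HasDerivAt (fun r : ℝ => x + r • d) d t := by
    simpa using ((hasDerivAt_id t).smul_const d).const_add x
  exact (hh.hasFDerivAt.comp_hasDerivAt t h1).congr_deriv (by simp)

/-- First-order condition along a segment for the sum of a differentiable and a strongly convex
function. -/
lemma first_order_along_segment [CompleteSpace E] {s : Set E} {m : ℝ} {h g : E → ℝ} {x y p : E}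
    (hg : StrongConvexOn s m g) (hx : x ∈ s) (hy : y ∈ s) (hh : HasGradientAt h p x)
    (hmin : ∀ t : ℝ, 0 < t → t ≤ 1 →
      h x + g x ≤ h (x + t • (y - x)) + g (x + t • (y - x))) :
    0 ≤ ⟪p, y - x⟫_ℝ + g y - g x - m / 2 * ‖y - x‖ ^ 2 := by
  have hd : HasDerivAt (fun r : ℝ => h (x + r • (y - x))) ⟪p, y - x⟫_ℝ 0 :=
    hasDerivAt_line (by simpa using hh)
  have hlim := hd.tendsto_slope_zero_right
  -- Strong convexity at parameter `t` gains `t (1 - t) m/2 ‖y - x‖²`; after division by `t` the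
  -- factor `1 - t` tends to one, so the full quadratic term survives.
  have hlim2 : Tendsto (fun t : ℝ => (1 - t) * (m / 2 * ‖y - x‖ ^ 2)) (𝓝[>] 0)
      (𝓝 ((1 - 0) * (m / 2 * ‖y - x‖ ^ 2))) :=
    ((continuous_const.sub continuous_id).mul continuous_const).continuousWithinAt
  have hlim3 := ((hlim.add_const (g y)).sub_const (g x)).sub hlim2
  have key : 0 ≤ ⟪p, y - x⟫_ℝ + g y - g x - (1 - 0) * (m / 2 * ‖y - x‖ ^ 2) := by
    refine ge_of_tendsto hlim3 ?_
    filter_upwards [Ioc_mem_nhdsGT (show (0 : ℝ) < 1 by norm_num)] with t ht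
    have h1 := hmin t ht.1 ht.2
    have h2 := hg.2 hx hy (show 0 ≤ 1 - t by linarith [ht.2]) ht.1.le (by ring)
    have h3 : (1 - t) • x + t • y = x + t • (y - x) := by module
    rw [h3] at h2
    simp only [smul_eq_mul, norm_sub_rev x y] at h2
    have h4 : 0 ≤ t * (t⁻¹ • (h (x + (0 + t) • (y - x)) - h (x + (0 : ℝ) • (y - x)))
        + g y - g x - (1 - t) * (m / 2 * ‖y - x‖ ^ 2)) := by
      have : t * (t⁻¹ • (h (x + (0 + t) • (y - x)) - h (x + (0 : ℝ) • (y - x)))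
        + g y - g x - (1 - t) * (m / 2 * ‖y - x‖ ^ 2))
        = (h (x + t • (y - x)) - h x)
          + t * (g y - g x - (1 - t) * (m / 2 * ‖y - x‖ ^ 2)) := by
        have ht0 : t ≠ 0 := ht.1.ne'
        simp only [smul_eq_mul, zero_add, zero_smul, add_zero]
        field_simp
        ring
      rw [this]
      nlinarith
    exact nonneg_of_mul_nonneg_right h4 ht.1
  linarith

/-- Variational inequality at a minimizer of a composite objective. -/
lemma IsArgmin.variational [CompleteSpace E] {s : Set E} (hs : Convex ℝ s) {m : ℝ} {h g : E → ℝ}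
    {x p : E} (hg : StrongConvexOn s m g) (hh : HasGradientAt h p x)
    (hmin : IsArgmin s (fun y => h y + g y) x) {y : E} (hy : y ∈ s) :
    0 ≤ ⟪p, y - x⟫_ℝ + g y - g x - m / 2 * ‖y - x‖ ^ 2 :=
  first_order_along_segment hg hmin.1 hy hh fun _ h0 h1 =>
    hmin.2 _ (segment_point_mem hs hmin.1 hy h0.le h1)

lemma HasGradientAt.neg' [CompleteSpace E] {h : E → ℝ} {p x : E} (hh : HasGradientAt h p x) :
    HasGradientAt (fun y => -h y) (-p) x := by
  rw [hasGradientAt_iff_hasFDerivAt] at *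
  exact hh.neg.congr_fderiv (by simp)

lemma HasGradientAt.add' [CompleteSpace E] {h k : E → ℝ} {p q x : E} (hh : HasGradientAt h p x)
    (hk : HasGradientAt k q x) : HasGradientAt (fun y => h y + k y) (p + q) x := by
  rw [hasGradientAt_iff_hasFDerivAt] at *
  exact (hh.add hk).congr_fderiv (by simp)

lemma hasGradientAt_inner [CompleteSpace E] (c x₁ x : E) :
    HasGradientAt (fun y => ⟪c, y - x₁⟫_ℝ) c x := by
  rw [hasGradientAt_iff_hasFDerivAt]
  have := ((InnerProductSpace.toDual ℝ E c).hasFDerivAt (x := x)).sub_const (⟪c, x₁⟫_ℝ)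
  refine this.congr_of_eventuallyEq (Eventually.of_forall fun y => ?_)
  simp [inner_sub_right]

lemma hasGradientAt_half_sq [CompleteSpace E] (τ : ℝ) (x₀ x : E) :
    HasGradientAt (fun y => τ / 2 * ‖y - x₀‖ ^ 2) (τ • (x - x₀)) x := by
  rw [hasGradientAt_iff_hasFDerivAt]
  have := (((hasFDerivAt_id (𝕜 := ℝ) x).sub_const x₀).norm_sq).const_mul (τ / 2)
  refine this.congr_fderiv ?_
  ext v
  simp
  ring

/-- Tangent-plane inequality. -/
lemma ConvexOn.le_sub_of_hasGradientAt [CompleteSpace E] {s : Set E} {g : E → ℝ} {x y p : E}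
    (hg : ConvexOn ℝ s g) (hx : x ∈ s) (hy : y ∈ s) (hp : HasGradientAt g p x) :
    ⟪p, y - x⟫_ℝ ≤ g y - g x := by
  -- With `h = -g` the sum `h + g` is constant, so every point is a minimizer.
  have := first_order_along_segment (strongConvexOn_zero.2 hg) hx hy hp.neg'
    (fun t _ _ => by simp)
  simp only [inner_neg_left] at this
  linarith

lemma ConvexOn.gradient_monotone [CompleteSpace E] {s : Set E} {g : E → ℝ} {x y p q : E}
    (hg : ConvexOn ℝ s g) (hx : x ∈ s) (hy : y ∈ s) (hp : HasGradientAt g p x)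
    (hq : HasGradientAt g q y) : 0 ≤ ⟪p - q, x - y⟫_ℝ := by
  have h1 := hg.le_sub_of_hasGradientAt hx hy hp
  have h2 := hg.le_sub_of_hasGradientAt hy hx hq
  have h3 : ⟪p, y - x⟫_ℝ = -⟪p, x - y⟫_ℝ := by rw [← inner_neg_right, neg_sub]
  rw [inner_sub_left]
  linarith

/-- Quadratic upper bound for a function whose gradient grows at most linearly along a segment. -/
lemma le_quadratic_of_gradient_le [CompleteSpace E] {h : E → ℝ} {gr : E → E} {x y : E} {L : ℝ}
    (hh : ∀ t ∈ Icc (0 : ℝ) 1, HasGradientAt h (gr (x + t • (y - x))) (x + t • (y - x)))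
    (hL : ∀ t ∈ Icc (0 : ℝ) 1, ‖gr (x + t • (y - x)) - gr x‖ ≤ L * (t * ‖y - x‖)) :
    h y ≤ h x + ⟪gr x, y - x⟫_ℝ + L / 2 * ‖y - x‖ ^ 2 := by
  set d := y - x with hd
  -- Mean value theorem for `h` along the segment minus its claimed quadratic majorant; the
  -- hypothesis `hL` makes this derivative nonpositive.
  have hder : ∀ t ∈ Icc (0 : ℝ) 1, HasDerivAt
      (fun r : ℝ => h (x + r • d) - r * ⟪gr x, d⟫_ℝ - r ^ 2 * (L / 2 * ‖d‖ ^ 2))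
      (⟪gr (x + t • d), d⟫_ℝ - ⟪gr x, d⟫_ℝ - 2 * t * (L / 2 * ‖d‖ ^ 2)) t := by
    intro t ht
    have h1 := hasDerivAt_line (hh t ht)
    have h2 := (hasDerivAt_id t).mul_const ⟪gr x, d⟫_ℝ
    have h3 := (hasDerivAt_pow 2 t).mul_const (L / 2 * ‖d‖ ^ 2)
    refine ((h1.sub h2).sub h3).congr_deriv ?_
    simp
  obtain ⟨c, hc, hceq⟩ := exists_hasDerivAt_eq_slope
    (fun r : ℝ => h (x + r • d) - r * ⟪gr x, d⟫_ℝ - r ^ 2 * (L / 2 * ‖d‖ ^ 2)) _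
    zero_lt_one (fun t ht => (hder t ht).continuousAt.continuousWithinAt)
    (fun t ht => hder t (Ioo_subset_Icc_self ht))
  have hle : ⟪gr (x + c • d), d⟫_ℝ - ⟪gr x, d⟫_ℝ ≤ c * (L * ‖d‖ ^ 2) := by
    rw [← inner_sub_left]
    calc ⟪gr (x + c • d) - gr x, d⟫_ℝ ≤ ‖gr (x + c • d) - gr x‖ * ‖d‖ := real_inner_le_norm _ _
      _ ≤ L * (c * ‖d‖) * ‖d‖ := by
        gcongr; exact hL c (Ioo_subset_Icc_self hc)
      _ = _ := by ring
  have hy' : x + d = y := by rw [hd]; abel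
  simp only [one_smul, zero_smul, add_zero, hy', sub_zero, div_one, one_mul, one_pow] at hceq
  nlinarith

/-- A convex function on an open set is bounded below by a downward cone at each point. -/
lemma ConvexOn.exists_cone_lower_bound [FiniteDimensional ℝ E] {O : Set E} (hO : IsOpen O)
    {g : E → ℝ} (hg : ConvexOn ℝ O g) {z : E} (hz : z ∈ O) :
    ∃ C : ℝ, 0 ≤ C ∧ ∀ x ∈ O, g z - C * ‖x - z‖ ≤ g x := by
  obtain ⟨K, t, ht, hlip⟩ := hg.locallyLipschitzOn hO hz
  rw [hO.nhdsWithin_eq hz] at ht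
  refine ⟨K, K.2, fun x hx => ?_⟩
  have hcont : Tendsto (fun r : ℝ => z + r • (x - z)) (𝓝[>] 0) (𝓝 z) := by
    have : Continuous (fun r : ℝ => z + r • (x - z)) := by fun_prop
    simpa using (this.tendsto 0).mono_left nhdsWithin_le_nhds
  -- A local Lipschitz bound at `z` suffices: convexity transports it from a nearby point of the
  -- segment to `x`.
  obtain ⟨r, hr, hr01⟩ := ((hcont.eventually ht).and
    (Ioc_mem_nhdsGT (show (0 : ℝ) < 1 by norm_num))).exists
  have h1 := hg.2 hz hx (show 0 ≤ 1 - r by linarith [hr01.2]) hr01.1.le (by ring)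
  have h3 : (1 - r) • z + r • x = z + r • (x - z) := by module
  rw [h3] at h1
  have h4 := hlip.dist_le_mul _ hr _ (mem_of_mem_nhds ht)
  rw [Real.dist_eq, dist_eq_norm, add_sub_cancel_left, norm_smul, Real.norm_of_nonneg hr01.1.le]
    at h4
  have h5 := (abs_le.1 h4).1
  simp only [smul_eq_mul] at h1
  have : 0 ≤ r * (g x - (g z - K * ‖x - z‖)) := by nlinarith
  have := nonneg_of_mul_nonneg_right this hr01.1
  linarith

lemma StrongConvexOn.exists_cone_lower_bound [FiniteDimensional ℝ E] {O : Set E} (hO : IsOpen O)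
    {g : E → ℝ} {m : ℝ} (hg : StrongConvexOn O m g) {z : E} (hz : z ∈ O) :
    ∃ C : ℝ, 0 ≤ C ∧ ∀ x ∈ O, g z - C * ‖x - z‖ + m / 2 * ‖x - z‖ ^ 2 ≤ g x := by
  obtain ⟨C, hC, h⟩ := (strongConvexOn_iff_convex.1 hg).exists_cone_lower_bound hO hz
  -- The convex part is `g - m/2 ‖·‖²`; the extra `|m| * ‖z‖` pays for recentering the quadratic
  -- from the origin to `z`.
  refine ⟨C + |m| * ‖z‖, by positivity, fun x hx => ?_⟩
  have h1 := h x hx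
  have h2 : ‖x‖ ^ 2 = ‖x - z‖ ^ 2 + 2 * ⟪z, x - z⟫_ℝ + ‖z‖ ^ 2 := by
    have := norm_add_sq_real (x - z) z
    rw [sub_add_cancel, real_inner_comm] at this
    exact this
  have h3 : |m * ⟪z, x - z⟫_ℝ| ≤ |m| * (‖z‖ * ‖x - z‖) := by
    rw [abs_mul]; gcongr; exact abs_real_inner_le_norm _ _
  have h4 := (abs_le.1 h3).1
  rw [h2] at h1
  nlinarith

/-- Strongly convex objectives over closed convex sets have exactly one minimizer. -/
lemma existsUnique_isArgmin [FiniteDimensional ℝ E] {O s : Set E} (hO : IsOpen O) (hsO : s ⊆ O)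
    (hsc : IsClosed s) (hs : Convex ℝ s) (hne : s.Nonempty) {g : E → ℝ} {m : ℝ} (hm : 0 < m)
    (hg : StrongConvexOn O m g) : ∃! x, IsArgmin s g x := by
  have hcv : ConvexOn ℝ O g := by
    have := hg.mono hm.le
    rwa [strongConvexOn_zero] at this
  obtain ⟨z, hz⟩ := hne
  obtain ⟨C, hC, hlow⟩ := hg.exists_cone_lower_bound hO (hsO hz)
  have hcont : ContinuousOn g s := (hcv.continuousOn hO).mono hsO
  -- Beyond radius `2C/m` the quadratic growth beats the cone, so values there exceed `g z`.
  have hK : IsCompact (s ∩ Metric.closedBall z (2 * C / m)) :=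
    (isCompact_closedBall z _).inter_left hsc
  have hzK : z ∈ s ∩ Metric.closedBall z (2 * C / m) :=
    ⟨hz, Metric.mem_closedBall_self (by positivity)⟩
  obtain ⟨x, hx, hxmin⟩ := hK.exists_isMinOn ⟨z, hzK⟩ (hcont.mono inter_subset_left)
  refine ⟨x, ⟨hx.1, fun y hy => ?_⟩, ?_⟩
  · by_cases hyb : y ∈ Metric.closedBall z (2 * C / m)
    · exact hxmin ⟨hy, hyb⟩
    · rw [Metric.mem_closedBall, dist_eq_norm, not_le, div_lt_iff₀ hm] at hyb
      have h1 := hlow y (hsO hy)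
      have h2 : g x ≤ g z := hxmin hzK
      nlinarith [norm_nonneg (y - z)]
  · intro y hy
    have hst : StrictConvexOn ℝ s g := (hg.strictConvexOn hm).subset hsO hs
    exact hst.eq_of_isMinOn (fun w hw => hy.2 w hw)
      (fun w hw => (show g x ≤ g w from by
        refine le_trans ?_ (hy.2 w hw)
        by_cases hyb : y ∈ Metric.closedBall z (2 * C / m)
        · exact hxmin ⟨hy.1, hyb⟩
        · rw [Metric.mem_closedBall, dist_eq_norm, not_le, div_lt_iff₀ hm] at hyb
          have h1 := hlow y (hsO hy.1)
          have h2 : g x ≤ g z := hxmin hzK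
          nlinarith [norm_nonneg (y - z)])) hy.1 hx.1

/-- Proximal points depend Lipschitz-continuously on the linear term and on the center. -/
lemma prox_variational_lipschitz {s : Set E} {g : E → ℝ} {τ : ℝ} (hτ : 0 < τ)
    {p q x y a b : E} (ha : a ∈ s) (hb : b ∈ s)
    (h1 : ∀ w ∈ s, 0 ≤ ⟪p + τ • (a - x), w - a⟫_ℝ + g w - g a)
    (h2 : ∀ w ∈ s, 0 ≤ ⟪q + τ • (b - y), w - b⟫_ℝ + g w - g b) :
    ‖a - b‖ ≤ ‖p - q‖ / τ + ‖x - y‖ := by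
  have e1 := h1 b hb
  have e2 := h2 a ha
  have e3 : ⟪p + τ • (a - x), b - a⟫_ℝ + ⟪q + τ • (b - y), a - b⟫_ℝ
      = -⟪p - q, a - b⟫_ℝ + τ * ⟪x - y, a - b⟫_ℝ - τ * ‖a - b‖ ^ 2 := by
    rw [← real_inner_self_eq_norm_sq, ← neg_sub a b, inner_neg_right]
    simp only [inner_add_left, inner_sub_left, inner_sub_right, inner_smul_left, RCLike.conj_to_real]
    ring
  have e4 := (abs_le.1 (abs_real_inner_le_norm (p - q) (a - b))).1
  have e5 := real_inner_le_norm (x - y) (a - b)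
  have e6 : τ * ‖a - b‖ ^ 2 ≤ ‖a - b‖ * (‖p - q‖ + τ * ‖x - y‖) := by nlinarith
  rcases eq_or_lt_of_le (norm_nonneg (a - b)) with h0 | h0
  · rw [← h0]; positivity
  · have : τ * ‖a - b‖ ≤ ‖p - q‖ + τ * ‖x - y‖ := by
      by_contra hcon
      push Not at hcon
      nlinarith
    rw [div_add' _ _ _ hτ.ne', le_div_iff₀ hτ]
    linarith

end ConvexTools

/-! ### Hessian bounds on a convex set and the forward gradient step -/

section HessianTools

variable {E : Type*} [NormedAddCommGroup E] [InnerProductSpace ℝ E]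

/-- The second derivative is the limit of `⟪∇f (x + t w) - ∇f x, t w⟫ / t²`, which monotonicity and
the Lipschitz bound control. That bound holds only on `s`, which may have empty interior, so only
directions pointing into `s` are available. -/
lemma hessian_bounds_of_feasible [CompleteSpace E] {O s : Set E} (hO : IsOpen O) (hsO : s ⊆ O)
    (hs : Convex ℝ s) {f : E → ℝ} (hf : ContDiffOn ℝ 2 f O) (hcv : ConvexOn ℝ O f) {L : ℝ}
    (hL : ∀ y ∈ s, ∀ z ∈ s, ‖gradient f y - gradient f z‖ ≤ L * ‖y - z‖)
    {x w : E} (hx : x ∈ s) {r : ℝ} (hr : 0 < r) (hxw : x + r • w ∈ s) :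
    0 ≤ fderiv ℝ (fderiv ℝ f) x w w ∧ fderiv ℝ (fderiv ℝ f) x w w ≤ L * ‖w‖ ^ 2 := by
  have hdf : ∀ y ∈ O, DifferentiableAt ℝ f y := fun y hy =>
    (hf.contDiffAt (hO.mem_nhds hy)).differentiableAt (by norm_num)
  have hd2 : DifferentiableAt ℝ (fderiv ℝ f) x :=
    ((hf.contDiffAt (hO.mem_nhds (hsO hx))).fderiv_right (m := 1) (by norm_num)).differentiableAt
      (by norm_num)
  have hder : HasDerivAt (fun t : ℝ => fderiv ℝ f (x + t • w) w)
      (fderiv ℝ (fderiv ℝ f) x w w) 0 := by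
    have h1 : HasDerivAt (fun r : ℝ => x + r • w) w 0 := by
      simpa using ((hasDerivAt_id (0 : ℝ)).smul_const w).const_add x
    have h2 : HasFDerivAt (fderiv ℝ f) (fderiv ℝ (fderiv ℝ f) x) (x + (0 : ℝ) • w) := by
      simpa using hd2.hasFDerivAt
    have h3 := h2.comp_hasDerivAt (0 : ℝ) h1
    have h4 := h3.clm_apply (hasDerivAt_const (0 : ℝ) w)
    simpa using h4
  have hlim := hder.tendsto_slope_zero_right
  have hmem : ∀ t ∈ Ioc 0 r, x + t • w ∈ s := by
    intro t ht
    have := segment_point_mem hs hx hxw (div_nonneg ht.1.le hr.le) ((div_le_one hr).2 ht.2)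
    rwa [add_sub_cancel_left, smul_smul, div_mul_cancel₀ _ hr.ne'] at this
  have hquot : ∀ t ∈ Ioc 0 r,
      t⁻¹ • (fderiv ℝ f (x + (0 + t) • w) w - fderiv ℝ f (x + (0 : ℝ) • w) w)
        = (t⁻¹ * t⁻¹) * ⟪gradient f (x + t • w) - gradient f x, (x + t • w) - x⟫_ℝ := by
    intro t ht
    have ht0 := ht.1.ne'
    rw [inner_sub_left, inner_gradient_left, inner_gradient_left]
    simp
    field_simp
  constructor
  · refine ge_of_tendsto hlim ?_
    filter_upwards [Ioc_mem_nhdsGT hr] with t ht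
    rw [hquot t ht]
    have := hcv.gradient_monotone (hsO (hmem t ht)) (hsO hx)
      (hdf _ (hsO (hmem t ht))).hasGradientAt (hdf _ (hsO hx)).hasGradientAt
    exact mul_nonneg (mul_self_nonneg _) this
  · refine le_of_tendsto hlim ?_
    filter_upwards [Ioc_mem_nhdsGT hr] with t ht
    rw [hquot t ht]
    have h1 := hL _ (hmem t ht) _ hx
    have h2 : ⟪gradient f (x + t • w) - gradient f x, (x + t • w) - x⟫_ℝ
        ≤ (t * t) * (L * ‖w‖ ^ 2) := by
      refine (real_inner_le_norm _ _).trans ?_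
      rw [add_sub_cancel_left, norm_smul, Real.norm_of_nonneg ht.1.le] at *
      nlinarith [norm_nonneg w, ht.1, mul_nonneg ht.1.le (norm_nonneg w)]
    have ht0 := ht.1.ne'
    calc _ ≤ (t⁻¹ * t⁻¹) * ((t * t) * (L * ‖w‖ ^ 2)) :=
          mul_le_mul_of_nonneg_left h2 (mul_self_nonneg _)
      _ = _ := by field_simp

/-- The bounds on the Hessian extend to all directions feasible from some point of the set. -/
lemma hessian_bounds [CompleteSpace E] {O s : Set E} (hO : IsOpen O) (hsO : s ⊆ O)
    (hs : Convex ℝ s) {f : E → ℝ} (hf : ContDiffOn ℝ 2 f O) (hcv : ConvexOn ℝ O f) {L : ℝ}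
    (hL : ∀ y ∈ s, ∀ z ∈ s, ‖gradient f y - gradient f z‖ ≤ L * ‖y - z‖)
    {x w p : E} (hx : x ∈ s) (hp : p ∈ s) {r : ℝ} (hr : 0 < r) (hpw : p + r • w ∈ s) :
    0 ≤ fderiv ℝ (fderiv ℝ f) x w w ∧ fderiv ℝ (fderiv ℝ f) x w w ≤ L * ‖w‖ ^ 2 := by
  have hc2 : ContinuousAt (fderiv ℝ (fderiv ℝ f)) x :=
    ((hf.contDiffAt (hO.mem_nhds (hsO hx))).fderiv_right (m := 1) (by norm_num)).continuousAt_fderiv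
      (by norm_num)
  have hcont : Tendsto (fun t : ℝ => x + t • (p - x)) (𝓝[>] 0) (𝓝 x) := by
    have : Continuous (fun t : ℝ => x + t • (p - x)) := by fun_prop
    simpa using (this.tendsto 0).mono_left nhdsWithin_le_nhds
  have hlim : Tendsto (fun t : ℝ => fderiv ℝ (fderiv ℝ f) (x + t • (p - x)) w w) (𝓝[>] 0)
      (𝓝 (fderiv ℝ (fderiv ℝ f) x w w)) := by
    have h1 : Continuous (fun H : E →L[ℝ] E →L[ℝ] ℝ => H w w) := by fun_prop
    exact (h1.tendsto _).comp (hc2.tendsto.comp hcont)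
  -- Moving from `x` slightly towards `p` makes `w` feasible, with step `t * r`; continuity of the
  -- Hessian then gives the bounds at `x`.
  have hb : ∀ t ∈ Ioc (0 : ℝ) 1, 0 ≤ fderiv ℝ (fderiv ℝ f) (x + t • (p - x)) w w ∧
      fderiv ℝ (fderiv ℝ f) (x + t • (p - x)) w w ≤ L * ‖w‖ ^ 2 := by
    intro t ht
    refine hessian_bounds_of_feasible hO hsO hs hf hcv hL
      (segment_point_mem hs hx hp ht.1.le ht.2) (mul_pos ht.1 hr) ?_
    have := segment_point_mem hs hx hpw ht.1.le ht.2
    convert this using 1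
    module
  constructor
  · refine ge_of_tendsto hlim ?_
    filter_upwards [Ioc_mem_nhdsGT (show (0 : ℝ) < 1 by norm_num)] with t ht using (hb t ht).1
  · refine le_of_tendsto hlim ?_
    filter_upwards [Ioc_mem_nhdsGT (show (0 : ℝ) < 1 by norm_num)] with t ht using (hb t ht).2

/-- The forward gradient step is nonexpansive, tested against differences of feasible points. -/
lemma forward_step_nonexpansive [CompleteSpace E] {O s : Set E} (hO : IsOpen O) (hsO : s ⊆ O)
    (hs : Convex ℝ s) {f : E → ℝ} (hf : ContDiffOn ℝ 2 f O) (hcv : ConvexOn ℝ O f) {L τ : ℝ}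
    (hL : ∀ y ∈ s, ∀ z ∈ s, ‖gradient f y - gradient f z‖ ≤ L * ‖y - z‖) (hτ : L / 2 ≤ τ)
    {x z u v : E} (hx : x ∈ s) (hz : z ∈ s) (hu : u ∈ s) (hv : v ∈ s) :
    ⟪τ • (x - z) - (gradient f x - gradient f z), u - v⟫_ℝ ≤ τ * ‖x - z‖ * ‖u - v‖ := by
  set a := x - z with ha
  set b := u - v with hb
  -- From the barycenter of the four points, every direction in the span of `x - z` and `u - v` is
  -- feasible.
  set p : E := (1 / 4 : ℝ) • (x + z + u + v) with hp
  have hcomb : ∀ α β : ℝ, |α| ≤ 1 → |β| ≤ 1 → p + (1 / 4 : ℝ) • (α • a + β • b) ∈ s := by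
    intro α β hα hβ
    rw [abs_le] at hα hβ
    have h1 : (1 / 2 : ℝ) • (((1 + α) / 2) • x + ((1 - α) / 2) • z)
        + (1 / 2 : ℝ) • (((1 + β) / 2) • u + ((1 - β) / 2) • v) ∈ s :=
      hs (hs hx hz (by linarith) (by linarith) (by ring))
        (hs hu hv (by linarith) (by linarith) (by ring)) (by norm_num) (by norm_num) (by norm_num)
    convert h1 using 1
    rw [hp, ha, hb]
    module
  have hps : p ∈ s := by simpa using hcomb 0 0 (by simp) (by simp)
  -- This is `0 ≤ H ≤ L ≤ 2τ` on the span of `a` and `b`, rewritten as a bound on the quadratic form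
  -- of `τ - H`.
  have hquad : ∀ y ∈ s, ∀ α β : ℝ,
      |τ * ‖α • a + β • b‖ ^ 2
        - fderiv ℝ (fderiv ℝ f) y (α • a + β • b) (α • a + β • b)|
        ≤ τ * ‖α • a + β • b‖ ^ 2 := by
    intro y hy α β
    set M := |α| + |β| + 1 with hM
    have hM0 : 0 < M := by positivity
    have hmem : p + (1 / 4 * M⁻¹ : ℝ) • (α • a + β • b) ∈ s := by
      have := hcomb (M⁻¹ * α) (M⁻¹ * β)
        (by rw [abs_mul, abs_of_pos (inv_pos.2 hM0), inv_mul_le_iff₀ hM0]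
            linarith [abs_nonneg β])
        (by rw [abs_mul, abs_of_pos (inv_pos.2 hM0), inv_mul_le_iff₀ hM0]
            linarith [abs_nonneg α])
      convert this using 1
      module
    obtain ⟨h1, h2⟩ := hessian_bounds hO hsO hs hf hcv hL hy hps (by positivity) hmem
    rw [abs_le]
    constructor <;> nlinarith [sq_nonneg ‖α • a + β • b‖]
  -- Polarization with `‖b‖ a ± ‖a‖ b`: the two vectors are balanced so that the parallelogram law
  -- gives exactly `τ ‖a‖ ‖b‖`.
  have hbil : ∀ y ∈ s, τ * ⟪a, b⟫_ℝ - fderiv ℝ (fderiv ℝ f) y a b ≤ τ * ‖a‖ * ‖b‖ := by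
    intro y hy
    have hsymm : fderiv ℝ (fderiv ℝ f) y b a = fderiv ℝ (fderiv ℝ f) y a b :=
      (hf.contDiffAt (hO.mem_nhds (hsO hy))).isSymmSndFDerivAt (by simp) b a
    rcases eq_or_ne a 0 with h0 | h0
    · simp [h0]
    rcases eq_or_ne b 0 with h0' | h0'
    · simp [h0']
    have hna : 0 < ‖a‖ := norm_pos_iff.2 h0
    have hnb : 0 < ‖b‖ := norm_pos_iff.2 h0'
    have h1 := (abs_le.1 (hquad y hy ‖b‖ ‖a‖)).2
    have h2 := (abs_le.1 (hquad y hy ‖b‖ (-‖a‖))).1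
    have e1 : ‖‖b‖ • a + ‖a‖ • b‖ ^ 2
        = 2 * ‖a‖ ^ 2 * ‖b‖ ^ 2 + 2 * ‖a‖ * ‖b‖ * ⟪a, b⟫_ℝ := by
      rw [norm_add_sq_real, norm_smul, norm_smul, inner_smul_left, inner_smul_right]
      simp; ring
    have e2 : ‖‖b‖ • a + (-‖a‖) • b‖ ^ 2
        = 2 * ‖a‖ ^ 2 * ‖b‖ ^ 2 - 2 * ‖a‖ * ‖b‖ * ⟪a, b⟫_ℝ := by
      rw [norm_add_sq_real, norm_smul, norm_smul, inner_smul_left, inner_smul_right]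
      simp; ring
    rw [e1] at h1
    rw [e2] at h2
    simp only [map_add, map_smul, add_apply, smul_apply,
      smul_eq_mul, hsymm] at h1 h2
    have h3 : (4 * (‖a‖ * ‖b‖)) * (τ * ⟪a, b⟫_ℝ - fderiv ℝ (fderiv ℝ f) y a b)
        ≤ (4 * (‖a‖ * ‖b‖)) * (τ * ‖a‖ * ‖b‖) := by nlinarith
    exact le_of_mul_le_mul_left h3 (by positivity)
  have hder : ∀ t ∈ Icc (0 : ℝ) 1, HasDerivAt
      (fun r : ℝ => r * (τ * ⟪a, b⟫_ℝ) - fderiv ℝ f (z + r • a) b)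
      (τ * ⟪a, b⟫_ℝ - fderiv ℝ (fderiv ℝ f) (z + t • a) a b) t := by
    intro t ht
    have hmem : z + t • a ∈ O := hsO (segment_point_mem hs hz hx ht.1 ht.2)
    have hd2 : DifferentiableAt ℝ (fderiv ℝ f) (z + t • a) :=
      ((hf.contDiffAt (hO.mem_nhds hmem)).fderiv_right (m := 1) (by norm_num)).differentiableAt
        (by norm_num)
    have h1 : HasDerivAt (fun r : ℝ => z + r • a) a t := by
      simpa using ((hasDerivAt_id t).smul_const a).const_add z
    have h3 := hd2.hasFDerivAt.comp_hasDerivAt t h1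
    have h4 := h3.clm_apply (hasDerivAt_const t b)
    have h5 := (hasDerivAt_id t).mul_const (τ * ⟪a, b⟫_ℝ)
    refine (h5.sub h4).congr_deriv ?_
    simp
  obtain ⟨c, hc, hceq⟩ := exists_hasDerivAt_eq_slope
    (fun r : ℝ => r * (τ * ⟪a, b⟫_ℝ) - fderiv ℝ f (z + r • a) b) _
    zero_lt_one (fun t ht => (hder t ht).continuousAt.continuousWithinAt)
    (fun t ht => hder t (Ioo_subset_Icc_self ht))
  have hfin := hbil _ (segment_point_mem hs hz hx hc.1.le hc.2.le)
  have hxz : z + a = x := by rw [ha]; abel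
  simp only [one_smul, zero_smul, add_zero, sub_zero, div_one, hxz] at hceq
  rw [inner_sub_left, inner_sub_left, inner_smul_left, inner_gradient_left, inner_gradient_left]
  simp only [RCLike.conj_to_real]
  linarith

end HessianTools

/-! ### Spread of a family -/

section SpreadBasic

variable {ι V : Type*} [SeminormedAddCommGroup V]

/-- The largest distance between two members of a family. -/
noncomputable def spread (x : ι → V) : ℝ :=
  ⨆ p : ι × ι, ‖x p.1 - x p.2‖

lemma spread_le [Nonempty ι] {x : ι → V} {r : ℝ} (h : ∀ i j, ‖x i - x j‖ ≤ r) : spread x ≤ r :=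
  ciSup_le fun p => h p.1 p.2

lemma spread_nonneg (x : ι → V) : 0 ≤ spread x :=
  Real.iSup_nonneg fun _ => norm_nonneg _

end SpreadBasic

/-! ### Mixing matrices and perturbed push-sum averaging -/

section Network

variable {ι : Type*} [Fintype ι]

/-- The backward product `A (s + k - 1) * ⋯ * A s`. -/
noncomputable def transition [DecidableEq ι] (A : ℕ → Matrix ι ι ℝ) (s : ℕ) : ℕ → Matrix ι ι ℝ
  | 0 => 1
  | k + 1 => A (s + k) * transition A s k

namespace WeightAssumptions

variable {E : ℕ → ι → ι → Prop} {A : ℕ → Matrix ι ι ℝ} {κ : ℝ}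

lemma nonneg (hA : WeightAssumptions E A κ) (ν : ℕ) (i j : ι) : 0 ≤ A ν i j := by
  by_cases h : E ν j i
  · exact hA.pos.le.trans (hA.link ν i j h)
  · by_cases hij : i = j
    · subst hij; exact hA.pos.le.trans (hA.diag ν i)
    · exact (hA.nolink ν i j hij h).ge

lemma kappa_le_one [Nonempty ι] (hA : WeightAssumptions E A κ) : κ ≤ 1 := by
  obtain ⟨i⟩ := ‹Nonempty ι›
  refine (hA.diag 0 i).trans ?_
  rw [← hA.colsum 0 i]
  exact Finset.single_le_sum (f := fun k => A 0 k i) (fun k _ => hA.nonneg 0 k i)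
    (Finset.mem_univ i)

variable [DecidableEq ι]

lemma transition_nonneg (hA : WeightAssumptions E A κ) (s k : ℕ) (i j : ι) :
    0 ≤ transition A s k i j := by
  induction k generalizing i with
  | zero => simp only [transition, Matrix.one_apply]; split_ifs <;> norm_num
  | succ k ih =>
    rw [transition, Matrix.mul_apply]
    exact Finset.sum_nonneg fun l _ => mul_nonneg (hA.nonneg _ _ _) (ih l)

lemma transition_step (hA : WeightAssumptions E A κ) {s k : ℕ} {i j a : ι}
    (hij : κ ≤ A (s + k) i j) (h : κ ^ k ≤ transition A s k j a) :
    κ ^ (k + 1) ≤ transition A s (k + 1) i a := by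
  rw [transition, Matrix.mul_apply]
  calc κ ^ (k + 1) = κ * κ ^ k := by ring
    _ ≤ A (s + k) i j * transition A s k j a :=
      mul_le_mul hij h (pow_nonneg hA.pos.le _) (hA.nonneg _ _ _)
    _ ≤ _ := Finset.single_le_sum (f := fun l => A (s + k) i l * transition A s k l a)
      (fun l _ => mul_nonneg (hA.nonneg _ _ _) (hA.transition_nonneg _ _ _ _)) (Finset.mem_univ j)

lemma transition_persist (hA : WeightAssumptions E A κ) {s k l : ℕ} (hkl : k ≤ l) {j a : ι}
    (h : κ ^ k ≤ transition A s k j a) : κ ^ l ≤ transition A s l j a := by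
  induction l, hkl using Nat.le_induction with
  | base => exact h
  | succ l _ ih => exact hA.transition_step (hA.diag _ _) ih

/-- The number of agents that a given agent influences with a definite weight grows with each
window. -/
lemma card_influenced [Nonempty ι] (hA : WeightAssumptions E A κ) {B : ℕ}
    (hconn : ∀ k : ℕ, ∀ a b : ι,
      Relation.ReflTransGen (fun c d => ∃ t, k * B ≤ t ∧ t < (k + 1) * B ∧ E t c d) a b)
    (s k₀ : ℕ) (hs : s ≤ k₀ * B) (a : ι) (m : ℕ) :
    min (m + 1) (Fintype.card ι) ≤
      (Finset.univ.filter fun i => κ ^ ((k₀ + m) * B - s) ≤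
        transition A s ((k₀ + m) * B - s) i a).card := by
  induction m with
  | zero =>
    refine (min_le_left _ _).trans ?_
    rw [zero_add, Nat.one_le_iff_ne_zero, Finset.card_ne_zero]
    refine ⟨a, Finset.mem_filter.2 ⟨Finset.mem_univ _, hA.transition_persist (Nat.zero_le _) ?_⟩⟩
    simp [transition]
  | succ m ih =>
    set R := Finset.univ.filter fun i => κ ^ ((k₀ + m) * B - s) ≤
        transition A s ((k₀ + m) * B - s) i a with hR
    set R' := Finset.univ.filter fun i => κ ^ ((k₀ + (m + 1)) * B - s) ≤
        transition A s ((k₀ + (m + 1)) * B - s) i a with hR'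
    have hle : (k₀ + m) * B ≤ (k₀ + (m + 1)) * B := Nat.mul_le_mul_right _ (by omega)
    have hk0 : k₀ * B ≤ (k₀ + m) * B := Nat.mul_le_mul_right _ (by omega)
    have hsub : R ⊆ R' := by
      intro i hi
      rw [hR, Finset.mem_filter] at hi
      exact Finset.mem_filter.2 ⟨Finset.mem_univ _, hA.transition_persist (by omega) hi.2⟩
    by_cases hfull : R = Finset.univ
    · have : R' = Finset.univ := Finset.univ_subset_iff.1 (hfull ▸ hsub)
      rw [this]
      exact min_le_right _ _
    -- If the window added nobody, following a path of its union graph from `a` would never leave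
    -- `R`, so `R` would already contain every agent.
    · have hss : R ⊂ R' := by
        refine Finset.ssubset_iff_subset_ne.2 ⟨hsub, fun heq => hfull ?_⟩
        refine Finset.eq_univ_iff_forall.2 fun b => ?_
        have haR : a ∈ R := by
          refine Finset.mem_filter.2 ⟨Finset.mem_univ _, hA.transition_persist (Nat.zero_le _) ?_⟩
          simp [transition]
        refine Relation.ReflTransGen.head_induction_on (motive := fun c _ => c ∈ R → b ∈ R)
          (hconn (k₀ + m) a b) (fun h => h) ?_ haR
        rintro c d ⟨t, ht1, ht2, hE⟩ _ ih2 hc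
        refine ih2 ?_
        rw [heq]
        have hc' := (Finset.mem_filter.1 hc).2
        have h1 := hA.transition_persist (show (k₀ + m) * B - s ≤ t - s by omega) hc'
        have h2 : κ ≤ A (s + (t - s)) d c := by
          rw [show s + (t - s) = t by omega]
          exact hA.link t d c hE
        have h3 := hA.transition_step h2 h1
        have ht2' : t < (k₀ + (m + 1)) * B := by rw [← add_assoc]; exact ht2
        exact Finset.mem_filter.2 ⟨Finset.mem_univ _, hA.transition_persist (by omega) h3⟩
      have := Finset.card_lt_card hss
      omega

/-- At most `B` steps lead from `s` to the next window boundary, and each following window adds an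
influenced agent until none is left. Hence `card ι + 1` window lengths suffice from any start, and
the self-loops keep the bound alive until then. -/
lemma exists_transition_lower_bound [Nonempty ι] (hA : WeightAssumptions E A κ)
    (hE : BStronglyConnected E) :
    ∃ T : ℕ, ∀ s i j, κ ^ T ≤ transition A s T i j := by
  obtain ⟨B, hB, hconn⟩ := hE
  refine ⟨(Fintype.card ι + 1) * B, fun s i j => ?_⟩
  have hs1 : s ≤ (s / B + 1) * B := by
    exact (Nat.lt_mul_of_div_lt (Nat.lt_succ_self (s / B)) hB).le
  have hs2 : s / B * B ≤ s := Nat.div_mul_le_self s B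
  have h := hA.card_influenced hconn s (s / B + 1) hs1 j (Fintype.card ι)
  rw [min_eq_right (by omega)] at h
  have huniv := Finset.eq_univ_of_card _ (le_antisymm (Finset.card_le_univ _) h)
  have hi : i ∈ (Finset.univ : Finset ι) := Finset.mem_univ i
  rw [← huniv, Finset.mem_filter] at hi
  refine hA.transition_persist ?_ hi.2
  have : (s / B + 1 + Fintype.card ι) * B = s / B * B + (Fintype.card ι + 1) * B := by ring
  omega

end WeightAssumptions

section Spread

variable {V : Type*} [SeminormedAddCommGroup V]

lemma norm_sub_le_spread (x : ι → V) (i j : ι) : ‖x i - x j‖ ≤ spread x :=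
  le_ciSup (f := fun p : ι × ι => ‖x p.1 - x p.2‖) (Set.finite_range _).bddAbove (i, j)

variable [NormedSpace ℝ V]

lemma norm_sub_average_le {x : ι → V} {w : ι → ℝ} (hw : ∀ i, 0 ≤ w i) (hs : ∑ i, w i = 1)
    {v : V} {r : ℝ} (h : ∀ i, ‖v - x i‖ ≤ r) : ‖v - ∑ i, w i • x i‖ ≤ r := by
  have h1 : v - ∑ i, w i • x i = ∑ i, w i • (v - x i) := by
    simp only [smul_sub, Finset.sum_sub_distrib, ← Finset.sum_smul, hs, one_smul]
  rw [h1]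
  calc ‖∑ i, w i • (v - x i)‖ ≤ ∑ i, w i * r := by
        refine norm_sum_le_of_le _ fun i _ => ?_
        rw [norm_smul, Real.norm_of_nonneg (hw i)]
        exact mul_le_mul_of_nonneg_left (h i) (hw i)
    _ = r := by rw [← Finset.sum_mul, hs, one_mul]

/-- Averaging with weights bounded below contracts the spread. -/
lemma norm_average_sub_average_le [Nonempty ι] {x : ι → V} {w w' : ι → ℝ} {η : ℝ}
    (hw : ∀ i, η ≤ w i) (hs : ∑ i, w i = 1) (hw' : ∀ i, η ≤ w' i) (hs' : ∑ i, w' i = 1) :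
    ‖∑ i, w i • x i - ∑ i, w' i • x i‖ ≤ (1 - Fintype.card ι * η) * spread x := by
  set θ := 1 - Fintype.card ι * η with hθ
  have hsum : ∑ i, (w i - η) = θ := by
    rw [Finset.sum_sub_distrib, hs]; simp [hθ]
  have hsum' : ∑ i, (w' i - η) = θ := by
    rw [Finset.sum_sub_distrib, hs']; simp [hθ]
  have hθ0 : 0 ≤ θ := hsum ▸ Finset.sum_nonneg fun i _ => sub_nonneg.2 (hw i)
  -- The common part with constant weight `η` cancels; what remains are nonnegative weights of total
  -- mass `θ`, which are normalized unless `θ = 0`.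
  have h0 : ∑ i, w i • x i - ∑ i, w' i • x i
      = ∑ i, (w i - η) • x i - ∑ i, (w' i - η) • x i := by
    simp only [sub_smul, Finset.sum_sub_distrib]; abel
  rw [h0]
  rcases eq_or_lt_of_le hθ0 with h | h
  · have z1 : ∀ i, w i - η = 0 := fun i =>
      (Finset.sum_eq_zero_iff_of_nonneg fun i _ => sub_nonneg.2 (hw i)).1 (hsum.trans h.symm) i
        (Finset.mem_univ i)
    have z2 : ∀ i, w' i - η = 0 := fun i =>
      (Finset.sum_eq_zero_iff_of_nonneg fun i _ => sub_nonneg.2 (hw' i)).1 (hsum'.trans h.symm) i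
        (Finset.mem_univ i)
    simp [z1, z2, ← h]
  · have e1 : ∀ u : ι → ℝ, ∑ i, (u i - η) • x i = θ • ∑ i, (θ⁻¹ * (u i - η)) • x i := by
      intro u
      rw [Finset.smul_sum]
      refine Finset.sum_congr rfl fun i _ => ?_
      rw [smul_smul, mul_inv_cancel_left₀ h.ne']
    rw [e1 w, e1 w', ← smul_sub, norm_smul, Real.norm_of_nonneg hθ0]
    refine mul_le_mul_of_nonneg_left ?_ hθ0
    have p1 : ∀ i, 0 ≤ θ⁻¹ * (w i - η) := fun i =>
      mul_nonneg (inv_nonneg.2 hθ0) (sub_nonneg.2 (hw i))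
    have p2 : ∀ i, 0 ≤ θ⁻¹ * (w' i - η) := fun i =>
      mul_nonneg (inv_nonneg.2 hθ0) (sub_nonneg.2 (hw' i))
    have q1 : ∑ i, θ⁻¹ * (w i - η) = 1 := by
      rw [← Finset.mul_sum, hsum, inv_mul_cancel₀ h.ne']
    have q2 : ∑ i, θ⁻¹ * (w' i - η) = 1 := by
      rw [← Finset.mul_sum, hsum', inv_mul_cancel₀ h.ne']
    refine norm_sub_average_le p2 q2 fun j => ?_
    rw [norm_sub_rev]
    refine norm_sub_average_le p1 q1 fun i => ?_
    exact norm_sub_le_spread x j i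

end Spread

section PushSum

variable {V : Type*} [NormedAddCommGroup V] [NormedSpace ℝ V]
variable {E : ℕ → ι → ι → Prop} {A : ℕ → Matrix ι ι ℝ} {κ : ℝ}

lemma WeightAssumptions.sum_norm_mix_le (hA : WeightAssumptions E A κ) (ν : ℕ) (y : ι → V) :
    ∑ i, ‖∑ j, A ν i j • y j‖ ≤ ∑ j, ‖y j‖ := by
  calc ∑ i, ‖∑ j, A ν i j • y j‖ ≤ ∑ i, ∑ j, A ν i j * ‖y j‖ :=
        Finset.sum_le_sum fun i _ => norm_sum_le_of_le _ fun j _ => by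
          rw [norm_smul, Real.norm_of_nonneg (hA.nonneg ν i j)]
    _ = ∑ j, ‖y j‖ := by
        rw [Finset.sum_comm]
        simp only [← Finset.sum_mul, hA.colsum, one_mul]

/-- Column-stochastic mixing does not increase the sum of norms over the agents, so the propagated
perturbations never exceed what was injected. -/
lemma WeightAssumptions.exists_unrolled [DecidableEq ι] (hA : WeightAssumptions E A κ)
    {y e : ℕ → ι → V} (hy : ∀ ν i, y (ν + 1) i = ∑ j, A ν i j • y ν j + e ν i) (s k : ℕ) :
    ∃ r : ι → V, (∀ i, y (s + k) i = ∑ j, transition A s k i j • y s j + r i) ∧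
      ∑ i, ‖r i‖ ≤ ∑ t ∈ Finset.range k, ∑ i, ‖e (s + t) i‖ := by
  induction k with
  | zero => exact ⟨fun _ => 0, fun i => by simp [transition, Matrix.one_apply], by simp⟩
  | succ k ih =>
    obtain ⟨r, h1, h2⟩ := ih
    refine ⟨fun i => ∑ j, A (s + k) i j • r j + e (s + k) i, fun i => ?_, ?_⟩
    · rw [← add_assoc, hy, ← add_assoc]
      congr 1
      simp only [h1, smul_add, Finset.sum_add_distrib, transition, Matrix.mul_apply,
        Finset.sum_smul, Finset.smul_sum, smul_smul]
      congr 1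
      rw [Finset.sum_comm]
    · rw [Finset.sum_range_succ]
      calc _ ≤ ∑ i, (‖∑ j, A (s + k) i j • r j‖ + ‖e (s + k) i‖) :=
            Finset.sum_le_sum fun i _ => norm_add_le _ _
        _ = ∑ i, ‖∑ j, A (s + k) i j • r j‖ + ∑ i, ‖e (s + k) i‖ := Finset.sum_add_distrib
        _ ≤ _ := by
          gcongr
          exact (hA.sum_norm_mix_le _ _).trans h2

/-- Push-sum weights stay bounded away from zero and keep their total mass, and perturbed push-sum
averaging contracts the spread over windows of fixed length. -/
lemma WeightAssumptions.exists_contraction [Nonempty ι] (hA : WeightAssumptions E A κ)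
    (hE : BStronglyConnected E) {φ : ℕ → ι → ℝ} (h0 : ∀ i, φ 0 i = 1)
    (hφ : ∀ ν i, φ (ν + 1) i = ∑ j, A ν i j * φ ν j) :
    ∃ (T : ℕ) (ρ c : ℝ), 0 ≤ ρ ∧ ρ < 1 ∧ 0 < c ∧
      (∀ ν, ∑ i, φ ν i = Fintype.card ι) ∧ (∀ ν i, c ≤ φ ν i) ∧
      ∀ x e : ℕ → ι → V,
        (∀ ν i, φ (ν + 1) i • x (ν + 1) i = ∑ j, A ν i j • (φ ν j • x ν j) + e ν i) →
        ∀ ν, spread (x (ν + T)) ≤ ρ * spread (x ν)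
          + 2 / c * ∑ t ∈ Finset.range T, ∑ i, ‖e (ν + t) i‖ := by
  classical
  obtain ⟨T, hlow⟩ := hA.exists_transition_lower_bound hE
  have hκ1 := hA.kappa_le_one
  have hκT : 0 < κ ^ T := pow_pos hA.pos T
  have hN : (0 : ℝ) < Fintype.card ι := by exact_mod_cast Fintype.card_pos
  have hN1 : (1 : ℝ) ≤ Fintype.card ι := by exact_mod_cast Fintype.card_pos
  have hmass : ∀ ν, ∑ i, φ ν i = Fintype.card ι := by
    intro ν
    induction ν with
    | zero => simp [h0]
    | succ ν ih =>
      simp only [hφ]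
      rw [Finset.sum_comm]
      simp only [← Finset.sum_mul, hA.colsum, one_mul, ih]
  -- A bound through self-loops alone; it decays with `ν` and is needed only for positivity and for
  -- the first `T` steps.
  have hnn : ∀ ν i, κ ^ ν ≤ φ ν i := by
    intro ν
    induction ν with
    | zero => intro i; simp [h0]
    | succ ν ih =>
      intro i
      have hpos : ∀ j, 0 ≤ φ ν j := fun j => (pow_nonneg hA.pos.le _).trans (ih j)
      rw [hφ]
      calc κ ^ (ν + 1) = κ * κ ^ ν := by ring
        _ ≤ A ν i i * φ ν i := mul_le_mul (hA.diag ν i) (ih i) (pow_nonneg hA.pos.le _)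
            (hA.nonneg _ _ _)
        _ ≤ _ := Finset.single_le_sum (f := fun j => A ν i j * φ ν j)
            (fun j _ => mul_nonneg (hA.nonneg _ _ _) (hpos j)) (Finset.mem_univ i)
  have hpos : ∀ ν i, 0 ≤ φ ν i := fun ν i => (pow_nonneg hA.pos.le _).trans (hnn ν i)
  have hunroll : ∀ s k i, φ (s + k) i = ∑ j, transition A s k i j * φ s j := by
    intro s k i
    obtain ⟨r, h1, h2⟩ := hA.exists_unrolled (y := φ) (e := fun _ _ => (0 : ℝ))
      (fun ν i => by simp [hφ]) s k
    have hr : ∑ i, ‖r i‖ = 0 :=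
      le_antisymm (by simpa using h2) (Finset.sum_nonneg fun _ _ => norm_nonneg _)
    have hri : ‖r i‖ = 0 :=
      (Finset.sum_eq_zero_iff_of_nonneg fun i _ => norm_nonneg _).1 hr i (Finset.mem_univ i)
    have := h1 i
    rw [norm_eq_zero.1 hri] at this
    simpa using this
  -- After time `T`, every agent receives at least the fraction `κ ^ T` of the conserved mass `card
  -- ι ≥ 1`.
  have hbig : ∀ ν i, κ ^ T ≤ φ ν i := by
    intro ν i
    by_cases hν : ν ≤ T
    · exact (pow_le_pow_of_le_one hA.pos.le hκ1 hν).trans (hnn ν i)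
    · obtain ⟨s, rfl⟩ : ∃ s, ν = s + T := ⟨ν - T, by omega⟩
      rw [hunroll]
      calc κ ^ T ≤ κ ^ T * ∑ j, φ s j := by
            rw [hmass]; exact le_mul_of_one_le_right hκT.le hN1
        _ = ∑ j, κ ^ T * φ s j := Finset.mul_sum _ _ _
        _ ≤ _ := Finset.sum_le_sum fun j _ => mul_le_mul_of_nonneg_right (hlow s i j) (hpos s j)
  have hle : ∀ ν i, φ ν i ≤ Fintype.card ι := fun ν i => by
    rw [← hmass ν]
    exact Finset.single_le_sum (f := φ ν) (fun j _ => hpos ν j) (Finset.mem_univ i)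
  -- One factor `κ ^ T` comes from the transition entry, the other from `φ ν j`; the denominator
  -- bounds `φ (ν + T) i`.
  set η : ℝ := κ ^ T * κ ^ T / Fintype.card ι with hη
  have hκT1 : κ ^ T ≤ 1 := pow_le_one₀ hA.pos.le hκ1
  have hNη : Fintype.card ι * η = κ ^ T * κ ^ T := by rw [hη]; field_simp
  refine ⟨T, 1 - κ ^ T * κ ^ T, κ ^ T, ?_, ?_, hκT, hmass, hbig, ?_⟩
  · nlinarith
  · nlinarith
  intro x e hx ν
  obtain ⟨r, h1, h2⟩ := hA.exists_unrolled (y := fun ν i => φ ν i • x ν i) (e := e) hx ν T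
  have hφT : ∀ i, 0 < φ (ν + T) i := fun i => hκT.trans_le (hbig _ i)
  -- Dividing by `φ` turns column-stochastic mixing into genuine averages: these rows sum to one
  -- because `φ` evolves by the same matrices.
  set w : ι → ι → ℝ := fun i j => transition A ν T i j * φ ν j / φ (ν + T) i with hw
  have hw1 : ∀ i, ∑ j, w i j = 1 := by
    intro i
    rw [hw, ← Finset.sum_div, ← hunroll, div_self (hφT i).ne']
  have hw2 : ∀ i j, η ≤ w i j := by
    intro i j
    rw [hη, hw]
    exact div_le_div₀ (mul_nonneg (hA.transition_nonneg _ _ _ _) (hpos _ _))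
      (mul_le_mul (hlow ν i j) (hbig ν j) hκT.le (hA.transition_nonneg _ _ _ _)) (hφT i) (hle _ _)
  have hxT : ∀ i, x (ν + T) i = ∑ j, w i j • x ν j + (φ (ν + T) i)⁻¹ • r i := by
    intro i
    have h : φ (ν + T) i • x (ν + T) i
        = ∑ j, transition A ν T i j • (φ ν j • x ν j) + r i := h1 i
    rw [← inv_smul_smul₀ (hφT i).ne' (x (ν + T) i), h, smul_add, Finset.smul_sum]
    congr 1
    refine Finset.sum_congr rfl fun j _ => ?_
    rw [smul_smul, smul_smul, hw]
    congr 1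
    field_simp
  have hr : ∀ i, ‖(φ (ν + T) i)⁻¹ • r i‖ ≤
      1 / κ ^ T * ∑ t ∈ Finset.range T, ∑ i, ‖e (ν + t) i‖ := by
    intro i
    rw [norm_smul, norm_inv, Real.norm_of_nonneg (hφT i).le, ← one_div]
    refine mul_le_mul (one_div_le_one_div_of_le hκT (hbig _ i)) ?_ (norm_nonneg _) (by positivity)
    exact (Finset.single_le_sum (f := fun i => ‖r i‖) (fun _ _ => norm_nonneg _)
      (Finset.mem_univ i)).trans h2
  refine spread_le fun i j => ?_
  rw [hxT i, hxT j]
  have h3 := norm_average_sub_average_le (x := x ν) (hw2 i) (hw1 i) (hw2 j) (hw1 j)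
  rw [hNη] at h3
  calc _ = ‖(∑ k, w i k • x ν k - ∑ k, w j k • x ν k)
          + ((φ (ν + T) i)⁻¹ • r i - (φ (ν + T) j)⁻¹ • r j)‖ := by congr 1; abel
    _ ≤ _ := (norm_add_le _ _).trans (add_le_add h3 ((norm_sub_le _ _).trans
        (add_le_add (hr i) (hr j))))
    _ = _ := by ring

end PushSum

end Network

/-! ### Windowed contractions, perturbed descent, absence of oscillation -/

section RealSequences

lemma sum_range_shift_le {u : ℕ → ℝ} (hu : ∀ k, 0 ≤ u k) {M s N : ℕ} (h : M + s ≤ N) :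
    ∑ k ∈ Finset.range M, u (k + s) ≤ ∑ k ∈ Finset.range N, u k := by
  calc _ = ∑ k ∈ Finset.range M, u (s + k) := by simp only [add_comm s]
    _ ≤ ∑ k ∈ Finset.range (s + M), u k := by
      rw [Finset.sum_range_add]
      exact le_add_of_nonneg_left (Finset.sum_nonneg fun k _ => hu k)
    _ ≤ _ := Finset.sum_le_sum_of_subset_of_nonneg (Finset.range_mono (by omega))
      fun k _ _ => hu k

/-- Each term lies in at most `T` windows. -/
lemma sum_range_window_le {u : ℕ → ℝ} (hu : ∀ k, 0 ≤ u k) (T N : ℕ) :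
    ∑ k ∈ Finset.range (N - T), ∑ s ∈ Finset.range T, u (k + s)
      ≤ T * ∑ k ∈ Finset.range N, u k := by
  rw [Finset.sum_comm]
  calc _ ≤ ∑ s ∈ Finset.range T, ∑ k ∈ Finset.range N, u k := by
        refine Finset.sum_le_sum fun s hs => ?_
        rw [Finset.mem_range] at hs
        rcases Nat.eq_zero_or_pos (N - T) with h0 | h0
        · rw [h0]; simpa using Finset.sum_nonneg fun k _ => hu k
        · exact sum_range_shift_le hu (by omega)
    _ = _ := by simp

/-- Partial sums of a sequence that contracts over windows of length `T`. -/
lemma sum_range_le_of_window {a b : ℕ → ℝ} {T : ℕ} {ρ : ℝ} (ha : ∀ k, 0 ≤ a k) (hρ : 0 ≤ ρ)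
    (hρ1 : ρ < 1) (h : ∀ k, a (k + T) ≤ ρ * a k + b k) (N : ℕ) :
    ∑ k ∈ Finset.range N, a k
      ≤ (∑ k ∈ Finset.range T, a k + ∑ k ∈ Finset.range (N - T), b k) / (1 - ρ) := by
  have hρ' : 0 < 1 - ρ := by linarith
  rw [le_div_iff₀ hρ']
  have h1 : ∑ k ∈ Finset.range N, a k
      ≤ ∑ k ∈ Finset.range T, a k + ∑ k ∈ Finset.range (N - T), a (T + k) := by
    rw [← Finset.sum_range_add]
    exact Finset.sum_le_sum_of_subset_of_nonneg (Finset.range_mono (by omega)) fun k _ _ => ha k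
  have h2 : ∑ k ∈ Finset.range (N - T), a (T + k)
      ≤ ρ * ∑ k ∈ Finset.range (N - T), a k + ∑ k ∈ Finset.range (N - T), b k := by
    rw [Finset.mul_sum, ← Finset.sum_add_distrib]
    exact Finset.sum_le_sum fun k _ => by rw [add_comm T]; exact h k
  have h3 : ∑ k ∈ Finset.range (N - T), a k ≤ ∑ k ∈ Finset.range N, a k :=
    Finset.sum_le_sum_of_subset_of_nonneg (Finset.range_mono (by omega)) fun k _ _ => ha k
  nlinarith

lemma summable_of_window {a b : ℕ → ℝ} {T : ℕ} {ρ : ℝ} (ha : ∀ k, 0 ≤ a k) (hρ : 0 ≤ ρ)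
    (hρ1 : ρ < 1) (h : ∀ k, a (k + T) ≤ ρ * a k + b k) (hb0 : ∀ k, 0 ≤ b k) (hb : Summable b) :
    Summable a := by
  refine summable_of_sum_range_le ha (c := (∑ k ∈ Finset.range T, a k + ∑' k, b k) / (1 - ρ))
    fun N => (sum_range_le_of_window ha hρ hρ1 h N).trans ?_
  have : 0 < 1 - ρ := by linarith
  gcongr
  exact hb.sum_le_tsum _ fun k _ => hb0 k

/-- Convexity of the square at the combination `ρ y + (1 - ρ) (e / (1 - ρ))`. The contraction factor
is not lost when passing to squares. -/
lemma sq_le_of_contraction {x y e ρ : ℝ} (hρ : 0 ≤ ρ) (hρ1 : ρ < 1) (hx : 0 ≤ x)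
    (h : x ≤ ρ * y + e) : x ^ 2 ≤ ρ * y ^ 2 + 1 / (1 - ρ) * e ^ 2 := by
  have h1 : 0 < 1 - ρ := by linarith
  have h2 : x ^ 2 ≤ (ρ * y + e) ^ 2 := pow_le_pow_left₀ hx h 2
  have h3 : ρ * y ^ 2 + 1 / (1 - ρ) * e ^ 2 - (ρ * y + e) ^ 2
      = ρ / (1 - ρ) * ((1 - ρ) * y - e) ^ 2 := by
    field_simp
    ring
  have h4 : 0 ≤ ρ / (1 - ρ) * ((1 - ρ) * y - e) ^ 2 :=
    mul_nonneg (div_nonneg hρ h1.le) (sq_nonneg _)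
  linarith

lemma sq_sum_range_le (u : ℕ → ℝ) (T : ℕ) :
    (∑ s ∈ Finset.range T, u s) ^ 2 ≤ T * ∑ s ∈ Finset.range T, u s ^ 2 := by
  simpa using sq_sum_le_card_mul_sum_sq (s := Finset.range T) (f := u)

/-- A nearly decreasing sequence that is bounded below converges. -/
lemma exists_tendsto_of_le_add_summable {L r : ℕ → ℝ} {l : ℝ} (hl : ∀ ν, l ≤ L ν)
    (hr : Summable r) (h : ∀ ν, L (ν + 1) ≤ L ν + r ν) : ∃ u, Tendsto L atTop (𝓝 u) := by
  set M : ℕ → ℝ := fun ν => L ν - ∑ k ∈ Finset.range ν, r k with hM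
  have hanti : Antitone M := antitone_nat_of_succ_le fun ν => by
    simp only [hM, Finset.sum_range_succ]
    linarith [h ν]
  have hsum := hr.hasSum.tendsto_sum_nat
  obtain ⟨R, hR⟩ := hsum.bddAbove_range
  have hbdd : BddBelow (range M) := by
    refine ⟨l - R, ?_⟩
    rintro _ ⟨ν, rfl⟩
    have := hR ⟨ν, rfl⟩
    simp only [hM]
    linarith [hl ν]
  refine ⟨_, ((tendsto_atTop_ciInf hanti hbdd).add hsum).congr fun ν => ?_⟩
  simp [hM]

/-- Summability from a perturbed descent inequality coupled with a tracking error that is itself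
driven by the descent terms. -/
lemma descent_summable {L w q t e γ : ℕ → ℝ} {c C l ρ : ℝ} {T : ℕ} (hc : 0 < c) (hC : 0 ≤ C)
    (hρ : 0 ≤ ρ) (hρ1 : ρ < 1) (hγ : ∀ ν, 0 ≤ γ ν) (hγ2 : Summable fun ν => γ ν ^ 2)
    (hw : ∀ ν, 0 ≤ w ν) (hq : ∀ ν, 0 ≤ q ν) (he0 : ∀ ν, 0 ≤ e ν) (he : Summable e)
    (hl : ∀ ν, l ≤ L ν)
    (h1 : ∀ ν, L (ν + 1) + c * (γ ν * w ν) + c * q ν ≤ L ν + C * (γ ν * t ν) + e ν)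
    (h2 : ∀ ν, t (ν + T) ^ 2 ≤ ρ * t ν ^ 2
      + C * ∑ s ∈ Finset.range T, (q (ν + s) + e (ν + s))) :
    Summable q ∧ Summable (fun ν => γ ν * w ν) ∧ Summable (fun ν => t ν ^ 2) ∧
      ∃ u, Tendsto L atTop (𝓝 u) := by
  have hρ' : 0 < 1 - ρ := by linarith
  set P0 := ∑ k ∈ Finset.range T, t k ^ 2 with hP0
  have hP00 : 0 ≤ P0 := Finset.sum_nonneg fun _ _ => sq_nonneg _
  set S := ∑' k, e k with hS
  have hes : ∀ N, ∑ k ∈ Finset.range N, e k ≤ S := fun N => he.sum_le_tsum _ fun k _ => he0 k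
  set Γ := ∑' k, γ k ^ 2 with hΓ
  have hγs : ∀ N, ∑ k ∈ Finset.range N, γ k ^ 2 ≤ Γ :=
    fun N => hγ2.sum_le_tsum _ fun k _ => sq_nonneg _
  have ht : ∀ N, ∑ k ∈ Finset.range N, t k ^ 2
      ≤ (P0 + C * (T * (∑ k ∈ Finset.range N, q k + S))) / (1 - ρ) := by
    intro N
    refine (sum_range_le_of_window (fun _ => sq_nonneg _) hρ hρ1 h2 N).trans ?_
    gcongr
    rw [← Finset.mul_sum]
    gcongr
    refine (sum_range_window_le (fun k => add_nonneg (hq k) (he0 k)) T N).trans ?_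
    gcongr
    rw [Finset.sum_add_distrib]
    gcongr
    exact hes N
  set A := C * T / (1 - ρ) with hA
  have hA0 : 0 ≤ A := by positivity
  -- `A` is the gain from `∑ q` to `∑ t²`. This `η` gives `η * A ≤ c / 2`, so the tracking terms
  -- consume at most half of the descent in `q`.
  set η := c / (2 * (A + 1)) with hη
  have hη0 : 0 < η := by positivity
  have hηA : η * A ≤ c / 2 := by
    rw [hη, div_mul_eq_mul_div, div_le_div_iff₀ (by positivity) (by norm_num)]
    nlinarith
  have ht' : ∀ N, ∑ k ∈ Finset.range N, t k ^ 2
      ≤ (P0 / (1 - ρ) + A * S) + A * ∑ k ∈ Finset.range N, q k := by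
    intro N
    refine (ht N).trans (le_of_eq ?_)
    rw [hA]; field_simp; ring
  have hstep : ∀ ν, L (ν + 1) + c * (γ ν * w ν) + c * q ν
      ≤ L ν + (C ^ 2 / (4 * η) * γ ν ^ 2 + η * t ν ^ 2) + e ν := by
    intro ν
    have : C * (γ ν * t ν) ≤ C ^ 2 / (4 * η) * γ ν ^ 2 + η * t ν ^ 2 := by
      have h : C ^ 2 / (4 * η) * γ ν ^ 2 + η * t ν ^ 2 - C * (γ ν * t ν)
          = 1 / (4 * η) * (C * γ ν - 2 * η * t ν) ^ 2 := by
        field_simp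
        ring
      have : 0 ≤ 1 / (4 * η) * (C * γ ν - 2 * η * t ν) ^ 2 := by positivity
      linarith
    linarith [h1 ν]
  have htel : ∀ N, L N + c * ∑ k ∈ Finset.range N, γ k * w k + c * ∑ k ∈ Finset.range N, q k
      ≤ L 0 + C ^ 2 / (4 * η) * ∑ k ∈ Finset.range N, γ k ^ 2
        + η * ∑ k ∈ Finset.range N, t k ^ 2 + ∑ k ∈ Finset.range N, e k := by
    intro N
    induction N with
    | zero => simp
    | succ N ih =>
      simp only [Finset.sum_range_succ]
      linarith [hstep N]
  set Q := L 0 - l + C ^ 2 / (4 * η) * Γ + η * (P0 / (1 - ρ) + A * S) + S with hQ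
  have hbound : ∀ N, c * ∑ k ∈ Finset.range N, γ k * w k + c / 2 * ∑ k ∈ Finset.range N, q k
      ≤ Q := by
    intro N
    have a1 := htel N
    have a2 : C ^ 2 / (4 * η) * ∑ k ∈ Finset.range N, γ k ^ 2 ≤ C ^ 2 / (4 * η) * Γ :=
      mul_le_mul_of_nonneg_left (hγs N) (by positivity)
    have a3 := mul_le_mul_of_nonneg_left (ht' N) hη0.le
    have a4 : η * A * ∑ k ∈ Finset.range N, q k ≤ c / 2 * ∑ k ∈ Finset.range N, q k :=
      mul_le_mul_of_nonneg_right hηA (Finset.sum_nonneg fun k _ => hq k)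
    have a5 := hl N
    have a6 := hes N
    rw [hQ]
    linarith
  have hq_s : Summable q := by
    refine summable_of_sum_range_le hq (c := Q / (c / 2)) fun N => ?_
    rw [le_div_iff₀ (by positivity)]
    have := hbound N
    have hnn : 0 ≤ c * ∑ k ∈ Finset.range N, γ k * w k :=
      mul_nonneg hc.le (Finset.sum_nonneg fun k _ => mul_nonneg (hγ k) (hw k))
    linarith
  have hw_s : Summable (fun ν => γ ν * w ν) := by
    refine summable_of_sum_range_le (fun k => mul_nonneg (hγ k) (hw k)) (c := Q / c) fun N => ?_
    rw [le_div_iff₀ hc]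
    have := hbound N
    have hnn : 0 ≤ c / 2 * ∑ k ∈ Finset.range N, q k :=
      mul_nonneg (by positivity) (Finset.sum_nonneg fun k _ => hq k)
    linarith
  have ht_s : Summable (fun ν => t ν ^ 2) := by
    refine summable_of_sum_range_le (fun _ => sq_nonneg _)
      (c := (P0 / (1 - ρ) + A * S) + A * ∑' k, q k) fun N => (ht' N).trans ?_
    gcongr
    exact hq_s.sum_le_tsum _ fun k _ => hq k
  refine ⟨hq_s, hw_s, ht_s, exists_tendsto_of_le_add_summable hl
    (r := fun ν => (C ^ 2 / (4 * η) * γ ν ^ 2 + η * t ν ^ 2) + e ν)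
    (((hγ2.mul_left _).add (ht_s.mul_left _)).add he) fun ν => ?_⟩
  have := hstep ν
  have b1 : 0 ≤ c * (γ ν * w ν) := mul_nonneg hc.le (mul_nonneg (hγ ν) (hw ν))
  have b2 : 0 ≤ c * q ν := mul_nonneg hc.le (hq ν)
  linarith

/-- A sequence whose variation is controlled by step sizes, and whose step sizes are summable
along the times at which it is not small, cannot oscillate. -/
lemma tendsto_zero_of_no_oscillation {a s γ β : ℕ → ℝ} {C C' : ℝ} (hC : 0 ≤ C) (hC' : 0 ≤ C')
    (ha : ∀ ν, 0 ≤ a ν) (hγ0 : ∀ ν, 0 ≤ γ ν) (hγ : Tendsto γ atTop (𝓝 0))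
    (hβ : Tendsto β atTop (𝓝 0)) (hlip : ∀ ν, a (ν + 1) ≤ a ν + C * s ν)
    (hs : ∀ n N, ∑ k ∈ Finset.range N, s (n + k)
      ≤ β n + C' * ∑ k ∈ Finset.range N, γ (n + k))
    (hfreq : ∀ ε > 0, ∃ᶠ ν in atTop, a ν < ε)
    (hsum : ∀ ε > 0, Summable fun ν => if ε ≤ a ν then γ ν else 0) :
    Tendsto a atTop (𝓝 0) := by
  by_contra hnot
  obtain ⟨ε, hε, hfr⟩ : ∃ ε > 0, ∃ᶠ ν in atTop, 2 * ε ≤ a ν := by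
    by_contra hcon
    push Not at hcon
    refine hnot (Metric.tendsto_atTop'.2 fun δ hδ => ?_)
    have h1 := hcon (δ / 2) (by positivity)
    rw [eventually_atTop] at h1
    obtain ⟨n, hn⟩ := h1
    refine ⟨n, fun m hm => ?_⟩
    have := hn m hm.le
    rw [Real.dist_eq, sub_zero, abs_of_nonneg (ha m)]
    linarith
  set g : ℕ → ℝ := fun ν => if ε ≤ a ν then γ ν else 0 with hg
  have hg0 : ∀ ν, 0 ≤ g ν := fun ν => by simp only [hg]; split_ifs <;> simp [hγ0]
  have hgs : Summable g := hsum ε hε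
  have htail : Tendsto (fun n => ∑' k, g (k + n)) atTop (𝓝 0) := tendsto_sum_nat_add g
  have hlim : Tendsto (fun n => C * (β n + C' * (γ n + ∑' k, g (k + n)))) atTop (𝓝 0) := by
    have := (hβ.add ((hγ.add htail).const_mul C')).const_mul C
    simpa using this
  obtain ⟨n₀, hn₀⟩ := eventually_atTop.1 (hlim.eventually (gt_mem_nhds hε))
  obtain ⟨n₁, hn₁, han₁⟩ := frequently_atTop.1 (hfreq ε hε) n₀
  obtain ⟨m, hm, ham⟩ := frequently_atTop.1 hfr n₁
  -- The last time before `m` with value below `ε`: from then until `m` the sequence climbs by more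
  -- than `ε` while staying at or above `ε`.
  set n := Nat.findGreatest (fun k => a k < ε) m with hn
  have hn1 : n₁ ≤ n := Nat.le_findGreatest hm han₁
  have hspec : a n < ε := Nat.findGreatest_spec (P := fun k => a k < ε) hm han₁
  have hnm : n ≤ m := Nat.findGreatest_le m
  have hbetween : ∀ k, n < k → k ≤ m → ε ≤ a k := fun k h1 h2 =>
    not_lt.1 (Nat.findGreatest_is_greatest h1 h2)
  have htel : ∀ N, a (n + N) ≤ a n + C * ∑ k ∈ Finset.range N, s (n + k) := by
    intro N
    induction N with
    | zero => simp
    | succ N ih =>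
      rw [Finset.sum_range_succ, ← add_assoc]
      linarith [hlip (n + N)]
  have h1 := htel (m - n)
  rw [Nat.add_sub_cancel' hnm] at h1
  -- The start `n` is itself below `ε`, so `g` misses its step, which is added separately.
  have h2 : ∑ k ∈ Finset.range (m - n), γ (n + k) ≤ γ n + ∑' k, g (k + n) := by
    have hle : ∑ k ∈ Finset.range (m - n), γ (n + k)
        ≤ ∑ k ∈ Finset.range (m - n), ((if k = 0 then γ n else 0) + g (k + n)) := by
      refine Finset.sum_le_sum fun k hk => ?_
      rw [Finset.mem_range] at hk
      rcases Nat.eq_zero_or_pos k with h0 | h0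
      · subst h0; simpa using hg0 n
      · have := hbetween (k + n) (by omega) (by omega)
        simp [hg, this, h0.ne', add_comm]
    refine hle.trans ?_
    rw [Finset.sum_add_distrib]
    refine add_le_add ?_ (((summable_nat_add_iff n).2 hgs).sum_le_tsum _ fun k _ => hg0 _)
    rw [Finset.sum_ite_eq']
    split_ifs
    · exact le_rfl
    · exact hγ0 n
  have h3 := hn₀ n (hn₁.trans hn1)
  have h4 := hs n (m - n)
  have h5 : C * ∑ k ∈ Finset.range (m - n), s (n + k)
      ≤ C * (β n + C' * (γ n + ∑' k, g (k + n))) := by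
    refine mul_le_mul_of_nonneg_left (h4.trans ?_) hC
    gcongr
  linarith

end RealSequences

/-! ### Entrywise norm and strongly convex proximal objectives -/

lemma maxAbs_nonneg {m k : ℕ} (A : RMat m k) : 0 ≤ maxAbs A :=
  Real.iSup_nonneg fun _ => abs_nonneg _

lemma maxAbs_le_norm {m k : ℕ} (A : RMat m k) : maxAbs A ≤ ‖A‖ :=
  Real.iSup_le (fun p => PiLp.norm_apply_le A p) (norm_nonneg _)

lemma argminOn_isArgmin {E : Type*} [Nonempty E] {s : Set E} {φ : E → ℝ}
    (h : ∃ x, IsArgmin s φ x) : IsArgmin s φ (argminOn s φ) :=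
  Classical.epsilon_spec h

lemma StrongConvexOn.subset {E : Type*} [NormedAddCommGroup E] [NormedSpace ℝ E] {s t : Set E}
    {m : ℝ} {g : E → ℝ} (hg : StrongConvexOn t m g) (hst : s ⊆ t) (hs : Convex ℝ s) :
    StrongConvexOn s m g :=
  ⟨hs, fun _ hx _ hy => hg.2 (hst hx) (hst hy)⟩

/-- Subtracting `τ/2 ‖y‖²` leaves `g` plus an affine function. -/
lemma ConvexOn.strongConvexOn_prox {E : Type*} [NormedAddCommGroup E] [InnerProductSpace ℝ E]
    {O : Set E} {g : E → ℝ} (hg : ConvexOn ℝ O g) (τ : ℝ) (c x : E) :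
    StrongConvexOn O τ fun y => ⟪c, y - x⟫_ℝ + τ / 2 * ‖y - x‖ ^ 2 + g y := by
  rw [strongConvexOn_iff_convex]
  have h1 : ConvexOn ℝ O fun y => ⟪c - τ • x, y⟫_ℝ + (τ / 2 * ‖x‖ ^ 2 - ⟪c, x⟫_ℝ) :=
    ((innerSL ℝ (c - τ • x)).toLinearMap.convexOn hg.1).add_const _
  refine (h1.add hg).congr fun y _ => ?_
  simp only [Pi.add_apply, norm_sub_sq_real, inner_sub_left, inner_sub_right, inner_smul_left,
    RCLike.conj_to_real, real_inner_comm x y]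
  ring

/-! ### Regularity of the objective and optimality of the subproblems -/

namespace DLProblem

variable {ι : Type*} {M K : ℕ} {n : ι → ℕ} {P : DLProblem ι M K n} {L : ι → RMat M K → ℝ}

namespace Assumptions

lemma contDiffOn_D (hP : P.Assumptions L) (i : ι) {x : RMat K (n i)} (hx : x ∈ P.Oi i) :
    ContDiffOn ℝ 2 (fun D => P.f i D x) P.O :=
  (hP.f_contDiff i).comp (f := fun D : RMat M K => (D, x))
    (contDiff_id.prodMk contDiff_const).contDiffOn fun _ hD => ⟨hD, hx⟩

lemma contDiffOn_X (hP : P.Assumptions L) (i : ι) {D : RMat M K} (hD : D ∈ P.O) :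
    ContDiffOn ℝ 2 (fun x => P.f i D x) (P.Oi i) :=
  (hP.f_contDiff i).comp (f := fun x : RMat K (n i) => (D, x))
    (contDiff_const.prodMk contDiff_id).contDiffOn fun _ hx => ⟨hD, hx⟩

lemma hasGradientAt_D (hP : P.Assumptions L) (i : ι) {D : RMat M K} {x : RMat K (n i)}
    (hD : D ∈ P.O) (hx : x ∈ P.Oi i) :
    HasGradientAt (fun D' => P.f i D' x) (P.gradD i D x) D :=
  (((hP.contDiffOn_D i hx).contDiffAt (hP.O_open.mem_nhds hD)).differentiableAt
    (by norm_num)).hasGradientAt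

lemma hasGradientAt_X (hP : P.Assumptions L) (i : ι) {D : RMat M K} {x : RMat K (n i)}
    (hD : D ∈ P.O) (hx : x ∈ P.Oi i) :
    HasGradientAt (fun x' => P.f i D x') (P.gradX i D x) x :=
  (((hP.contDiffOn_X i hD).contDiffAt ((hP.Oi_open i).mem_nhds hx)).differentiableAt
    (by norm_num)).hasGradientAt

lemma hasGradientAt_F [Fintype ι] (hP : P.Assumptions L) {D : RMat M K}
    {X : (i : ι) → RMat K (n i)} (hD : D ∈ P.O) (hX : ∀ i, X i ∈ P.Oi i) :
    HasGradientAt (fun D' => P.F D' X) (∑ i, P.gradD i D (X i)) D := by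
  rw [hasGradientAt_iff_hasFDerivAt, map_sum]
  exact HasFDerivAt.fun_sum fun i _ => (hP.hasGradientAt_D i hD (hX i)).hasFDerivAt

lemma gradDF_eq_sum [Fintype ι] (hP : P.Assumptions L) {D : RMat M K}
    {X : (i : ι) → RMat K (n i)} (hD : D ∈ P.O) (hX : ∀ i, X i ∈ P.Oi i) :
    P.gradDF D X = ∑ i, P.gradD i D (X i) :=
  (hP.hasGradientAt_F hD hX).gradient

/-- A partial gradient represents the joint derivative restricted to one factor, and the inclusion
of a factor has norm at most one. Joint regularity thus passes to partial gradients with the same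
constant. -/
lemma norm_gradD_sub_le (hP : P.Assumptions L) (i : ι) {D D' : RMat M K} {x x' : RMat K (n i)}
    (hD : D ∈ P.O) (hx : x ∈ P.Oi i) (hD' : D' ∈ P.O) (hx' : x' ∈ P.Oi i) :
    ‖P.gradD i D x - P.gradD i D' x'‖
      ≤ ‖fderiv ℝ (fun p : RMat M K × RMat K (n i) => P.f i p.1 p.2) (D, x)
          - fderiv ℝ (fun p : RMat M K × RMat K (n i) => P.f i p.1 p.2) (D', x')‖ := by
  have key : ∀ {D : RMat M K} {x : RMat K (n i)}, D ∈ P.O → x ∈ P.Oi i →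
      InnerProductSpace.toDual ℝ (RMat M K) (P.gradD i D x)
        = (fderiv ℝ (fun p : RMat M K × RMat K (n i) => P.f i p.1 p.2) (D, x)).comp
          (ContinuousLinearMap.inl ℝ _ _) := by
    intro D x hD hx
    have h1 : HasFDerivAt (fun p : RMat M K × RMat K (n i) => P.f i p.1 p.2)
        (fderiv ℝ (fun p : RMat M K × RMat K (n i) => P.f i p.1 p.2) (D, x)) (D, x) :=
      (((hP.f_contDiff i).contDiffAt ((hP.O_open.prod (hP.Oi_open i)).mem_nhds
        ⟨hD, hx⟩)).differentiableAt (by norm_num)).hasFDerivAt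
    have h2 : HasFDerivAt (fun D' : RMat M K => (D', x))
        (ContinuousLinearMap.inl ℝ (RMat M K) (RMat K (n i))) D := hasFDerivAt_prodMk_left D x
    have h3 := h1.comp D h2
    exact (hP.hasGradientAt_D i hD hx).hasFDerivAt.unique h3
  rw [← (InnerProductSpace.toDual ℝ (RMat M K)).norm_map, map_sub, key hD hx, key hD' hx',
    ← ContinuousLinearMap.sub_comp]
  refine (ContinuousLinearMap.opNorm_comp_le _ _).trans ?_
  exact mul_le_of_le_one_right (norm_nonneg _) (ContinuousLinearMap.norm_inl_le_one ℝ _ _)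

lemma norm_gradX_sub_le (hP : P.Assumptions L) (i : ι) {D D' : RMat M K} {x x' : RMat K (n i)}
    (hD : D ∈ P.O) (hx : x ∈ P.Oi i) (hD' : D' ∈ P.O) (hx' : x' ∈ P.Oi i) :
    ‖P.gradX i D x - P.gradX i D' x'‖
      ≤ ‖fderiv ℝ (fun p : RMat M K × RMat K (n i) => P.f i p.1 p.2) (D, x)
          - fderiv ℝ (fun p : RMat M K × RMat K (n i) => P.f i p.1 p.2) (D', x')‖ := by
  have key : ∀ {D : RMat M K} {x : RMat K (n i)}, D ∈ P.O → x ∈ P.Oi i →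
      InnerProductSpace.toDual ℝ (RMat K (n i)) (P.gradX i D x)
        = (fderiv ℝ (fun p : RMat M K × RMat K (n i) => P.f i p.1 p.2) (D, x)).comp
          (ContinuousLinearMap.inr ℝ _ _) := by
    intro D x hD hx
    have h1 : HasFDerivAt (fun p : RMat M K × RMat K (n i) => P.f i p.1 p.2)
        (fderiv ℝ (fun p : RMat M K × RMat K (n i) => P.f i p.1 p.2) (D, x)) (D, x) :=
      (((hP.f_contDiff i).contDiffAt ((hP.O_open.prod (hP.Oi_open i)).mem_nhds
        ⟨hD, hx⟩)).differentiableAt (by norm_num)).hasFDerivAt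
    have h2 : HasFDerivAt (fun x' : RMat K (n i) => (D, x'))
        (ContinuousLinearMap.inr ℝ (RMat M K) (RMat K (n i))) x := hasFDerivAt_prodMk_right D x
    exact (hP.hasGradientAt_X i hD hx).hasFDerivAt.unique (h1.comp x h2)
  rw [← (InnerProductSpace.toDual ℝ (RMat K (n i))).norm_map, map_sub, key hD hx, key hD' hx',
    ← ContinuousLinearMap.sub_comp]
  refine (ContinuousLinearMap.opNorm_comp_le _ _).trans ?_
  exact mul_le_of_le_one_right (norm_nonneg _) (ContinuousLinearMap.norm_inr_le_one ℝ _ _)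

/-- Uniform Lipschitz bounds over compact convex sets of arguments. -/
lemma exists_lipschitz (hP : P.Assumptions L) (i : ι) {Z : Set (RMat K (n i))}
    (hZ : IsCompact Z) (hZc : Convex ℝ Z) (hZO : Z ⊆ P.Oi i) :
    ∃ ℓ : ℝ, 0 ≤ ℓ ∧ ∀ D ∈ P.Dset, ∀ D' ∈ P.Dset, ∀ x ∈ Z, ∀ x' ∈ Z,
      ‖P.gradD i D x - P.gradD i D' x'‖ ≤ ℓ * (‖D - D'‖ + ‖x - x'‖) ∧
      ‖P.gradX i D x - P.gradX i D' x'‖ ≤ ℓ * (‖D - D'‖ + ‖x - x'‖) ∧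
      |P.f i D x - P.f i D' x'| ≤ ℓ * (‖D - D'‖ + ‖x - x'‖) := by
  have hsub : P.Dset ×ˢ Z ⊆ P.O ×ˢ P.Oi i := prod_mono hP.Dset_subset hZO
  have hcv : Convex ℝ (P.Dset ×ˢ Z) := hP.Dset_convex.prod hZc
  have hcp : IsCompact (P.Dset ×ˢ Z) := hP.Dset_compact.prod hZ
  -- Both `f` and its derivative are `C¹`, hence Lipschitz on a compact convex set; `K₁` serves the
  -- values and `K₂` both partial gradients.
  obtain ⟨K₁, h1⟩ := ((hP.f_contDiff i).mono hsub).exists_lipschitzOnWith (by norm_num) hcv hcp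
  obtain ⟨K₂, h2⟩ := (((hP.f_contDiff i).fderiv_of_isOpen (hP.O_open.prod (hP.Oi_open i))
    (m := 1) (by norm_num)).mono hsub).exists_lipschitzOnWith (by norm_num) hcv hcp
  refine ⟨max K₁ K₂, K₁.2.trans (le_max_left _ _), fun D hD D' hD' x hx x' hx' => ?_⟩
  have hd : dist (D, x) (D', x') ≤ ‖D - D'‖ + ‖x - x'‖ := by
    rw [dist_eq_norm, Prod.mk_sub_mk, Prod.norm_def]
    exact max_le (le_add_of_nonneg_right (norm_nonneg _)) (le_add_of_nonneg_left (norm_nonneg _))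
  have h1' := h1.dist_le_mul (D, x) ⟨hD, hx⟩ (D', x') ⟨hD', hx'⟩
  have h2' := h2.dist_le_mul (D, x) ⟨hD, hx⟩ (D', x') ⟨hD', hx'⟩
  have e2 : (K₂ : ℝ) * dist (D, x) (D', x') ≤ max K₁ K₂ * (‖D - D'‖ + ‖x - x'‖) :=
    mul_le_mul (le_max_right _ _) hd dist_nonneg (K₁.2.trans (le_max_left _ _))
  have e1 : (K₁ : ℝ) * dist (D, x) (D', x') ≤ max K₁ K₂ * (‖D - D'‖ + ‖x - x'‖) :=
    mul_le_mul (le_max_left _ _) hd dist_nonneg (K₁.2.trans (le_max_left _ _))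
  rw [dist_eq_norm] at h2'
  rw [Real.dist_eq] at h1'
  refine ⟨?_, ?_, h1'.trans e1⟩
  · exact (hP.norm_gradD_sub_le i (hP.Dset_subset hD) (hZO hx) (hP.Dset_subset hD')
      (hZO hx')).trans (h2'.trans e2)
  · exact (hP.norm_gradX_sub_le i (hP.Dset_subset hD) (hZO hx) (hP.Dset_subset hD')
      (hZO hx')).trans (h2'.trans e2)

lemma g_convex (hP : P.Assumptions L) (i : ι) : ConvexOn ℝ (P.Oi i) (P.g i) := by
  rcases hP.g_cases i with ⟨_, h⟩ | ⟨μ, hμ, h⟩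
  · exact h
  · have := h.mono hμ.le
    rwa [strongConvexOn_zero] at this

lemma forward_step (hP : P.Assumptions L) (i : ι) {V : RMat M K} (hV : V ∈ P.Dset) {τ : ℝ}
    (hτ : L i V / 2 ≤ τ) {x z u v : RMat K (n i)} (hx : x ∈ P.Xset i) (hz : z ∈ P.Xset i)
    (hu : u ∈ P.Xset i) (hv : v ∈ P.Xset i) :
    ⟪τ • (x - z) - (P.gradX i V x - P.gradX i V z), u - v⟫_ℝ ≤ τ * ‖x - z‖ * ‖u - v‖ :=
  forward_step_nonexpansive (hP.Oi_open i) (hP.Xset_subset i) (hP.Xset_convex i)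
    (hP.contDiffOn_X i (hP.Dset_subset hV)) (hP.f_convex_X i V (hP.Dset_subset hV))
    (hP.L_lipschitz i V hV) hτ hx hz hu hv

lemma gradX_monotone (hP : P.Assumptions L) (i : ι) {V : RMat M K} (hV : V ∈ P.Dset)
    {x z : RMat K (n i)} (hx : x ∈ P.Xset i) (hz : z ∈ P.Xset i) :
    0 ≤ ⟪P.gradX i V x - P.gradX i V z, x - z⟫_ℝ :=
  (hP.f_convex_X i V (hP.Dset_subset hV)).gradient_monotone (hP.Xset_subset i hx)
    (hP.Xset_subset i hz) (hP.hasGradientAt_X i (hP.Dset_subset hV) (hP.Xset_subset i hx))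
    (hP.hasGradientAt_X i (hP.Dset_subset hV) (hP.Xset_subset i hz))

/-- Optimality of the private-variable update; `q` is the partial gradient at the new or at the
old point, depending on the surrogate. -/
lemma X_variational (hP : P.Assumptions L) (i : ι) {V : RMat M K} (hV : V ∈ P.Dset) {τ μ : ℝ}
    {x x' : RMat K (n i)} {h : RMat K (n i) → ℝ}
    (hh : h = P.surrXFull i τ V x ∨ h = P.surrXLin i τ V x)
    (hμ : StrongConvexOn (P.Oi i) μ (P.g i))
    (hmin : IsArgmin (P.Xset i) (fun y => h y + P.g i y) x') :
    ∃ q, (q = P.gradX i V x' ∨ q = P.gradX i V x) ∧ ∀ y ∈ P.Xset i,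
      0 ≤ ⟪q + τ • (x' - x), y - x'⟫_ℝ + P.g i y - P.g i x' - μ / 2 * ‖y - x'‖ ^ 2 := by
  have hg := hμ.subset (hP.Xset_subset i) (hP.Xset_convex i)
  rcases hh with rfl | rfl
  · refine ⟨_, Or.inl rfl, fun y hy => ?_⟩
    exact hmin.variational (hP.Xset_convex i) hg
      ((hP.hasGradientAt_X i (hP.Dset_subset hV) (hP.Xset_subset i hmin.1)).add'
        (hasGradientAt_half_sq τ x x')) hy
  · refine ⟨_, Or.inr rfl, fun y hy => ?_⟩
    exact hmin.variational (hP.Xset_convex i) hg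
      ((hasGradientAt_inner (P.gradX i V x) x x').add' (hasGradientAt_half_sq τ x x')) hy

/-- Sufficient decrease of the private-variable update. -/
lemma X_descent (hP : P.Assumptions L) (i : ι) {V : RMat M K} (hV : V ∈ P.Dset) {τ μ : ℝ}
    (hμ0 : 0 ≤ μ) {x x' q : RMat K (n i)} (hx : x ∈ P.Xset i) (hx' : x' ∈ P.Xset i)
    (hq : q = P.gradX i V x' ∨ q = P.gradX i V x)
    (hvi : ∀ y ∈ P.Xset i,
      0 ≤ ⟪q + τ • (x' - x), y - x'⟫_ℝ + P.g i y - P.g i x' - μ / 2 * ‖y - x'‖ ^ 2) :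
    P.f i V x' + P.g i x' + (τ - L i V / 2) * ‖x' - x‖ ^ 2 ≤ P.f i V x + P.g i x := by
  have hVO := hP.Dset_subset hV
  have h1 := hvi x hx
  have e1 : ⟪q + τ • (x' - x), x - x'⟫_ℝ = -⟪q, x' - x⟫_ℝ - τ * ‖x' - x‖ ^ 2 := by
    rw [← neg_sub x' x, inner_neg_right, inner_add_left, inner_smul_left,
      real_inner_self_eq_norm_sq]
    simp only [RCLike.conj_to_real]
    ring
  have h2 : 0 ≤ μ / 2 * ‖x - x'‖ ^ 2 := by positivity
  -- For the full surrogate this is convexity at the new point, and the quadratic term is slack; for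
  -- the linearized one it is the descent lemma.
  have h3 : P.f i V x' ≤ P.f i V x + ⟪q, x' - x⟫_ℝ + L i V / 2 * ‖x' - x‖ ^ 2 := by
    have hL0 := hP.L_nonneg i V hV
    rcases hq with rfl | rfl
    · have := (hP.f_convex_X i V hVO).le_sub_of_hasGradientAt (hP.Xset_subset i hx')
        (hP.Xset_subset i hx) (hP.hasGradientAt_X i hVO (hP.Xset_subset i hx'))
      rw [← neg_sub x' x, inner_neg_right] at this
      have : 0 ≤ L i V / 2 * ‖x' - x‖ ^ 2 := by positivity
      linarith
    · refine le_quadratic_of_gradient_le (gr := P.gradX i V) (fun t ht => ?_) fun t ht => ?_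
      · exact hP.hasGradientAt_X i hVO (hP.Xset_subset i
          (segment_point_mem (hP.Xset_convex i) hx hx' ht.1 ht.2))
      · have := hP.L_lipschitz i V hV _ (segment_point_mem (hP.Xset_convex i) hx hx' ht.1 ht.2)
          _ hx
        rwa [add_sub_cancel_left, norm_smul, Real.norm_of_nonneg ht.1] at this
  rw [e1] at h1
  linarith

/-- With a strongly convex regularizer, the private-variable update contracts towards any
reference point up to a constant. -/
lemma exists_X_contraction (hP : P.Assumptions L) (i : ι) {μ : ℝ}
    (hμ : StrongConvexOn (P.Oi i) μ (P.g i)) {z : RMat K (n i)} (hz : z ∈ P.Xset i) :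
    ∃ C : ℝ, 0 ≤ C ∧ ∀ V ∈ P.Dset, ∀ τ : ℝ, L i V / 2 ≤ τ → ∀ x ∈ P.Xset i, ∀ x' ∈ P.Xset i,
      ∀ q, (q = P.gradX i V x' ∨ q = P.gradX i V x) →
      (∀ y ∈ P.Xset i,
        0 ≤ ⟪q + τ • (x' - x), y - x'⟫_ℝ + P.g i y - P.g i x' - μ / 2 * ‖y - x'‖ ^ 2) →
      (τ + μ) * ‖x' - z‖ ≤ τ * ‖x - z‖ + C := by
  -- This bound supplies a second `μ/2 ‖x' - z‖²` besides the one in the variational inequality,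
  -- which produces the full `μ` in the contraction.
  obtain ⟨C₁, hC₁, hcone⟩ := hμ.exists_cone_lower_bound (hP.Oi_open i) (hP.Xset_subset i hz)
  obtain ⟨ℓ, hℓ, hlip⟩ := hP.exists_lipschitz i (isCompact_singleton (x := z))
    (convex_singleton z) (singleton_subset_iff.2 (hP.Xset_subset i hz))
  obtain ⟨R, hR⟩ := (isBounded_iff_forall_norm_le.1
    (show Bornology.IsBounded ((fun V => P.gradX i V z) '' P.Dset) by
      refine (hP.Dset_compact.image_of_continuousOn ?_).isBounded
      refine (LipschitzOnWith.of_dist_le_mul (K := ⟨ℓ, hℓ⟩) fun V hV V' hV' => ?_).continuousOn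
      have := (hlip V hV V' hV' z rfl z rfl).2.1
      rw [dist_eq_norm, dist_eq_norm]
      rwa [sub_self, norm_zero, add_zero] at this))
  refine ⟨C₁ + |R|, by positivity, fun V hV τ hτ x hx x' hx' q hq hvi => ?_⟩
  have hRV : ‖P.gradX i V z‖ ≤ |R| := (hR _ ⟨V, hV, rfl⟩).trans (le_abs_self R)
  have h1 := hvi z hz
  have h2 := hcone x' (hP.Xset_subset i hx')
  rw [norm_sub_rev z x'] at h1
  -- With the gradient at the new point, monotonicity suffices; with the gradient at the old point,
  -- this is the forward step.
  have h3 : ⟪P.gradX i V z - q + τ • (x - z), x' - z⟫_ℝ ≤ τ * ‖x - z‖ * ‖x' - z‖ := by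
    have hτ0 : 0 ≤ τ := by linarith [hP.L_nonneg i V hV]
    rcases hq with rfl | rfl
    · have m1 := hP.gradX_monotone i hV hx' hz
      have m2 := real_inner_le_norm (x - z) (x' - z)
      rw [← neg_sub (P.gradX i V x'), inner_add_left, inner_neg_left, inner_smul_left]
      simp only [RCLike.conj_to_real]
      nlinarith
    · have := hP.forward_step i hV hτ hx hz hx' hz
      convert this using 2
      abel
  have h4 := (abs_le.1 (abs_real_inner_le_norm (P.gradX i V z) (x' - z))).1
  have e1 : ⟪q + τ • (x' - x), z - x'⟫_ℝ
      = ⟪P.gradX i V z - q + τ • (x - z), x' - z⟫_ℝ - ⟪P.gradX i V z, x' - z⟫_ℝ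
        - τ * ‖x' - z‖ ^ 2 := by
    rw [← real_inner_self_eq_norm_sq, ← neg_sub x' z, inner_neg_right]
    have : x' - x = (x' - z) - (x - z) := by abel
    rw [this, smul_sub]
    simp only [inner_add_left, inner_sub_left, inner_smul_left, RCLike.conj_to_real]
    ring
  rw [e1] at h1
  have h5 : ‖P.gradX i V z‖ * ‖x' - z‖ ≤ |R| * ‖x' - z‖ := by gcongr
  have h6 : ‖x' - z‖ * ((τ + μ) * ‖x' - z‖) ≤ ‖x' - z‖ * (τ * ‖x - z‖ + (C₁ + |R|)) := by
    nlinarith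
  rcases eq_or_lt_of_le (norm_nonneg (x' - z)) with h0 | h0
  · rw [← h0]
    have : 0 ≤ τ := by linarith [hP.L_nonneg i V hV]
    have : 0 ≤ τ * ‖x - z‖ := by positivity
    linarith [abs_nonneg R]
  · exact le_of_mul_le_mul_left h6 h0

/-- Successive private-variable updates contract up to the change of the dictionary. -/
lemma X_successive_contraction (hP : P.Assumptions L) (i : ι) {Z : Set (RMat K (n i))}
    (hZ : Z ⊆ P.Xset i) {ℓ : ℝ} (hℓ : ∀ D ∈ P.Dset, ∀ D' ∈ P.Dset, ∀ x ∈ Z,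
      ‖P.gradX i D x - P.gradX i D' x‖ ≤ ℓ * ‖D - D'‖)
    {V V' : RMat M K} (hV : V ∈ P.Dset) (hV' : V' ∈ P.Dset) {τ τ' μ : ℝ}
    (hτ : L i V / 2 ≤ τ) {x x' x'' q q' : RMat K (n i)} (hx : x ∈ P.Xset i) (hx' : x' ∈ Z)
    (hx'' : x'' ∈ Z) (hq : q = P.gradX i V x' ∨ q = P.gradX i V x)
    (hq' : q' = P.gradX i V' x'' ∨ q' = P.gradX i V' x')
    (hvi : ∀ y ∈ P.Xset i,
      0 ≤ ⟪q + τ • (x' - x), y - x'⟫_ℝ + P.g i y - P.g i x' - μ / 2 * ‖y - x'‖ ^ 2)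
    (hvi' : ∀ y ∈ P.Xset i,
      0 ≤ ⟪q' + τ' • (x'' - x'), y - x''⟫_ℝ + P.g i y - P.g i x'' - μ / 2 * ‖y - x''‖ ^ 2)
    (hℓ0 : 0 ≤ ℓ) :
    (τ' + μ) * ‖x'' - x'‖ ≤ τ * ‖x' - x‖ + ℓ * ‖V' - V‖ := by
  have hx's := hZ hx'
  have hx''s := hZ hx''
  have hτ0 : 0 ≤ τ := by linarith [hP.L_nonneg i V hV]
  have h1 := hvi x'' hx''s
  have h2 := hvi' x' hx's
  rw [norm_sub_rev x' x''] at h2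
  -- `r` is `q'` evaluated at the old dictionary `V`, so that both inequalities refer to the same
  -- function.
  obtain ⟨r, hr1, hr2⟩ : ∃ r, ‖q' - r‖ ≤ ℓ * ‖V' - V‖ ∧
      0 ≤ ⟪r - P.gradX i V x', x'' - x'⟫_ℝ := by
    rcases hq' with rfl | rfl
    · exact ⟨P.gradX i V x'', hℓ _ hV' _ hV _ hx'', hP.gradX_monotone i hV hx''s hx's⟩
    · exact ⟨P.gradX i V x', hℓ _ hV' _ hV _ hx', by simp⟩
  have h3 : ⟪q - P.gradX i V x' + τ • (x' - x), x'' - x'⟫_ℝ ≤ τ * ‖x' - x‖ * ‖x'' - x'‖ := by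
    rcases hq with rfl | rfl
    · rw [sub_self, zero_add, inner_smul_left]
      simp only [RCLike.conj_to_real]
      have := real_inner_le_norm (x' - x) (x'' - x')
      nlinarith
    · have := hP.forward_step i hV hτ hx's hx hx''s hx's
      convert this using 2
      abel
  have h4 := (abs_le.1 (abs_real_inner_le_norm (q' - r) (x'' - x'))).1
  have e1 : ⟪q + τ • (x' - x), x'' - x'⟫_ℝ + ⟪q' + τ' • (x'' - x'), x' - x''⟫_ℝ
      = ⟪q - P.gradX i V x' + τ • (x' - x), x'' - x'⟫_ℝ
        - ⟪r - P.gradX i V x', x'' - x'⟫_ℝ - ⟪q' - r, x'' - x'⟫_ℝ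
        - τ' * ‖x'' - x'‖ ^ 2 := by
    rw [← real_inner_self_eq_norm_sq, ← neg_sub x'' x', inner_neg_right]
    simp only [inner_add_left, inner_sub_left, inner_smul_left, RCLike.conj_to_real]
    ring
  have h5 : ‖q' - r‖ * ‖x'' - x'‖ ≤ ℓ * ‖V' - V‖ * ‖x'' - x'‖ := by gcongr
  have h6 : ‖x'' - x'‖ * ((τ' + μ) * ‖x'' - x'‖)
      ≤ ‖x'' - x'‖ * (τ * ‖x' - x‖ + ℓ * ‖V' - V‖) := by nlinarith
  rcases eq_or_lt_of_le (norm_nonneg (x'' - x')) with h0 | h0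
  · rw [← h0]
    have : 0 ≤ τ * ‖x' - x‖ := by positivity
    have : 0 ≤ ℓ * ‖V' - V‖ := by positivity
    linarith
  · exact le_of_mul_le_mul_left h6 h0

/-- Optimality of the dictionary subproblem. -/
lemma D_variational (hP : P.Assumptions L) (i : ι) {D D' Θ : RMat M K} {x : RMat K (n i)}
    (hD : D ∈ P.Dset) (hx : x ∈ P.Xset i) {τ : ℝ} {h : RMat M K → ℝ}
    (hh : h = P.surrDFull i τ D x ∨ h = P.surrDLin i τ D x)
    (hmin : IsArgmin P.Dset
      (fun y => h y + ⟪Θ - P.gradD i D x, y - D⟫_ℝ + P.G y) D') :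
    ∃ p, 0 ≤ ⟪p, D' - D⟫_ℝ ∧ ‖p‖ ≤ ‖P.gradD i D' x - P.gradD i D x‖ ∧ ∀ y ∈ P.Dset,
      0 ≤ ⟪p + τ • (D' - D) + Θ, y - D'⟫_ℝ + P.G y - P.G D' := by
  have hG : StrongConvexOn P.Dset 0 P.G :=
    strongConvexOn_zero.2 (hP.G_convex.subset hP.Dset_subset hP.Dset_convex)
  have hD'O := hP.Dset_subset hmin.1
  have hxO := hP.Xset_subset i hx
  rcases hh with rfl | rfl
  · refine ⟨P.gradD i D' x - P.gradD i D x, ?_, le_rfl, fun y hy => ?_⟩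
    · exact (hP.f_convex_D i x hxO).gradient_monotone hD'O (hP.Dset_subset hD)
        (hP.hasGradientAt_D i hD'O hxO) (hP.hasGradientAt_D i (hP.Dset_subset hD) hxO)
    · have := hmin.variational hP.Dset_convex hG
        (((hP.hasGradientAt_D i hD'O hxO).add' (hasGradientAt_half_sq τ D D')).add'
          (hasGradientAt_inner _ _ _)) hy
      simp only [zero_div, zero_mul, sub_zero] at this
      convert this using 4
      abel
  · refine ⟨0, by simp, by simp, fun y hy => ?_⟩
    have := hmin.variational hP.Dset_convex hG
        (((hasGradientAt_inner (P.gradD i D x) D D').add' (hasGradientAt_half_sq τ D D')).add'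
          (hasGradientAt_inner _ _ _)) hy
    simp only [zero_div, zero_mul, sub_zero] at this
    convert this using 4
    abel

lemma existsUnique_hatD [Fintype ι] (hP : P.Assumptions L) {τ : ℝ} (hτ : 0 < τ)
    {D : RMat M K} (hD : D ∈ P.Dset) (X : (i : ι) → RMat K (n i)) :
    ∃! D', IsArgmin P.Dset (P.hatDObj τ D X) D' :=
  existsUnique_isArgmin hP.O_open hP.Dset_subset hP.Dset_compact.isClosed hP.Dset_convex ⟨D, hD⟩
    hτ (hP.G_convex.strongConvexOn_prox τ _ _)

lemma existsUnique_hatX (hP : P.Assumptions L) {τ : ℝ} (hτ : 0 < τ) (i : ι) (D : RMat M K)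
    {x : RMat K (n i)} (hx : x ∈ P.Xset i) :
    ∃! x', IsArgmin (P.Xset i) (P.hatXObj τ i D x) x' :=
  existsUnique_isArgmin (hP.Oi_open i) (hP.Xset_subset i) (hP.Xset_closed i) (hP.Xset_convex i)
    ⟨x, hx⟩ hτ ((hP.g_convex i).strongConvexOn_prox τ _ _)

lemma hatD_variational [Fintype ι] (hP : P.Assumptions L) {τ : ℝ} (hτ : 0 < τ)
    {D : RMat M K} (hD : D ∈ P.Dset) (X : (i : ι) → RMat K (n i)) :
    argminOn P.Dset (P.hatDObj τ D X) ∈ P.Dset ∧ ∀ y ∈ P.Dset,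
      0 ≤ ⟪P.gradDF D X + τ • (argminOn P.Dset (P.hatDObj τ D X) - D),
        y - argminOn P.Dset (P.hatDObj τ D X)⟫_ℝ + P.G y
        - P.G (argminOn P.Dset (P.hatDObj τ D X)) := by
  have h := argminOn_isArgmin (hP.existsUnique_hatD hτ hD X).exists
  refine ⟨h.1, fun y hy => ?_⟩
  have hG : StrongConvexOn P.Dset 0 P.G :=
    strongConvexOn_zero.2 (hP.G_convex.subset hP.Dset_subset hP.Dset_convex)
  have := IsArgmin.variational hP.Dset_convex hG
    ((hasGradientAt_inner (P.gradDF D X) D _).add' (hasGradientAt_half_sq τ D _)) h hy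
  simpa only [zero_div, zero_mul, sub_zero] using this

lemma hatX_variational (hP : P.Assumptions L) {τ : ℝ} (hτ : 0 < τ) (i : ι) (D : RMat M K)
    {x : RMat K (n i)} (hx : x ∈ P.Xset i) :
    argminOn (P.Xset i) (P.hatXObj τ i D x) ∈ P.Xset i ∧ ∀ y ∈ P.Xset i,
      0 ≤ ⟪P.gradX i D x + τ • (argminOn (P.Xset i) (P.hatXObj τ i D x) - x),
        y - argminOn (P.Xset i) (P.hatXObj τ i D x)⟫_ℝ + P.g i y
        - P.g i (argminOn (P.Xset i) (P.hatXObj τ i D x)) := by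
  have h := argminOn_isArgmin (hP.existsUnique_hatX hτ i D hx).exists
  refine ⟨h.1, fun y hy => ?_⟩
  have hG : StrongConvexOn (P.Xset i) 0 (P.g i) :=
    strongConvexOn_zero.2 ((hP.g_convex i).subset (hP.Xset_subset i) (hP.Xset_convex i))
  have := IsArgmin.variational (hP.Xset_convex i) hG
    ((hasGradientAt_inner (P.gradX i D x) x _).add' (hasGradientAt_half_sq τ x _)) h hy
  simpa only [zero_div, zero_mul, sub_zero] using this

end Assumptions

end DLProblem

lemma ConvexOn.map_weighted_sum_le {V : Type*} [NormedAddCommGroup V] [NormedSpace ℝ V] {ι : Type*}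
    [Fintype ι] {s : Set V} {g : V → ℝ} (hg : ConvexOn ℝ s g) {w : ι → ℝ} {x : ι → V}
    (hw : ∀ i, 0 ≤ w i) (hs : ∑ i, w i = 1) (hx : ∀ i, x i ∈ s) :
    g (∑ i, w i • x i) ≤ ∑ i, w i * g (x i) := by
  simpa using hg.map_sum_le (fun i _ => hw i) hs (fun i _ => hx i)

/-! ### Boundedness of the iterates and uniform constants -/

namespace D4LIterates

variable {ι : Type*} [Fintype ι] {M K : ℕ} {n : ι → ℕ}

/-- A run together with uniform bounds on everything that enters the convergence analysis: the
private variables stay in compact convex sets `Z i`, on which the partial gradients are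
`ℓ`-Lipschitz; `R` bounds the diameter of `Dset`, `c` the push-sum weights from below, and perturbed
push-sum averaging contracts by `ρ` over `T` steps. -/
structure RegularRun (P : DLProblem ι M K n) (L : ι → RMat M K → ℝ) (E : ℕ → ι → ι → Prop)
    (A : ℕ → Matrix ι ι ℝ) (κ : ℝ) (γ : ℕ → ℝ) (S : D4LIterates ι M K n) (τD τX : ℕ → ι → ℝ)
    (ft : ℕ → (i : ι) → RMat M K → ℝ) (ht : ℕ → (i : ι) → RMat K (n i) → ℝ)
    (Z : (i : ι) → Set (RMat K (n i))) (ℓ R c ε τlo τhi ρ : ℝ) (T : ℕ) : Prop where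
  problem : P.Assumptions L
  weights : WeightAssumptions E A κ
  step : StepAssumptions γ
  run : S.IsRun P γ A ft ht
  surr : S.SurrogateAssumptions P τD τX ft ht
  Z_compact : ∀ i, IsCompact (Z i)
  Z_convex : ∀ i, Convex ℝ (Z i)
  Z_subset : ∀ i, Z i ⊆ P.Xset i
  lip_nonneg : 0 ≤ ℓ
  lipschitz : ∀ i, ∀ D ∈ P.Dset, ∀ D' ∈ P.Dset, ∀ x ∈ Z i, ∀ x' ∈ Z i,
    ‖P.gradD i D x - P.gradD i D' x'‖ ≤ ℓ * (‖D - D'‖ + ‖x - x'‖) ∧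
    ‖P.gradX i D x - P.gradX i D' x'‖ ≤ ℓ * (‖D - D'‖ + ‖x - x'‖) ∧
    |P.f i D x - P.f i D' x'| ≤ ℓ * (‖D - D'‖ + ‖x - x'‖)
  R_nonneg : 0 ≤ R
  diam_le : ∀ D ∈ P.Dset, ∀ D' ∈ P.Dset, ‖D - D'‖ ≤ R
  c_pos : 0 < c
  φ_mass : ∀ ν, ∑ i, S.φ ν i = Fintype.card ι
  φ_lower : ∀ ν i, c ≤ S.φ ν i
  D_mem : ∀ ν i, S.D ν i ∈ P.Dset
  V_mem : ∀ ν i, S.V ν i ∈ P.Dset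
  X_mem : ∀ ν i, S.X ν i ∈ Z i
  ε_pos : 0 < ε
  τX_lower : ∀ i, ∀ ν, 1 ≤ ν → 1 / 2 * L i (S.V ν i) + ε ≤ τX ν i
  τX_pos : ∀ ν i, 0 < τX ν i
  τX_upper : ∀ ν i, τX ν i ≤ τhi
  τlo_pos : 0 < τlo
  τD_lower : ∀ ν i, τlo ≤ τD ν i
  τD_upper : ∀ ν i, τD ν i ≤ τhi
  ρ_nonneg : 0 ≤ ρ
  ρ_lt_one : ρ < 1
  contraction : ∀ x e : ℕ → ι → RMat M K,
    (∀ ν i, S.φ (ν + 1) i • x (ν + 1) i = ∑ j, A ν i j • (S.φ ν j • x ν j) + e ν i) →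
    ∀ ν, spread (x (ν + T)) ≤ ρ * spread (x ν)
      + 2 / c * ∑ t ∈ Finset.range T, ∑ i, ‖e (ν + t) i‖

lemma exists_uniform_bound (u : ι → ℝ → Prop) (h : ∀ i, ∃ C, u i C)
    (hmono : ∀ i C C', C ≤ C' → u i C → u i C') : ∃ C, 0 ≤ C ∧ ∀ i, u i C := by
  choose C hC using h
  refine ⟨∑ i, |C i|, Finset.sum_nonneg fun _ _ => abs_nonneg _, fun i => hmono i _ _ ?_ (hC i)⟩
  exact (le_abs_self _).trans (Finset.single_le_sum (f := fun i => |C i|)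
    (fun _ _ => abs_nonneg _) (Finset.mem_univ i))

/-- Every dictionary update is a convex combination of feasible points; the push-sum weights, once
divided by the new `φ`, sum to one. -/
lemma IsRun.D_V_mem [Nonempty ι] {P : DLProblem ι M K n} {L : ι → RMat M K → ℝ}
    (hP : P.Assumptions L)
    {E : ℕ → ι → ι → Prop} {A : ℕ → Matrix ι ι ℝ} {κ : ℝ} (hA : WeightAssumptions E A κ)
    {γ : ℕ → ℝ} (hγ : StepAssumptions γ) {S : D4LIterates ι M K n}
    {ft : ℕ → (i : ι) → RMat M K → ℝ} {ht : ℕ → (i : ι) → RMat K (n i) → ℝ}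
    (hrun : S.IsRun P γ A ft ht) (hφ : ∀ ν i, 0 < S.φ ν i) (ν : ℕ) :
    (∀ i, S.D ν i ∈ P.Dset) ∧ ∀ i, S.V ν i ∈ P.Dset := by
  have hV : ∀ ν, (∀ i, S.D ν i ∈ P.Dset) → ∀ i, S.V ν i ∈ P.Dset := fun ν h i => by
    rw [hrun.V_update]
    exact segment_point_mem hP.Dset_convex (h i) (hrun.Dt_argmin ν i).1 (hγ.pos ν).le (hγ.le_one ν)
  have hD : ∀ i, S.D ν i ∈ P.Dset := by
    induction ν with
    | zero => exact hrun.D_init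
    | succ ν ih =>
      intro i
      rw [hrun.D_update, Finset.smul_sum]
      simp only [smul_smul]
      refine hP.Dset_convex.sum_mem (fun j _ => ?_) ?_ fun j _ => hV ν ih j
      · exact mul_nonneg (one_div_nonneg.2 (hφ _ _).le) (mul_nonneg (hA.nonneg _ _ _) (hφ _ _).le)
      · rw [← Finset.mul_sum, ← hrun.φ_update, one_div, inv_mul_cancel₀ (hφ _ _).ne']
  exact ⟨hD, hV ν hD⟩

/-- The private variables stay bounded. -/
lemma exists_compact_X {P : DLProblem ι M K n} {L : ι → RMat M K → ℝ} (hP : P.Assumptions L)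
    {γ : ℕ → ℝ} {A : ℕ → Matrix ι ι ℝ} {S : D4LIterates ι M K n} {τD τX : ℕ → ι → ℝ}
    {ft : ℕ → (i : ι) → RMat M K → ℝ} {ht : ℕ → (i : ι) → RMat K (n i) → ℝ}
    (hrun : S.IsRun P γ A ft ht) (hsurr : S.SurrogateAssumptions P τD τX ft ht)
    (hprox : S.ProxAssumptions L τD τX) (hV : ∀ ν i, S.V ν i ∈ P.Dset) (i : ι) :
    ∃ Z : Set (RMat K (n i)), IsCompact Z ∧ Convex ℝ Z ∧ Z ⊆ P.Xset i ∧ ∀ ν, S.X ν i ∈ Z := by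
  have hX : ∀ ν, S.X ν i ∈ P.Xset i := fun ν => by
    cases ν with
    | zero => exact hrun.X_init i
    | succ ν => exact (hrun.X_update ν i).1
  rcases hP.g_cases i with ⟨hc, -⟩ | ⟨μ, hμ, hg⟩
  · exact ⟨P.Xset i, hc, hP.Xset_convex i, subset_rfl, hX⟩
  · obtain ⟨C, hC, hcon⟩ := hP.exists_X_contraction i hg (hX 0)
    obtain ⟨ε, hε, hτ⟩ := hprox.τX_lower
    -- A ball of radius at least `C / μ` is invariant under the contraction. The induction starts at
    -- `X 1`, since the lower bound on `τX` is assumed only from iteration one on.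
    set B := max ‖S.X 1 i - S.X 0 i‖ (C / μ) with hB
    have hB0 : 0 ≤ B := (norm_nonneg _).trans (le_max_left _ _)
    have hCB : C ≤ μ * B := by
      have : C / μ ≤ B := le_max_right _ _
      rwa [div_le_iff₀ hμ, mul_comm] at this
    have hbound : ∀ ν, ‖S.X (ν + 1) i - S.X 0 i‖ ≤ B := by
      intro ν
      induction ν with
      | zero => exact le_max_left _ _
      | succ ν ih =>
        have hτν := hτ i (ν + 1) (by omega)
        have hL0 := hP.L_nonneg i _ (hV (ν + 1) i)
        obtain ⟨q, hq, hvi⟩ := hP.X_variational i (hV (ν + 1) i) (hsurr.ht_eq (ν + 1) i) hg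
          (hrun.X_update (ν + 1) i)
        have h1 := hcon _ (hV (ν + 1) i) (τX (ν + 1) i) (by linarith) _ (hX (ν + 1)) _
          (hX (ν + 1 + 1)) q hq hvi
        have hτ0 := hprox.τX_pos (ν + 1) i
        have h2 : (τX (ν + 1) i + μ) * ‖S.X (ν + 1 + 1) i - S.X 0 i‖
            ≤ (τX (ν + 1) i + μ) * B := by nlinarith
        exact le_of_mul_le_mul_left h2 (by linarith)
    refine ⟨P.Xset i ∩ Metric.closedBall (S.X 0 i) B,
      (isCompact_closedBall _ _).inter_left (hP.Xset_closed i),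
      (hP.Xset_convex i).inter (convex_closedBall _ _), inter_subset_left, fun ν => ⟨hX ν, ?_⟩⟩
    rw [Metric.mem_closedBall, dist_eq_norm]
    cases ν with
    | zero => simpa using hB0
    | succ ν => exact hbound ν

/-- Once the private variables are confined to compact convex sets, `C²` regularity gives uniform
Lipschitz constants, and finiteness of `ι` makes them common to all agents. -/
theorem exists_regularRun [Nonempty ι] {P : DLProblem ι M K n} {L : ι → RMat M K → ℝ}
    (hP : P.Assumptions L) {E : ℕ → ι → ι → Prop} (hE : BStronglyConnected E)
    {A : ℕ → Matrix ι ι ℝ} {κ : ℝ} (hA : WeightAssumptions E A κ)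
    {γ : ℕ → ℝ} (hγ : StepAssumptions γ) {S : D4LIterates ι M K n} {τD τX : ℕ → ι → ℝ}
    {ft : ℕ → (i : ι) → RMat M K → ℝ} {ht : ℕ → (i : ι) → RMat K (n i) → ℝ}
    (hrun : S.IsRun P γ A ft ht) (hsurr : S.SurrogateAssumptions P τD τX ft ht)
    (hprox : S.ProxAssumptions L τD τX) :
    ∃ (Z : (i : ι) → Set (RMat K (n i))) (ℓ R c ε τlo τhi ρ : ℝ) (T : ℕ),
      RegularRun P L E A κ γ S τD τX ft ht Z ℓ R c ε τlo τhi ρ T := by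
  obtain ⟨T, ρ, c, hρ, hρ1, hc, hmass, hlow, hcontr⟩ :=
    hA.exists_contraction (V := RMat M K) hE hrun.φ_init hrun.φ_update
  have hφ : ∀ ν i, 0 < S.φ ν i := fun ν i => hc.trans_le (hlow ν i)
  have hDV := hrun.D_V_mem hP hA hγ hφ
  choose Z hZ1 hZ2 hZ3 hZ4 using
    fun i => exists_compact_X hP hrun hsurr hprox (fun ν i => (hDV ν).2 i) i
  obtain ⟨ℓ, hℓ0, hℓ⟩ := exists_uniform_bound
    (fun i C => 0 ≤ C ∧ ∀ D ∈ P.Dset, ∀ D' ∈ P.Dset, ∀ x ∈ Z i, ∀ x' ∈ Z i,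
      ‖P.gradD i D x - P.gradD i D' x'‖ ≤ C * (‖D - D'‖ + ‖x - x'‖) ∧
      ‖P.gradX i D x - P.gradX i D' x'‖ ≤ C * (‖D - D'‖ + ‖x - x'‖) ∧
      |P.f i D x - P.f i D' x'| ≤ C * (‖D - D'‖ + ‖x - x'‖))
    (fun i => hP.exists_lipschitz i (hZ1 i) (hZ2 i) ((hZ3 i).trans (hP.Xset_subset i)))
    (fun i C C' hC h => ⟨h.1.trans hC, fun D hD D' hD' x hx x' hx' => by
      obtain ⟨h1, h2, h3⟩ := h.2 D hD D' hD' x hx x' hx'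
      have : C * (‖D - D'‖ + ‖x - x'‖) ≤ C' * (‖D - D'‖ + ‖x - x'‖) := by gcongr
      exact ⟨h1.trans this, h2.trans this, h3.trans this⟩⟩)
  obtain ⟨C₁, hC₁0, hC₁⟩ := exists_uniform_bound (fun i C => ∀ ν, τD ν i ≤ C) hprox.τD_upper
    fun i C C' h h' ν => (h' ν).trans h
  obtain ⟨C₂, hC₂0, hC₂⟩ := exists_uniform_bound (fun i C => ∀ ν, τX ν i ≤ C) hprox.τX_upper
    fun i C C' h h' ν => (h' ν).trans h
  obtain ⟨ε, hε, hτ⟩ := hprox.τX_lower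
  choose lo hlo0 hlo using hprox.τD_lower
  obtain ⟨R, hR⟩ := isBounded_iff_forall_norm_le.1 hP.Dset_compact.isBounded
  refine ⟨Z, ℓ, 2 * |R|, c, ε, Finset.univ.inf' Finset.univ_nonempty lo, max C₁ C₂, ρ, T,
    { problem := hP, weights := hA, step := hγ, run := hrun, surr := hsurr, Z_compact := hZ1,
      Z_convex := hZ2, Z_subset := hZ3, lip_nonneg := hℓ0, lipschitz := fun i => (hℓ i).2,
      R_nonneg := by positivity, diam_le := fun D hD D' hD' => ?_, c_pos := hc, φ_mass := hmass,
      φ_lower := hlow, D_mem := fun ν => (hDV ν).1, V_mem := fun ν => (hDV ν).2,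
      X_mem := fun ν i => hZ4 i ν, ε_pos := hε, τX_lower := hτ, τX_pos := hprox.τX_pos,
      τX_upper := fun ν i => (hC₂ i ν).trans (le_max_right _ _),
      τlo_pos := (Finset.lt_inf'_iff _).2 fun i _ => hlo0 i,
      τD_lower := fun ν i => (Finset.inf'_le _ (Finset.mem_univ i)).trans (hlo i ν),
      τD_upper := fun ν i => (hC₁ i ν).trans (le_max_left _ _),
      ρ_nonneg := hρ, ρ_lt_one := hρ1, contraction := hcontr }⟩
  have h1 := (hR D hD).trans (le_abs_self R)
  have h2 := (hR D' hD').trans (le_abs_self R)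
  linarith [norm_sub_le D D']

end D4LIterates

/-! ### Weighted mean, moves and Lyapunov value -/

namespace D4LIterates

variable {ι : Type*} [Fintype ι] {M K : ℕ} {n : ι → ℕ}

/-- The push-sum weighted mean of the local dictionaries. -/
noncomputable def mean (S : D4LIterates ι M K n) (ν : ℕ) : RMat M K :=
  ∑ i, (S.φ ν i / Fintype.card ι) • S.D ν i

/-- Total squared change of the private variables in one iteration. -/
noncomputable def moveX (S : D4LIterates ι M K n) (ν : ℕ) : ℝ :=
  ∑ i, ‖S.X (ν + 1) i - S.X ν i‖ ^ 2

/-- Total squared length of the dictionary directions. -/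
noncomputable def moveD (S : D4LIterates ι M K n) (ν : ℕ) : ℝ :=
  ∑ i, ‖S.Dt ν i - S.D ν i‖ ^ 2

/-- The merit value that decreases along the iterations up to summable errors. -/
noncomputable def lyapunov (S : D4LIterates ι M K n) (P : DLProblem ι M K n) (ν : ℕ) : ℝ :=
  P.F (S.mean ν) (S.X ν) + ∑ i, P.g i (S.X ν i)
    + ∑ i, S.φ ν i / Fintype.card ι * P.G (S.D ν i)

namespace RegularRun

variable {P : DLProblem ι M K n} {L : ι → RMat M K → ℝ} {E : ℕ → ι → ι → Prop}
    {A : ℕ → Matrix ι ι ℝ} {κ : ℝ} {γ : ℕ → ℝ} {S : D4LIterates ι M K n} {τD τX : ℕ → ι → ℝ}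
    {ft : ℕ → (i : ι) → RMat M K → ℝ} {ht : ℕ → (i : ι) → RMat K (n i) → ℝ}
    {Z : (i : ι) → Set (RMat K (n i))} {ℓ R c ε τlo τhi ρ : ℝ} {T : ℕ}

/-! ### Consensus of the local dictionaries -/

section Consensus

lemma φ_pos (r : RegularRun P L E A κ γ S τD τX ft ht Z ℓ R c ε τlo τhi ρ T) (ν : ℕ) (i : ι) :
    0 < S.φ ν i :=
  r.c_pos.trans_le (r.φ_lower ν i)

lemma X_mem_Xset (r : RegularRun P L E A κ γ S τD τX ft ht Z ℓ R c ε τlo τhi ρ T) (ν : ℕ)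
    (i : ι) : S.X ν i ∈ P.Xset i :=
  r.Z_subset i (r.X_mem ν i)

lemma X_mem_Oi (r : RegularRun P L E A κ γ S τD τX ft ht Z ℓ R c ε τlo τhi ρ T) (ν : ℕ)
    (i : ι) : S.X ν i ∈ P.Oi i :=
  r.problem.Xset_subset i (r.X_mem_Xset ν i)

lemma Dt_mem (r : RegularRun P L E A κ γ S τD τX ft ht Z ℓ R c ε τlo τhi ρ T) (ν : ℕ) (i : ι) :
    S.Dt ν i ∈ P.Dset :=
  (r.run.Dt_argmin ν i).1

lemma weight_nonneg (r : RegularRun P L E A κ γ S τD τX ft ht Z ℓ R c ε τlo τhi ρ T) (ν : ℕ)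
    (i : ι) : 0 ≤ S.φ ν i / Fintype.card ι :=
  div_nonneg (r.φ_pos ν i).le (Nat.cast_nonneg _)

lemma weight_sum [Nonempty ι] (r : RegularRun P L E A κ γ S τD τX ft ht Z ℓ R c ε τlo τhi ρ T)
    (ν : ℕ) : ∑ i, S.φ ν i / Fintype.card ι = 1 := by
  rw [← Finset.sum_div, r.φ_mass, div_self]
  exact_mod_cast Fintype.card_ne_zero

lemma norm_Dt_sub_D_le (r : RegularRun P L E A κ γ S τD τX ft ht Z ℓ R c ε τlo τhi ρ T) (ν : ℕ)
    (i : ι) : ‖S.Dt ν i - S.D ν i‖ ≤ R :=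
  r.diam_le _ (r.Dt_mem ν i) _ (r.D_mem ν i)

lemma norm_V_sub_D_le (r : RegularRun P L E A κ γ S τD τX ft ht Z ℓ R c ε τlo τhi ρ T) (ν : ℕ)
    (i : ι) : ‖S.V ν i - S.D ν i‖ ≤ γ ν * R := by
  rw [r.run.V_update, add_sub_cancel_left, norm_smul, Real.norm_of_nonneg (r.step.pos ν).le]
  exact mul_le_mul_of_nonneg_left (r.norm_Dt_sub_D_le ν i) (r.step.pos ν).le

lemma norm_V_sub_V_le (r : RegularRun P L E A κ γ S τD τX ft ht Z ℓ R c ε τlo τhi ρ T) (ν : ℕ)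
    (i j : ι) : ‖S.V ν i - S.V ν j‖ ≤ spread (S.D ν) + 2 * (γ ν * R) := by
  have h1 := r.norm_V_sub_D_le ν i
  have h2 := r.norm_V_sub_D_le ν j
  have h3 := norm_sub_le_spread (S.D ν) i j
  have h4 : S.V ν i - S.V ν j
      = (S.V ν i - S.D ν i) + (S.D ν i - S.D ν j) - (S.V ν j - S.D ν j) := by abel
  rw [h4]
  refine (norm_sub_le _ _).trans ?_
  have := norm_add_le (S.V ν i - S.D ν i) (S.D ν i - S.D ν j)
  linarith

lemma mixing_nonneg (r : RegularRun P L E A κ γ S τD τX ft ht Z ℓ R c ε τlo τhi ρ T) (ν : ℕ)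
    (i j : ι) : 0 ≤ A ν i j * S.φ ν j / S.φ (ν + 1) i :=
  div_nonneg (mul_nonneg (r.weights.nonneg _ _ _) (r.φ_pos _ _).le) (r.φ_pos _ _).le

lemma mixing_sum (r : RegularRun P L E A κ γ S τD τX ft ht Z ℓ R c ε τlo τhi ρ T) (ν : ℕ)
    (i : ι) : ∑ j, A ν i j * S.φ ν j / S.φ (ν + 1) i = 1 := by
  rw [← Finset.sum_div, ← r.run.φ_update, div_self (r.φ_pos _ _).ne']

lemma D_succ_eq (r : RegularRun P L E A κ γ S τD τX ft ht Z ℓ R c ε τlo τhi ρ T) (ν : ℕ)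
    (i : ι) : S.D (ν + 1) i = ∑ j, (A ν i j * S.φ ν j / S.φ (ν + 1) i) • S.V ν j := by
  rw [r.run.D_update, Finset.smul_sum]
  refine Finset.sum_congr rfl fun j _ => ?_
  rw [smul_smul, one_div_mul_eq_div]

lemma φ_smul_D_succ (r : RegularRun P L E A κ γ S τD τX ft ht Z ℓ R c ε τlo τhi ρ T) (ν : ℕ)
    (i : ι) : S.φ (ν + 1) i • S.D (ν + 1) i = ∑ j, A ν i j • (S.φ ν j • S.V ν j) := by
  rw [r.run.D_update, smul_smul, mul_one_div_cancel (r.φ_pos _ _).ne', one_smul]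
  simp only [smul_smul]

lemma φ_smul_Θ_succ (r : RegularRun P L E A κ γ S τD τX ft ht Z ℓ R c ε τlo τhi ρ T) (ν : ℕ)
    (i : ι) : S.φ (ν + 1) i • S.Θ (ν + 1) i = ∑ j, A ν i j • (S.φ ν j • S.Θ ν j)
      + (P.gradD i (S.D (ν + 1) i) (S.X (ν + 1) i) - P.gradD i (S.D ν i) (S.X ν i)) := by
  rw [r.run.Θ_update, smul_add, smul_smul, smul_smul, mul_one_div_cancel (r.φ_pos _ _).ne',
    one_smul, one_smul]
  simp only [smul_smul]

lemma norm_D_succ_sub_V_le (r : RegularRun P L E A κ γ S τD τX ft ht Z ℓ R c ε τlo τhi ρ T)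
    (ν : ℕ) (i : ι) : ‖S.D (ν + 1) i - S.V ν i‖ ≤ spread (S.D ν) + 2 * (γ ν * R) := by
  rw [norm_sub_rev, r.D_succ_eq]
  exact norm_sub_average_le (r.mixing_nonneg ν i) (r.mixing_sum ν i) fun j =>
    r.norm_V_sub_V_le ν i j

lemma norm_D_succ_sub_D_le (r : RegularRun P L E A κ γ S τD τX ft ht Z ℓ R c ε τlo τhi ρ T)
    (ν : ℕ) (i : ι) : ‖S.D (ν + 1) i - S.D ν i‖ ≤ spread (S.D ν) + 3 * (γ ν * R) := by
  have h1 := r.norm_D_succ_sub_V_le ν i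
  have h2 := r.norm_V_sub_D_le ν i
  have h3 := norm_sub_le_norm_sub_add_norm_sub (S.D (ν + 1) i) (S.V ν i) (S.D ν i)
  linarith

lemma norm_V_succ_sub_V_le (r : RegularRun P L E A κ γ S τD τX ft ht Z ℓ R c ε τlo τhi ρ T)
    (ν : ℕ) (i : ι) :
    ‖S.V (ν + 1) i - S.V ν i‖ ≤ spread (S.D ν) + 2 * (γ ν * R) + γ (ν + 1) * R := by
  have h1 := r.norm_D_succ_sub_V_le ν i
  have h2 := r.norm_V_sub_D_le (ν + 1) i
  have h3 := norm_sub_le_norm_sub_add_norm_sub (S.V (ν + 1) i) (S.D (ν + 1) i) (S.V ν i)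
  linarith

/-- Unit column sums make the `φ`-weighted mean invariant under mixing, so only the local steps move
it. The uniform average `Dbar` lacks this property, which is why the descent argument uses `mean`.
-/
lemma mean_succ (r : RegularRun P L E A κ γ S τD τX ft ht Z ℓ R c ε τlo τhi ρ T) (ν : ℕ) :
    S.mean (ν + 1) = ∑ j, (S.φ ν j / Fintype.card ι) • S.V ν j := by
  have h : ∀ i, (S.φ (ν + 1) i / Fintype.card ι) • S.D (ν + 1) i
      = ∑ j, A ν i j • ((S.φ ν j / Fintype.card ι) • S.V ν j) := by
    intro i
    rw [div_eq_inv_mul, mul_smul, r.φ_smul_D_succ, Finset.smul_sum]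
    refine Finset.sum_congr rfl fun j _ => ?_
    simp only [smul_smul]
    congr 1
    ring
  rw [mean]
  simp only [h]
  rw [Finset.sum_comm]
  simp only [← Finset.sum_smul, r.weights.colsum, one_smul]

lemma mean_mem [Nonempty ι] (r : RegularRun P L E A κ γ S τD τX ft ht Z ℓ R c ε τlo τhi ρ T)
    (ν : ℕ) : S.mean ν ∈ P.Dset :=
  r.problem.Dset_convex.sum_mem (fun i _ => r.weight_nonneg ν i) (r.weight_sum ν)
    fun i _ => r.D_mem ν i

lemma Dbar_eq (S : D4LIterates ι M K n) (ν : ℕ) :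
    S.Dbar ν = ∑ i, (1 / (Fintype.card ι : ℝ)) • S.D ν i := by
  rw [Dbar, Finset.smul_sum]

lemma uniform_weight_sum [Nonempty ι] : ∑ _i : ι, (1 / (Fintype.card ι : ℝ)) = 1 := by
  simp

lemma Dbar_mem [Nonempty ι] (r : RegularRun P L E A κ γ S τD τX ft ht Z ℓ R c ε τlo τhi ρ T)
    (ν : ℕ) : S.Dbar ν ∈ P.Dset := by
  rw [Dbar_eq]
  exact r.problem.Dset_convex.sum_mem (fun i _ => by positivity) uniform_weight_sum
    fun i _ => r.D_mem ν i

lemma norm_D_sub_mean_le [Nonempty ι]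
    (r : RegularRun P L E A κ γ S τD τX ft ht Z ℓ R c ε τlo τhi ρ T) (ν : ℕ) (i : ι) :
    ‖S.D ν i - S.mean ν‖ ≤ spread (S.D ν) :=
  norm_sub_average_le (r.weight_nonneg ν) (r.weight_sum ν) fun j => norm_sub_le_spread _ i j

lemma norm_D_sub_Dbar_le [Nonempty ι] (S : D4LIterates ι M K n) (ν : ℕ) (i : ι) :
    ‖S.D ν i - S.Dbar ν‖ ≤ spread (S.D ν) := by
  rw [Dbar_eq]
  exact norm_sub_average_le (fun _ => by positivity) uniform_weight_sum fun j =>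
    norm_sub_le_spread _ i j

lemma norm_mean_succ_sub_V_le [Nonempty ι]
    (r : RegularRun P L E A κ γ S τD τX ft ht Z ℓ R c ε τlo τhi ρ T) (ν : ℕ) (i : ι) :
    ‖S.mean (ν + 1) - S.V ν i‖ ≤ spread (S.D ν) + 2 * (γ ν * R) := by
  rw [norm_sub_rev, r.mean_succ]
  exact norm_sub_average_le (r.weight_nonneg ν) (r.weight_sum ν) fun j => r.norm_V_sub_V_le ν i j

lemma mean_succ_sub_mean (r : RegularRun P L E A κ γ S τD τX ft ht Z ℓ R c ε τlo τhi ρ T)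
    (ν : ℕ) : S.mean (ν + 1) - S.mean ν
      = ∑ j, (S.φ ν j / Fintype.card ι) • (γ ν • (S.Dt ν j - S.D ν j)) := by
  rw [r.mean_succ, mean, ← Finset.sum_sub_distrib]
  refine Finset.sum_congr rfl fun j _ => ?_
  rw [← smul_sub, r.run.V_update, add_sub_cancel_left]

lemma norm_mean_succ_sub_mean_le [Nonempty ι]
    (r : RegularRun P L E A κ γ S τD τX ft ht Z ℓ R c ε τlo τhi ρ T) (ν : ℕ) :
    ‖S.mean (ν + 1) - S.mean ν‖ ≤ γ ν * R := by
  rw [r.mean_succ_sub_mean]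
  calc _ ≤ ∑ j, S.φ ν j / Fintype.card ι * (γ ν * R) := by
        refine norm_sum_le_of_le _ fun j _ => ?_
        rw [norm_smul, norm_smul, Real.norm_of_nonneg (r.weight_nonneg ν j),
          Real.norm_of_nonneg (r.step.pos ν).le]
        exact mul_le_mul_of_nonneg_left (mul_le_mul_of_nonneg_left (r.norm_Dt_sub_D_le ν j)
          (r.step.pos ν).le) (r.weight_nonneg ν j)
    _ = γ ν * R := by rw [← Finset.sum_mul, r.weight_sum, one_mul]

lemma spread_D_window (r : RegularRun P L E A κ γ S τD τX ft ht Z ℓ R c ε τlo τhi ρ T) (ν : ℕ) :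
    spread (S.D (ν + T)) ≤ ρ * spread (S.D ν)
      + 2 / c * (Fintype.card ι * R) * ∑ s ∈ Finset.range T, γ (ν + s) := by
  have h := r.contraction S.D
    (fun ν i => ∑ j, A ν i j • (S.φ ν j • (S.V ν j - S.D ν j))) (fun ν i => by
      rw [r.φ_smul_D_succ, ← Finset.sum_add_distrib]
      refine Finset.sum_congr rfl fun j _ => ?_
      module) ν
  refine h.trans ?_
  rw [mul_assoc (2 / c), Finset.mul_sum _ _ (Fintype.card ι * R)]
  have hc := r.c_pos
  gcongr with s hs
  calc _ ≤ ∑ j, ‖S.φ (ν + s) j • (S.V (ν + s) j - S.D (ν + s) j)‖ :=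
        r.weights.sum_norm_mix_le (ν + s) _
    _ ≤ ∑ j, S.φ (ν + s) j * (γ (ν + s) * R) := Finset.sum_le_sum fun j _ => by
        rw [norm_smul, Real.norm_of_nonneg (r.φ_pos _ _).le]
        exact mul_le_mul_of_nonneg_left (r.norm_V_sub_D_le _ j) (r.φ_pos _ _).le
    _ = Fintype.card ι * R * γ (ν + s) := by rw [← Finset.sum_mul, r.φ_mass]; ring

lemma summable_window {u : ℕ → ℝ} (hu : Summable u) (T : ℕ) :
    Summable fun ν => ∑ s ∈ Finset.range T, u (ν + s) :=
  summable_sum fun s _ => (summable_nat_add_iff s).2 hu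

/-- The spread contracts up to a window of step sizes, and these are square summable. -/
lemma summable_spread_D_sq (r : RegularRun P L E A κ γ S τD τX ft ht Z ℓ R c ε τlo τhi ρ T) :
    Summable fun ν => spread (S.D ν) ^ 2 := by
  set C := 2 / c * (Fintype.card ι * R) with hC
  have hρ : 0 < 1 - ρ := by linarith [r.ρ_lt_one]
  refine summable_of_window (b := fun ν => 1 / (1 - ρ) * (C ^ 2 * (T *
      ∑ s ∈ Finset.range T, γ (ν + s) ^ 2))) (T := T) (fun _ => sq_nonneg _) r.ρ_nonneg r.ρ_lt_one
    (fun ν => ?_) (fun ν => ?_) ?_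
  · refine (sq_le_of_contraction r.ρ_nonneg r.ρ_lt_one (spread_nonneg _)
      (r.spread_D_window ν)).trans ?_
    rw [mul_pow]
    gcongr
    exact sq_sum_range_le _ _
  · exact mul_nonneg (by positivity) (mul_nonneg (sq_nonneg _) (mul_nonneg (Nat.cast_nonneg _)
      (Finset.sum_nonneg fun _ _ => sq_nonneg _)))
  · exact (((summable_window r.step.sq_summable T).mul_left _).mul_left _).mul_left _

lemma tendsto_zero_of_summable_sq {u : ℕ → ℝ} (hu : Summable fun ν => u ν ^ 2) :
    Tendsto u atTop (𝓝 0) := by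
  have h := hu.tendsto_atTop_zero
  have h2 := (Real.continuous_sqrt.tendsto 0).comp h
  rw [Real.sqrt_zero] at h2
  refine (tendsto_zero_iff_abs_tendsto_zero u).2 (h2.congr fun ν => ?_)
  simp [Real.sqrt_sq_eq_abs]

lemma tendsto_spread_D (r : RegularRun P L E A κ γ S τD τX ft ht Z ℓ R c ε τlo τhi ρ T) :
    Tendsto (fun ν => spread (S.D ν)) atTop (𝓝 0) :=
  tendsto_zero_of_summable_sq r.summable_spread_D_sq

lemma tendsto_step (r : RegularRun P L E A κ γ S τD τX ft ht Z ℓ R c ε τlo τhi ρ T) :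
    Tendsto γ atTop (𝓝 0) :=
  tendsto_zero_of_summable_sq r.step.sq_summable

end Consensus

/-! ### Gradient tracking -/

section Tracking

lemma norm_gradD_succ_sub_le
    (r : RegularRun P L E A κ γ S τD τX ft ht Z ℓ R c ε τlo τhi ρ T) (ν : ℕ) (i : ι) :
    ‖P.gradD i (S.D (ν + 1) i) (S.X (ν + 1) i) - P.gradD i (S.D ν i) (S.X ν i)‖
      ≤ ℓ * (spread (S.D ν) + 3 * (γ ν * R) + ‖S.X (ν + 1) i - S.X ν i‖) := by
  refine (r.lipschitz i _ (r.D_mem _ i) _ (r.D_mem _ i) _ (r.X_mem _ i) _ (r.X_mem _ i)).1.trans ?_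
  exact mul_le_mul_of_nonneg_left (add_le_add_left (r.norm_D_succ_sub_D_le ν i) _) r.lip_nonneg

lemma spread_Θ_window (r : RegularRun P L E A κ γ S τD τX ft ht Z ℓ R c ε τlo τhi ρ T) (ν : ℕ) :
    spread (S.Θ (ν + T)) ≤ ρ * spread (S.Θ ν) + 2 / c * ∑ s ∈ Finset.range T, ∑ i,
      ℓ * (spread (S.D (ν + s)) + 3 * (γ (ν + s) * R)
        + ‖S.X (ν + s + 1) i - S.X (ν + s) i‖) := by
  refine (r.contraction S.Θ _ r.φ_smul_Θ_succ ν).trans ?_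
  have hc := r.c_pos
  gcongr with s hs i hi
  exact r.norm_gradD_succ_sub_le (ν + s) i

/-- The estimate is put in squared form so that the private moves enter through `moveX`, the
quantity that the descent controls. -/
lemma exists_spread_Θ_sq_window
    (r : RegularRun P L E A κ γ S τD τX ft ht Z ℓ R c ε τlo τhi ρ T) :
    ∃ C : ℝ, 0 ≤ C ∧ ∀ ν, spread (S.Θ (ν + T)) ^ 2 ≤ ρ * spread (S.Θ ν) ^ 2
      + C * ∑ s ∈ Finset.range T,
        (S.moveX (ν + s) + (spread (S.D (ν + s)) ^ 2 + γ (ν + s) ^ 2)) := by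
  set N := (Fintype.card ι : ℝ) with hN
  have hN0 : 0 ≤ N := Nat.cast_nonneg _
  have hρ : 0 < 1 - ρ := by linarith [r.ρ_lt_one]
  have hc := r.c_pos
  set B := 3 * N * ℓ ^ 2 * (1 + N + 9 * N * R ^ 2) with hB
  have hB0 : 0 ≤ B := by positivity
  refine ⟨1 / (1 - ρ) * ((2 / c) ^ 2 * (T * B)), by positivity, fun ν => ?_⟩
  refine (sq_le_of_contraction r.ρ_nonneg r.ρ_lt_one (spread_nonneg _)
      (r.spread_Θ_window ν)).trans ?_
  rw [mul_pow, mul_assoc (1 / (1 - ρ)), mul_assoc ((2 / c) ^ 2), mul_assoc (T : ℝ)]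
  gcongr
  refine (sq_sum_range_le _ _).trans ?_
  gcongr
  rw [Finset.mul_sum]
  refine Finset.sum_le_sum fun s _ => ?_
  set d := spread (S.D (ν + s))
  set g := γ (ν + s)
  have h1 : (∑ i, ℓ * (d + 3 * (g * R) + ‖S.X (ν + s + 1) i - S.X (ν + s) i‖)) ^ 2
      ≤ N * ∑ i, (ℓ * (d + 3 * (g * R) + ‖S.X (ν + s + 1) i - S.X (ν + s) i‖)) ^ 2 := by
    simpa using sq_sum_le_card_mul_sum_sq (s := (Finset.univ : Finset ι))
      (f := fun i => ℓ * (d + 3 * (g * R) + ‖S.X (ν + s + 1) i - S.X (ν + s) i‖))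
  refine h1.trans ?_
  have h2 : ∑ i, (ℓ * (d + 3 * (g * R) + ‖S.X (ν + s + 1) i - S.X (ν + s) i‖)) ^ 2
      ≤ ∑ i, (3 * ℓ ^ 2) * (d ^ 2 + 9 * R ^ 2 * g ^ 2
          + ‖S.X (ν + s + 1) i - S.X (ν + s) i‖ ^ 2) := by
    refine Finset.sum_le_sum fun i _ => ?_
    set δ := ‖S.X (ν + s + 1) i - S.X (ν + s) i‖
    have : (d + 3 * (g * R) + δ) ^ 2 ≤ 3 * (d ^ 2 + 9 * R ^ 2 * g ^ 2 + δ ^ 2) := by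
      nlinarith [sq_nonneg (d - 3 * (g * R)), sq_nonneg (d - δ), sq_nonneg (3 * (g * R) - δ)]
    calc _ = ℓ ^ 2 * (d + 3 * (g * R) + δ) ^ 2 := by ring
      _ ≤ ℓ ^ 2 * (3 * (d ^ 2 + 9 * R ^ 2 * g ^ 2 + δ ^ 2)) := by gcongr
      _ = _ := by ring
  refine (mul_le_mul_of_nonneg_left h2 hN0).trans ?_
  rw [← Finset.mul_sum, Finset.sum_add_distrib, Finset.sum_const, Finset.card_univ, nsmul_eq_mul]
  have hq : 0 ≤ S.moveX (ν + s) := Finset.sum_nonneg fun _ _ => sq_nonneg _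
  change N * (3 * ℓ ^ 2 * (N * (d ^ 2 + 9 * R ^ 2 * g ^ 2) + S.moveX (ν + s))) ≤ _
  have e : N * (3 * ℓ ^ 2 * (N * (d ^ 2 + 9 * R ^ 2 * g ^ 2) + S.moveX (ν + s)))
      = 3 * N * ℓ ^ 2 * (N * d ^ 2 + 9 * N * R ^ 2 * g ^ 2 + S.moveX (ν + s)) := by ring
  rw [e, hB, mul_assoc (3 * N * ℓ ^ 2)]
  refine mul_le_mul_of_nonneg_left ?_ (by positivity)
  have p1 : 0 ≤ 9 * N * R ^ 2 := by positivity
  nlinarith [mul_nonneg hN0 hq, mul_nonneg p1 hq, mul_nonneg p1 (sq_nonneg d),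
    mul_nonneg hN0 (sq_nonneg g), sq_nonneg d, sq_nonneg g]

/-- The tracking invariant: mixing preserves the weighted total, the gradient increments telescope,
and the initialization matches because `φ 0 i = 1`. -/
lemma sum_φ_smul_Θ (r : RegularRun P L E A κ γ S τD τX ft ht Z ℓ R c ε τlo τhi ρ T) (ν : ℕ) :
    ∑ i, S.φ ν i • S.Θ ν i = ∑ i, P.gradD i (S.D ν i) (S.X ν i) := by
  induction ν with
  | zero => simp [r.run.φ_init, r.run.Θ_init]
  | succ ν ih =>
    simp only [r.φ_smul_Θ_succ, Finset.sum_add_distrib, Finset.sum_sub_distrib]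
    rw [Finset.sum_comm]
    simp only [← Finset.sum_smul, r.weights.colsum, one_smul, ih]
    abel

/-- The local trackers approximate the gradient of `F` near the consensus point. -/
lemma norm_tracker_sub_gradDF_le
    (r : RegularRun P L E A κ γ S τD τX ft ht Z ℓ R c ε τlo τhi ρ T) (ν : ℕ) (i : ι)
    {D : RMat M K} (hD : D ∈ P.Dset) (hdist : ∀ j, ‖S.D ν j - D‖ ≤ spread (S.D ν)) :
    ‖(Fintype.card ι : ℝ) • S.Θ ν i - P.gradDF D (S.X ν)‖
      ≤ Fintype.card ι * spread (S.Θ ν) + Fintype.card ι * (ℓ * spread (S.D ν)) := by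
  rw [r.problem.gradDF_eq_sum (r.problem.Dset_subset hD) (r.X_mem_Oi ν)]
  -- The factor `card ι` is the total mass `∑ j, φ ν j`, so the tracker can be compared with each of
  -- the others.
  have e : (Fintype.card ι : ℝ) • S.Θ ν i - ∑ j, P.gradD j D (S.X ν j)
      = ∑ j, S.φ ν j • (S.Θ ν i - S.Θ ν j)
        + ∑ j, (P.gradD j (S.D ν j) (S.X ν j) - P.gradD j D (S.X ν j)) := by
    simp only [smul_sub, Finset.sum_sub_distrib, ← Finset.sum_smul, r.φ_mass, r.sum_φ_smul_Θ]
    abel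
  rw [e]
  refine (norm_add_le _ _).trans (add_le_add ?_ ?_)
  · calc _ ≤ ∑ j, S.φ ν j * spread (S.Θ ν) := norm_sum_le_of_le _ fun j _ => by
          rw [norm_smul, Real.norm_of_nonneg (r.φ_pos _ _).le]
          exact mul_le_mul_of_nonneg_left (norm_sub_le_spread _ i j) (r.φ_pos _ _).le
      _ = _ := by rw [← Finset.sum_mul, r.φ_mass]
  · calc _ ≤ ∑ _j : ι, ℓ * spread (S.D ν) := norm_sum_le_of_le _ fun j _ => by
          have := (r.lipschitz j _ (r.D_mem ν j) _ hD _ (r.X_mem ν j) _ (r.X_mem ν j)).1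
          rw [sub_self, norm_zero, add_zero] at this
          exact this.trans (mul_le_mul_of_nonneg_left (hdist j) r.lip_nonneg)
      _ = _ := by simp

lemma norm_gradDF_sub_le (r : RegularRun P L E A κ γ S τD τX ft ht Z ℓ R c ε τlo τhi ρ T)
    {D D' : RMat M K} (hD : D ∈ P.Dset) (hD' : D' ∈ P.Dset) {X X' : (i : ι) → RMat K (n i)}
    (hX : ∀ i, X i ∈ Z i) (hX' : ∀ i, X' i ∈ Z i) :
    ‖P.gradDF D X - P.gradDF D' X'‖ ≤ ∑ i, ℓ * (‖D - D'‖ + ‖X i - X' i‖) := by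
  have hO : ∀ {X : (i : ι) → RMat K (n i)}, (∀ i, X i ∈ Z i) → ∀ i, X i ∈ P.Oi i :=
    fun h i => r.problem.Xset_subset i (r.Z_subset i (h i))
  rw [r.problem.gradDF_eq_sum (r.problem.Dset_subset hD) (hO hX),
    r.problem.gradDF_eq_sum (r.problem.Dset_subset hD') (hO hX'), ← Finset.sum_sub_distrib]
  exact norm_sum_le_of_le _ fun i _ => (r.lipschitz i _ hD _ hD' _ (hX i) _ (hX' i)).1

end Tracking

end RegularRun

end D4LIterates

/-! ### Descent of the Lyapunov value and summability -/

namespace D4LIterates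

variable {ι : Type*} [Fintype ι] {M K : ℕ} {n : ι → ℕ}

namespace RegularRun

variable {P : DLProblem ι M K n} {L : ι → RMat M K → ℝ} {E : ℕ → ι → ι → Prop}
    {A : ℕ → Matrix ι ι ℝ} {κ : ℝ} {γ : ℕ → ℝ} {S : D4LIterates ι M K n} {τD τX : ℕ → ι → ℝ}
    {ft : ℕ → (i : ι) → RMat M K → ℝ} {ht : ℕ → (i : ι) → RMat K (n i) → ℝ}
    {Z : (i : ι) → Set (RMat K (n i))} {ℓ R c ε τlo τhi ρ : ℝ} {T : ℕ}

section Descent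

lemma D_step (r : RegularRun P L E A κ γ S τD τX ft ht Z ℓ R c ε τlo τhi ρ T) (ν : ℕ) (i : ι) :
    ∃ p, 0 ≤ ⟪p, S.Dt ν i - S.D ν i⟫_ℝ ∧ ‖p‖ ≤ ℓ * ‖S.Dt ν i - S.D ν i‖ ∧ ∀ y ∈ P.Dset,
      0 ≤ ⟪p + τD ν i • (S.Dt ν i - S.D ν i) + (Fintype.card ι : ℝ) • S.Θ ν i,
        y - S.Dt ν i⟫_ℝ + P.G y - P.G (S.Dt ν i) := by
  obtain ⟨p, h1, h2, h3⟩ := r.problem.D_variational i (r.D_mem ν i) (r.X_mem_Xset ν i)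
    (r.surr.ft_eq ν i) (r.run.Dt_argmin ν i)
  refine ⟨p, h1, h2.trans ?_, h3⟩
  have := (r.lipschitz i _ (r.Dt_mem ν i) _ (r.D_mem ν i) _ (r.X_mem ν i) _ (r.X_mem ν i)).1
  rwa [sub_self, norm_zero, add_zero] at this

/-- The optimality condition is tested at the current dictionary; the surrogate correction `p` has a
favorable sign along the direction and can be dropped. -/
lemma direction_decrease (r : RegularRun P L E A κ γ S τD τX ft ht Z ℓ R c ε τlo τhi ρ T)
    (ν : ℕ) (i : ι) :
    ⟪(Fintype.card ι : ℝ) • S.Θ ν i, S.Dt ν i - S.D ν i⟫_ℝ + (P.G (S.Dt ν i) - P.G (S.D ν i))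
      ≤ -(τlo * ‖S.Dt ν i - S.D ν i‖ ^ 2) := by
  obtain ⟨p, h1, -, h3⟩ := r.D_step ν i
  have h := h3 _ (r.D_mem ν i)
  rw [← neg_sub (S.Dt ν i) (S.D ν i), inner_neg_right, inner_add_left, inner_add_left,
    inner_smul_left (S.Dt ν i - S.D ν i), real_inner_self_eq_norm_sq] at h
  simp only [RCLike.conj_to_real] at h
  have h4 : τlo * ‖S.Dt ν i - S.D ν i‖ ^ 2 ≤ τD ν i * ‖S.Dt ν i - S.D ν i‖ ^ 2 := by
    gcongr; exact r.τD_lower ν i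
  linarith

/-- Convexity is used for the mixing and again for the step from `D` to `V`. The column sums carry
the weights back to time `ν`, so mixing itself never raises this term. -/
lemma sum_G_succ_le (r : RegularRun P L E A κ γ S τD τX ft ht Z ℓ R c ε τlo τhi ρ T)
    (ν : ℕ) : ∑ i, S.φ (ν + 1) i / Fintype.card ι * P.G (S.D (ν + 1) i)
      ≤ ∑ j, S.φ ν j / Fintype.card ι * P.G (S.D ν j)
        + γ ν * ∑ j, S.φ ν j / Fintype.card ι * (P.G (S.Dt ν j) - P.G (S.D ν j)) := by
  have hG : ConvexOn ℝ P.Dset P.G :=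
    r.problem.G_convex.subset r.problem.Dset_subset r.problem.Dset_convex
  have h1 : ∀ i, S.φ (ν + 1) i / Fintype.card ι * P.G (S.D (ν + 1) i)
      ≤ ∑ j, A ν i j * (S.φ ν j / Fintype.card ι * P.G (S.V ν j)) := by
    intro i
    have h := hG.map_weighted_sum_le (r.mixing_nonneg ν i) (r.mixing_sum ν i) (r.V_mem ν)
    rw [← r.D_succ_eq] at h
    refine (mul_le_mul_of_nonneg_left h (r.weight_nonneg _ i)).trans (le_of_eq ?_)
    rw [Finset.mul_sum]
    refine Finset.sum_congr rfl fun j _ => ?_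
    have := (r.φ_pos (ν + 1) i).ne'
    field_simp
  have h2 : ∀ j, P.G (S.V ν j) ≤ P.G (S.D ν j) + γ ν * (P.G (S.Dt ν j) - P.G (S.D ν j)) := by
    intro j
    have h := hG.2 (r.D_mem ν j) (r.Dt_mem ν j) (sub_nonneg.2 (r.step.le_one ν))
      (r.step.pos ν).le (by ring)
    have e : (1 - γ ν) • S.D ν j + γ ν • S.Dt ν j = S.V ν j := by
      rw [r.run.V_update]; module
    rw [e] at h
    simp only [smul_eq_mul] at h
    linarith
  refine (Finset.sum_le_sum fun i _ => h1 i).trans ?_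
  rw [Finset.sum_comm]
  simp only [← Finset.sum_mul, r.weights.colsum, one_mul]
  rw [Finset.mul_sum, ← Finset.sum_add_distrib]
  refine Finset.sum_le_sum fun j _ => ?_
  refine (mul_le_mul_of_nonneg_left (h2 j) (r.weight_nonneg ν j)).trans (le_of_eq ?_)
  ring

lemma F_quadratic_bound (r : RegularRun P L E A κ γ S τD τX ft ht Z ℓ R c ε τlo τhi ρ T)
    {D D' : RMat M K} (hD : D ∈ P.Dset) (hD' : D' ∈ P.Dset) (ν : ℕ) :
    P.F D' (S.X ν) ≤ P.F D (S.X ν) + ⟪P.gradDF D (S.X ν), D' - D⟫_ℝ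
      + Fintype.card ι * ℓ / 2 * ‖D' - D‖ ^ 2 := by
  have hmem : ∀ t ∈ Icc (0 : ℝ) 1, D + t • (D' - D) ∈ P.Dset := fun t ht =>
    segment_point_mem r.problem.Dset_convex hD hD' ht.1 ht.2
  refine le_quadratic_of_gradient_le (h := fun D => P.F D (S.X ν))
    (gr := fun D => P.gradDF D (S.X ν)) (fun t ht => ?_) fun t ht => ?_
  · rw [r.problem.gradDF_eq_sum (r.problem.Dset_subset (hmem t ht)) (r.X_mem_Oi ν)]
    exact r.problem.hasGradientAt_F (r.problem.Dset_subset (hmem t ht)) (r.X_mem_Oi ν)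
  · refine (r.norm_gradDF_sub_le (hmem t ht) hD (r.X_mem ν) (r.X_mem ν)).trans (le_of_eq ?_)
    simp [norm_smul, abs_of_nonneg ht.1]
    ring

/-- Each local direction decreases the linearization of `F` plus `G`, up to the tracking error. The
mean moves by the weighted sum of these directions, and the curvature costs only order `γ²`. -/
lemma D_descent [Nonempty ι] (r : RegularRun P L E A κ γ S τD τX ft ht Z ℓ R c ε τlo τhi ρ T)
    (ν : ℕ) :
    P.F (S.mean (ν + 1)) (S.X ν)
        + ∑ i, S.φ (ν + 1) i / Fintype.card ι * P.G (S.D (ν + 1) i)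
        + τlo * c / Fintype.card ι * (γ ν * S.moveD ν)
      ≤ P.F (S.mean ν) (S.X ν) + ∑ j, S.φ ν j / Fintype.card ι * P.G (S.D ν j)
        + γ ν * ((Fintype.card ι * spread (S.Θ ν) + Fintype.card ι * (ℓ * spread (S.D ν))) * R)
        + Fintype.card ι * ℓ / 2 * (γ ν * R) ^ 2 := by
  set N := (Fintype.card ι : ℝ) with hN
  have hN0 : 0 < N := by rw [hN]; exact_mod_cast Fintype.card_pos
  set e := N * spread (S.Θ ν) + N * (ℓ * spread (S.D ν)) with he
  set g := P.gradDF (S.mean ν) (S.X ν) with hg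
  have h1 := r.F_quadratic_bound (r.mean_mem ν) (r.mean_mem (ν + 1)) ν
  have h2 := r.sum_G_succ_le ν
  have h3 : ⟪g, S.mean (ν + 1) - S.mean ν⟫_ℝ
      = γ ν * ∑ j, S.φ ν j / N * ⟪g, S.Dt ν j - S.D ν j⟫_ℝ := by
    rw [r.mean_succ_sub_mean, inner_sum, Finset.mul_sum]
    refine Finset.sum_congr rfl fun j _ => ?_
    rw [inner_smul_right, inner_smul_right]
    ring
  have h4 : ∀ j, ⟪g, S.Dt ν j - S.D ν j⟫_ℝ + (P.G (S.Dt ν j) - P.G (S.D ν j))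
      ≤ -(τlo * ‖S.Dt ν j - S.D ν j‖ ^ 2) + e * R := by
    intro j
    have a1 := r.direction_decrease ν j
    have a2 := r.norm_tracker_sub_gradDF_le ν j (r.mean_mem ν) (r.norm_D_sub_mean_le ν)
    have a3 := (abs_le.1 (abs_real_inner_le_norm (N • S.Θ ν j - g) (S.Dt ν j - S.D ν j))).1
    have a4 : ‖N • S.Θ ν j - g‖ * ‖S.Dt ν j - S.D ν j‖ ≤ e * R :=
      mul_le_mul a2 (r.norm_Dt_sub_D_le ν j) (norm_nonneg _) ((norm_nonneg _).trans a2)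
    rw [inner_sub_left] at a3
    linarith
  have h5 : ∑ j, S.φ ν j / N * ⟪g, S.Dt ν j - S.D ν j⟫_ℝ
        + ∑ j, S.φ ν j / N * (P.G (S.Dt ν j) - P.G (S.D ν j))
      ≤ -(τlo * c / N * S.moveD ν) + e * R := by
    rw [← Finset.sum_add_distrib]
    calc _ ≤ ∑ j, (-(τlo * c / N * ‖S.Dt ν j - S.D ν j‖ ^ 2) + S.φ ν j / N * (e * R)) := by
          refine Finset.sum_le_sum fun j _ => ?_
          rw [← mul_add]
          refine (mul_le_mul_of_nonneg_left (h4 j) (r.weight_nonneg ν j)).trans ?_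
          -- The uniform lower bound on the weights keeps every agent's direction in the descent.
          have b1 : c / N ≤ S.φ ν j / N := by gcongr; exact r.φ_lower ν j
          have b2 : 0 ≤ τlo * ‖S.Dt ν j - S.D ν j‖ ^ 2 :=
            mul_nonneg r.τlo_pos.le (sq_nonneg _)
          have b3 := mul_le_mul_of_nonneg_right b1 b2
          have b4 : c / N * (τlo * ‖S.Dt ν j - S.D ν j‖ ^ 2)
            = τlo * c / N * ‖S.Dt ν j - S.D ν j‖ ^ 2 := by ring
          linarith
      _ = _ := by
          rw [Finset.sum_add_distrib, ← Finset.sum_mul, r.weight_sum, one_mul,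
            Finset.sum_neg_distrib, ← Finset.mul_sum, moveD]
  have h6 := mul_le_mul_of_nonneg_left h5 (r.step.pos ν).le
  have h7 : N * ℓ / 2 * ‖S.mean (ν + 1) - S.mean ν‖ ^ 2 ≤ N * ℓ / 2 * (γ ν * R) ^ 2 := by
    have := r.lip_nonneg
    gcongr
    exact r.norm_mean_succ_sub_mean_le ν
  rw [h3] at h1
  have e1 : τlo * c / N * (γ ν * S.moveD ν) = γ ν * (τlo * c / N * S.moveD ν) := by ring
  rw [e1]
  linarith

/-- The function `y ↦ f D' y - f D y` has gradient of norm at most `ℓ ‖D' - D‖` on `Z i`. -/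
lemma f_cross_difference (r : RegularRun P L E A κ γ S τD τX ft ht Z ℓ R c ε τlo τhi ρ T)
    (i : ι) {D D' : RMat M K} (hD : D ∈ P.Dset) (hD' : D' ∈ P.Dset) {x x' : RMat K (n i)}
    (hx : x ∈ Z i) (hx' : x' ∈ Z i) :
    |(P.f i D' x' - P.f i D x') - (P.f i D' x - P.f i D x)| ≤ ℓ * ‖D' - D‖ * ‖x' - x‖ := by
  have hO : ∀ y ∈ Z i, y ∈ P.Oi i := fun y hy => r.problem.Xset_subset i (r.Z_subset i hy)
  have h := (r.Z_convex i).norm_image_sub_le_of_norm_hasFDerivWithin_le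
    (f := fun y => P.f i D' y - P.f i D y)
    (f' := fun y => InnerProductSpace.toDual ℝ _ (P.gradX i D' y)
      - InnerProductSpace.toDual ℝ _ (P.gradX i D y)) (C := ℓ * ‖D' - D‖)
    (fun y hy => (((r.problem.hasGradientAt_X i (r.problem.Dset_subset hD') (hO y hy)).hasFDerivAt).sub
      ((r.problem.hasGradientAt_X i (r.problem.Dset_subset hD) (hO y hy)).hasFDerivAt)).hasFDerivWithinAt)
    (fun y hy => by
      rw [← map_sub, LinearIsometryEquiv.norm_map]
      have := (r.lipschitz i _ hD' _ hD _ hy _ hy).2.1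
      rwa [sub_self, norm_zero, add_zero] at this) hx hx'
  simpa [Real.norm_eq_abs] using h

/-- The update decreases the objective at `V ν i`, whereas the Lyapunov value sits at the new mean.
The discrepancy is a mixed difference; Young's inequality charges half of the decrease `ε ‖·‖²` for
it and leaves a summable square. -/
lemma X_step_descent [Nonempty ι]
    (r : RegularRun P L E A κ γ S τD τX ft ht Z ℓ R c ε τlo τhi ρ T) {ν : ℕ} (hν : 1 ≤ ν) (i : ι) :
    P.f i (S.mean (ν + 1)) (S.X (ν + 1) i) + P.g i (S.X (ν + 1) i)
        + ε / 2 * ‖S.X (ν + 1) i - S.X ν i‖ ^ 2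
      ≤ P.f i (S.mean (ν + 1)) (S.X ν i) + P.g i (S.X ν i)
        + ℓ ^ 2 / (2 * ε) * (spread (S.D ν) + 2 * (γ ν * R)) ^ 2 := by
  obtain ⟨q, hq, hvi⟩ := r.problem.X_variational i (r.V_mem ν i) (r.surr.ht_eq ν i)
    (strongConvexOn_zero.2 (r.problem.g_convex i)) (r.run.X_update ν i)
  have h1 := r.problem.X_descent i (r.V_mem ν i) le_rfl (r.X_mem_Xset ν i)
    (r.X_mem_Xset (ν + 1) i) hq hvi
  have h2 := r.τX_lower i ν hν
  have h3 := (abs_le.1 (r.f_cross_difference i (r.V_mem ν i) (r.mean_mem (ν + 1)) (r.X_mem ν i)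
    (r.X_mem (ν + 1) i))).2
  set δ := ‖S.X (ν + 1) i - S.X ν i‖
  set a := spread (S.D ν) + 2 * (γ ν * R)
  have hε := r.ε_pos
  have h4 : ℓ * ‖S.mean (ν + 1) - S.V ν i‖ * δ ≤ ℓ * a * δ := by
    have := r.lip_nonneg
    gcongr
    exact r.norm_mean_succ_sub_V_le ν i
  have h5 : ℓ * a * δ ≤ ε / 2 * δ ^ 2 + ℓ ^ 2 / (2 * ε) * a ^ 2 := by
    have e : ε / 2 * δ ^ 2 + ℓ ^ 2 / (2 * ε) * a ^ 2 - ℓ * a * δ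
        = 1 / (2 * ε) * (ε * δ - ℓ * a) ^ 2 := by field_simp; ring
    have : 0 ≤ 1 / (2 * ε) * (ε * δ - ℓ * a) ^ 2 := by positivity
    linarith
  have h6 : ε * δ ^ 2 ≤ (τX ν i - L i (S.V ν i) / 2) * δ ^ 2 := by
    gcongr; linarith
  linarith

/-- Separates `g * t`, whose summability is not yet known, from the squares `d ^ 2 + g ^ 2`, which
are already summable along the run. -/
lemma descent_error_le {N ℓ R B d t g : ℝ} (hN : 0 ≤ N) (hℓ : 0 ≤ ℓ) (hR : 0 ≤ R) (hB : 0 ≤ B)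
    (ht : 0 ≤ t) (hg : 0 ≤ g) :
    g * ((N * t + N * (ℓ * d)) * R) + N * ℓ / 2 * (g * R) ^ 2 + B * (d + 2 * (g * R)) ^ 2
      ≤ (N * R + (N * ℓ * R + N * ℓ * R ^ 2 + 8 * B * (1 + R ^ 2))) * (g * t)
        + (N * R + (N * ℓ * R + N * ℓ * R ^ 2 + 8 * B * (1 + R ^ 2))) * (d ^ 2 + g ^ 2) := by
  have a1 : g * d ≤ d ^ 2 + g ^ 2 := by nlinarith [sq_nonneg (g - d)]
  have b1 : (d + 2 * (g * R)) ^ 2 ≤ 2 * d ^ 2 + 8 * (g ^ 2 * R ^ 2) := by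
    nlinarith [sq_nonneg (d - 2 * (g * R))]
  have b2 : 0 ≤ R ^ 2 * d ^ 2 := by positivity
  have a2 : (d + 2 * (g * R)) ^ 2 ≤ 8 * (1 + R ^ 2) * (d ^ 2 + g ^ 2) := by
    have e : 8 * (1 + R ^ 2) * (d ^ 2 + g ^ 2)
      = 8 * d ^ 2 + 8 * g ^ 2 + 8 * (R ^ 2 * d ^ 2) + 8 * (g ^ 2 * R ^ 2) := by ring
    rw [e]
    linarith [sq_nonneg g, sq_nonneg d]
  have e1 : g * ((N * t + N * (ℓ * d)) * R) = N * R * (g * t) + N * ℓ * R * (g * d) := by ring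
  have a3 := mul_le_mul_of_nonneg_left a2 hB
  have a4 : N * ℓ * R * (g * d) ≤ N * ℓ * R * (d ^ 2 + g ^ 2) := by gcongr
  have k0 : 0 ≤ N * ℓ * R ^ 2 := by positivity
  have a5 : N * ℓ / 2 * (g * R) ^ 2 ≤ N * ℓ * R ^ 2 * (d ^ 2 + g ^ 2) := by
    have e : N * ℓ / 2 * (g * R) ^ 2 = N * ℓ * R ^ 2 * (g ^ 2 / 2) := by ring
    rw [e]
    gcongr
    linarith [sq_nonneg d, sq_nonneg g]
  have a6 : 0 ≤ (N * ℓ * R + N * ℓ * R ^ 2 + 8 * B * (1 + R ^ 2)) * (g * t) := by positivity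
  have a7 : 0 ≤ N * R * (d ^ 2 + g ^ 2) := by positivity
  rw [e1]
  linarith

lemma exists_lyapunov_descent [Nonempty ι]
    (r : RegularRun P L E A κ γ S τD τX ft ht Z ℓ R c ε τlo τhi ρ T) :
    ∃ c₀ C : ℝ, 0 < c₀ ∧ 0 ≤ C ∧ ∀ ν, 1 ≤ ν →
      S.lyapunov P (ν + 1) + c₀ * (γ ν * S.moveD ν) + c₀ * S.moveX ν
        ≤ S.lyapunov P ν + C * (γ ν * spread (S.Θ ν)) + C * (spread (S.D ν) ^ 2 + γ ν ^ 2) := by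
  set N := (Fintype.card ι : ℝ) with hN
  have hN0 : 0 < N := by rw [hN]; exact_mod_cast Fintype.card_pos
  have hc := r.c_pos
  have hτ := r.τlo_pos
  have hε := r.ε_pos
  have hℓ := r.lip_nonneg
  have hR := r.R_nonneg
  set B := N * (ℓ ^ 2 / (2 * ε)) with hB
  have hB0 : 0 ≤ B := by positivity
  refine ⟨min (τlo * c / N) (ε / 2),
    N * R + (N * ℓ * R + N * ℓ * R ^ 2 + 8 * B * (1 + R ^ 2)), by positivity, by positivity,
    fun ν hν => ?_⟩
  set d := spread (S.D ν)
  set t := spread (S.Θ ν) with ht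
  have hd0 : 0 ≤ d := spread_nonneg _
  have ht0 : 0 ≤ t := spread_nonneg _
  have hγ0 := (r.step.pos ν).le
  have h1 := r.D_descent ν
  have h2 : ∑ i, (P.f i (S.mean (ν + 1)) (S.X (ν + 1) i) + P.g i (S.X (ν + 1) i)
        + ε / 2 * ‖S.X (ν + 1) i - S.X ν i‖ ^ 2)
      ≤ ∑ i, (P.f i (S.mean (ν + 1)) (S.X ν i) + P.g i (S.X ν i)
        + ℓ ^ 2 / (2 * ε) * (d + 2 * (γ ν * R)) ^ 2) :=
    Finset.sum_le_sum fun i _ => r.X_step_descent hν i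
  simp only [Finset.sum_add_distrib, ← Finset.mul_sum] at h2
  rw [Finset.sum_const, Finset.card_univ, nsmul_eq_mul] at h2
  have hmX : 0 ≤ S.moveX ν := Finset.sum_nonneg fun _ _ => sq_nonneg _
  have hmD : 0 ≤ γ ν * S.moveD ν := mul_nonneg hγ0 (Finset.sum_nonneg fun _ _ => sq_nonneg _)
  have h3 : min (τlo * c / N) (ε / 2) * (γ ν * S.moveD ν)
      ≤ τlo * c / N * (γ ν * S.moveD ν) := by gcongr; exact min_le_left _ _
  have h4 : min (τlo * c / N) (ε / 2) * S.moveX ν ≤ ε / 2 * S.moveX ν := by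
    gcongr; exact min_le_right _ _
  have h5 := descent_error_le hN0.le hℓ hR hB0 ht0 hγ0 (d := d)
  have e2 : N * (ℓ ^ 2 / (2 * ε) * (d + 2 * (γ ν * R)) ^ 2) = B * (d + 2 * (γ ν * R)) ^ 2 := by
    rw [hB]; ring
  have hmX' : S.moveX ν = ∑ i, ‖S.X (ν + 1) i - S.X ν i‖ ^ 2 := rfl
  simp only [lyapunov, DLProblem.F] at h1 ⊢
  rw [← hmX'] at h2
  linarith

lemma exists_lyapunov_lower_bound [Nonempty ι]
    (r : RegularRun P L E A κ γ S τD τX ft ht Z ℓ R c ε τlo τhi ρ T) :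
    ∃ l, ∀ ν, l ≤ S.lyapunov P ν := by
  choose lf hlf using r.problem.f_lower
  have hg : ∀ i, ∃ b, ∀ x ∈ Z i, b ≤ P.g i x := fun i => by
    obtain ⟨b, hb⟩ := (r.Z_compact i).bddBelow_image
      (((r.problem.g_convex i).continuousOn (r.problem.Oi_open i)).mono
        ((r.Z_subset i).trans (r.problem.Xset_subset i)))
    exact ⟨b, fun x hx => hb ⟨x, hx, rfl⟩⟩
  choose lg hlg using hg
  obtain ⟨lG, hlG⟩ := r.problem.Dset_compact.bddBelow_image
    ((r.problem.G_convex.continuousOn r.problem.O_open).mono r.problem.Dset_subset)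
  refine ⟨∑ i, lf i + ∑ i, lg i + lG, fun ν => ?_⟩
  refine add_le_add (add_le_add ?_ ?_) ?_
  · exact Finset.sum_le_sum fun i _ => hlf i _ (r.problem.Dset_subset (r.mean_mem ν)) _
      (r.X_mem_Oi ν i)
  · exact Finset.sum_le_sum fun i _ => hlg i _ (r.X_mem ν i)
  · calc lG = ∑ i, S.φ ν i / Fintype.card ι * lG := by
          rw [← Finset.sum_mul, r.weight_sum, one_mul]
      _ ≤ _ := Finset.sum_le_sum fun i _ =>
          mul_le_mul_of_nonneg_left (hlG ⟨_, r.D_mem ν i, rfl⟩) (r.weight_nonneg ν i)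

/-- The summability estimates behind all convergence statements. -/
theorem summable_estimates [Nonempty ι]
    (r : RegularRun P L E A κ γ S τD τX ft ht Z ℓ R c ε τlo τhi ρ T) :
    Summable S.moveX ∧ Summable (fun ν => γ ν * S.moveD ν) ∧
      Summable (fun ν => spread (S.Θ ν) ^ 2) ∧ ∃ u, Tendsto (S.lyapunov P) atTop (𝓝 u) := by
  obtain ⟨c₀, C, hc₀, hC, hdesc⟩ := r.exists_lyapunov_descent
  obtain ⟨l, hl⟩ := r.exists_lyapunov_lower_bound
  obtain ⟨C', hC', htr⟩ := r.exists_spread_Θ_sq_window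
  have hdg : Summable fun ν => spread (S.D ν) ^ 2 + γ ν ^ 2 :=
    r.summable_spread_D_sq.add r.step.sq_summable
  have hmX : ∀ ν, 0 ≤ S.moveX ν := fun ν => Finset.sum_nonneg fun _ _ => sq_nonneg _
  have hmD : ∀ ν, 0 ≤ S.moveD ν := fun ν => Finset.sum_nonneg fun _ _ => sq_nonneg _
  have hdg0 : ∀ ν, 0 ≤ spread (S.D ν) ^ 2 + γ ν ^ 2 := fun ν =>
    add_nonneg (sq_nonneg _) (sq_nonneg _)
  -- All sequences are shifted by one, since descent is available only from iteration one. The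
  -- constants `max C C'` and `C + 1` let one error sequence serve both the descent and the tracking
  -- inequality.
  have hstep : ∀ ν, S.lyapunov P (ν + 1 + 1) + c₀ * (γ (ν + 1) * S.moveD (ν + 1))
      + c₀ * S.moveX (ν + 1) ≤ S.lyapunov P (ν + 1)
        + max C C' * (γ (ν + 1) * spread (S.Θ (ν + 1)))
        + (C + 1) * (spread (S.D (ν + 1)) ^ 2 + γ (ν + 1) ^ 2) := by
    intro ν
    have a1 := hdesc (ν + 1) (by omega)
    have a2 : C * (γ (ν + 1) * spread (S.Θ (ν + 1)))
        ≤ max C C' * (γ (ν + 1) * spread (S.Θ (ν + 1))) :=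
      mul_le_mul_of_nonneg_right (le_max_left _ _)
        (mul_nonneg (r.step.pos _).le (spread_nonneg _))
    have a3 := hdg0 (ν + 1)
    linarith
  have htrack : ∀ ν, spread (S.Θ (ν + T + 1)) ^ 2 ≤ ρ * spread (S.Θ (ν + 1)) ^ 2
      + max C C' * ∑ s ∈ Finset.range T, (S.moveX (ν + s + 1)
        + (C + 1) * (spread (S.D (ν + s + 1)) ^ 2 + γ (ν + s + 1) ^ 2)) := by
    intro ν
    have a1 := htr (ν + 1)
    rw [show ν + T + 1 = ν + 1 + T by ring]
    refine a1.trans (add_le_add_right ?_ _)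
    refine mul_le_mul (le_max_right _ _) (Finset.sum_le_sum fun s _ => ?_)
      (Finset.sum_nonneg fun s _ => add_nonneg (hmX _) (hdg0 _)) (hC'.trans (le_max_right _ _))
    rw [show ν + 1 + s = ν + s + 1 by ring]
    have := mul_nonneg hC (hdg0 (ν + s + 1))
    linarith
  obtain ⟨h1, h2, h3, u, h4⟩ := descent_summable (L := fun ν => S.lyapunov P (ν + 1))
    (w := fun ν => S.moveD (ν + 1)) (q := fun ν => S.moveX (ν + 1))
    (t := fun ν => spread (S.Θ (ν + 1)))
    (e := fun ν => (C + 1) * (spread (S.D (ν + 1)) ^ 2 + γ (ν + 1) ^ 2))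
    (γ := fun ν => γ (ν + 1)) (c := c₀) (C := max C C') (l := l) (ρ := ρ) (T := T) hc₀
    (hC.trans (le_max_left _ _)) r.ρ_nonneg r.ρ_lt_one (fun ν => (r.step.pos _).le)
    ((summable_nat_add_iff 1).2 r.step.sq_summable) (fun ν => hmD _) (fun ν => hmX _)
    (fun ν => mul_nonneg (by linarith) (hdg0 _))
    (((summable_nat_add_iff 1).2 hdg).mul_left _) (fun ν => hl _) hstep htrack
  exact ⟨(summable_nat_add_iff 1).1 h1,
    (summable_nat_add_iff (f := fun ν => γ ν * S.moveD ν) 1).1 h2,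
    (summable_nat_add_iff (f := fun ν => spread (S.Θ ν) ^ 2) 1).1 h3, u,
    (tendsto_add_atTop_iff_nat 1).1 h4⟩

lemma tendsto_X_move [Nonempty ι]
    (r : RegularRun P L E A κ γ S τD τX ft ht Z ℓ R c ε τlo τhi ρ T) (i : ι) :
    Tendsto (fun ν => ‖S.X (ν + 1) i - S.X ν i‖) atTop (𝓝 0) := by
  refine tendsto_zero_of_summable_sq (r.summable_estimates.1.of_nonneg_of_le
    (fun _ => sq_nonneg _) fun ν => ?_)
  exact Finset.single_le_sum (f := fun i => ‖S.X (ν + 1) i - S.X ν i‖ ^ 2)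
    (fun _ _ => sq_nonneg _) (Finset.mem_univ i)

end Descent

end RegularRun

end D4LIterates

/-! ### Merit values, stationarity and convergence of the objective -/

namespace D4LIterates

variable {ι : Type*} [Fintype ι] {M K : ℕ} {n : ι → ℕ}

/-- Frobenius-norm version of the dictionary merit value along a run. -/
noncomputable def gapD (S : D4LIterates ι M K n) (P : DLProblem ι M K n) (τ : ℝ) (ν : ℕ) : ℝ :=
  ‖argminOn P.Dset (P.hatDObj τ (S.Dbar ν) (S.X ν)) - S.Dbar ν‖

/-- Frobenius-norm version of the private merit value along a run. -/
noncomputable def gapX (S : D4LIterates ι M K n) (P : DLProblem ι M K n) (τ : ℝ) (i : ι) (ν : ℕ) :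
    ℝ :=
  ‖argminOn (P.Xset i) (P.hatXObj τ i (S.Dbar ν) (S.X ν i)) - S.X ν i‖

lemma gapD_nonneg (S : D4LIterates ι M K n) (P : DLProblem ι M K n) (τ : ℝ) (ν : ℕ) :
    0 ≤ S.gapD P τ ν :=
  norm_nonneg _

namespace RegularRun

variable {P : DLProblem ι M K n} {L : ι → RMat M K → ℝ} {E : ℕ → ι → ι → Prop}
    {A : ℕ → Matrix ι ι ℝ} {κ : ℝ} {γ : ℕ → ℝ} {S : D4LIterates ι M K n} {τD τX : ℕ → ι → ℝ}
    {ft : ℕ → (i : ι) → RMat M K → ℝ} {ht : ℕ → (i : ι) → RMat K (n i) → ℝ}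
    {Z : (i : ι) → Set (RMat K (n i))} {ℓ R c ε τlo τhi ρ : ℝ} {T : ℕ}

section Merit

lemma tendsto_consErr [Nonempty ι]
    (r : RegularRun P L E A κ γ S τD τX ft ht Z ℓ R c ε τlo τhi ρ T) :
    Tendsto S.consErr atTop (𝓝 0) :=
  squeeze_zero (fun _ => Real.iSup_nonneg fun _ => maxAbs_nonneg _)
    (fun ν => ciSup_le fun i => (maxAbs_le_norm _).trans (norm_D_sub_Dbar_le S ν i))
    r.tendsto_spread_D

lemma isCompact_region (r : RegularRun P L E A κ γ S τD τX ft ht Z ℓ R c ε τlo τhi ρ T) :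
    IsCompact (P.Dset ×ˢ univ.pi Z) :=
  r.problem.Dset_compact.prod (isCompact_univ_pi r.Z_compact)

lemma iterate_mem_region [Nonempty ι]
    (r : RegularRun P L E A κ γ S τD τX ft ht Z ℓ R c ε τlo τhi ρ T) (ν : ℕ) :
    (S.Dbar ν, S.X ν) ∈ P.Dset ×ˢ univ.pi Z :=
  ⟨r.Dbar_mem ν, fun i _ => r.X_mem ν i⟩

lemma isBounded_iterates [Nonempty ι]
    (r : RegularRun P L E A κ γ S τD τX ft ht Z ℓ R c ε τlo τhi ρ T) :
    Bornology.IsBounded (range fun ν => (S.Dbar ν, S.X ν)) :=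
  r.isCompact_region.isBounded.subset (by rintro _ ⟨ν, rfl⟩; exact r.iterate_mem_region ν)

lemma exists_lipschitz_G (r : RegularRun P L E A κ γ S τD τX ft ht Z ℓ R c ε τlo τhi ρ T) :
    ∃ C : ℝ, 0 ≤ C ∧ ∀ D ∈ P.Dset, ∀ D' ∈ P.Dset, |P.G D - P.G D'| ≤ C * ‖D - D'‖ := by
  obtain ⟨C, hC⟩ := ((r.problem.G_convex.locallyLipschitzOn r.problem.O_open).mono
    r.problem.Dset_subset).exists_lipschitzOnWith_of_compact r.problem.Dset_compact
  refine ⟨C, C.2, fun D hD D' hD' => ?_⟩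
  have := hC.dist_le_mul D hD D' hD'
  rwa [Real.dist_eq, dist_eq_norm] at this

/-- The objective converges along the averaged iterates. -/
lemma exists_tendsto_U [Nonempty ι]
    (r : RegularRun P L E A κ γ S τD τX ft ht Z ℓ R c ε τlo τhi ρ T) :
    ∃ u, Tendsto (fun ν => P.U (S.Dbar ν) (S.X ν)) atTop (𝓝 u) := by
  obtain ⟨u, hu⟩ := r.summable_estimates.2.2.2
  obtain ⟨C, hC, hG⟩ := r.exists_lipschitz_G
  have hF : ∀ ν, |P.F (S.Dbar ν) (S.X ν) - P.F (S.mean ν) (S.X ν)|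
      ≤ Fintype.card ι * (ℓ * (2 * spread (S.D ν))) := by
    intro ν
    have hdist : ‖S.Dbar ν - S.mean ν‖ ≤ 2 * spread (S.D ν) := by
      obtain ⟨i⟩ := ‹Nonempty ι›
      have h1 := norm_D_sub_Dbar_le S ν i
      have h2 := r.norm_D_sub_mean_le ν i
      rw [norm_sub_rev] at h1
      linarith [norm_sub_le_norm_sub_add_norm_sub (S.Dbar ν) (S.D ν i) (S.mean ν)]
    simp only [DLProblem.F]
    rw [← Finset.sum_sub_distrib]
    calc _ ≤ ∑ _i : ι, ℓ * (2 * spread (S.D ν)) := by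
          refine (Finset.abs_sum_le_sum_abs _ _).trans (Finset.sum_le_sum fun i _ => ?_)
          have := (r.lipschitz i _ (r.Dbar_mem ν) _ (r.mean_mem ν) _ (r.X_mem ν i) _
            (r.X_mem ν i)).2.2
          rw [sub_self, norm_zero, add_zero] at this
          exact this.trans (mul_le_mul_of_nonneg_left hdist r.lip_nonneg)
      _ = _ := by simp
  have hGm : ∀ ν, |P.G (S.Dbar ν) - ∑ i, S.φ ν i / Fintype.card ι * P.G (S.D ν i)|
      ≤ C * spread (S.D ν) := by
    intro ν
    have h := norm_sub_average_le (x := fun i => P.G (S.D ν i)) (v := P.G (S.Dbar ν))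
      (r.weight_nonneg ν) (r.weight_sum ν) (r := C * spread (S.D ν)) (fun i => by
        rw [Real.norm_eq_abs]
        refine (hG _ (r.Dbar_mem ν) _ (r.D_mem ν i)).trans (mul_le_mul_of_nonneg_left ?_ hC)
        rw [norm_sub_rev]
        exact norm_D_sub_Dbar_le S ν i)
    simpa using h
  have hdiff : Tendsto (fun ν => P.U (S.Dbar ν) (S.X ν) - S.lyapunov P ν) atTop (𝓝 0) := by
    have hlim : Tendsto (fun ν => Fintype.card ι * (ℓ * (2 * spread (S.D ν)))
        + C * spread (S.D ν)) atTop (𝓝 0) := by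
      have := (((r.tendsto_spread_D.const_mul 2).const_mul ℓ).const_mul
        (Fintype.card ι : ℝ)).add (r.tendsto_spread_D.const_mul C)
      simpa using this
    refine squeeze_zero_norm (fun ν => ?_) hlim
    have e : P.U (S.Dbar ν) (S.X ν) - S.lyapunov P ν
        = (P.F (S.Dbar ν) (S.X ν) - P.F (S.mean ν) (S.X ν))
          + (P.G (S.Dbar ν) - ∑ i, S.φ ν i / Fintype.card ι * P.G (S.D ν i)) := by
      simp only [DLProblem.U, lyapunov]; ring
    rw [e, Real.norm_eq_abs]
    exact (abs_add_le _ _).trans (add_le_add (hF ν) (hGm ν))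
  refine ⟨0 + u, (hdiff.add hu).congr fun ν => ?_⟩
  ring

/-- The new private variable is itself a proximal point with parameter `τ` and center `X ν i`, once
`(τX - τ) δ` is moved into the linear term; so it is close to the exact proximal point when the
linear terms are close. -/
lemma gapX_le [Nonempty ι] (r : RegularRun P L E A κ γ S τD τX ft ht Z ℓ R c ε τlo τhi ρ T)
    {τ : ℝ} (hτ : 0 < τ) (i : ι) (ν : ℕ) :
    S.gapX P τ i ν ≤ (ℓ * (spread (S.D ν) + γ ν * R + ‖S.X (ν + 1) i - S.X ν i‖)
        + (τhi + τ) * ‖S.X (ν + 1) i - S.X ν i‖) / τ + ‖S.X (ν + 1) i - S.X ν i‖ := by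
  obtain ⟨q, hq, hvi⟩ := r.problem.X_variational i (r.V_mem ν i) (r.surr.ht_eq ν i)
    (strongConvexOn_zero.2 (r.problem.g_convex i)) (r.run.X_update ν i)
  obtain ⟨hmem, hhat⟩ := r.problem.hatX_variational hτ i (S.Dbar ν) (r.X_mem_Xset ν i)
  set a := argminOn (P.Xset i) (P.hatXObj τ i (S.Dbar ν) (S.X ν i)) with ha
  set δ := S.X (ν + 1) i - S.X ν i with hδ
  have h1 := prox_variational_lipschitz (q := q + (τX ν i - τ) • δ) (y := S.X ν i) hτ hmem
    (r.X_mem_Xset (ν + 1) i) hhat (fun w hw => by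
      have := hvi w hw
      simp only [zero_div, zero_mul, sub_zero] at this
      rw [← hδ]
      rwa [show q + (τX ν i - τ) • δ + τ • δ = q + τX ν i • δ by module])
  rw [sub_self, norm_zero, add_zero] at h1
  have hDV : ‖S.Dbar ν - S.V ν i‖ ≤ spread (S.D ν) + γ ν * R := by
    have b1 := norm_D_sub_Dbar_le S ν i
    have b2 := r.norm_V_sub_D_le ν i
    rw [norm_sub_rev] at b1 b2
    linarith [norm_sub_le_norm_sub_add_norm_sub (S.Dbar ν) (S.D ν i) (S.V ν i)]
  have hgrad : ‖P.gradX i (S.Dbar ν) (S.X ν i) - q‖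
      ≤ ℓ * (spread (S.D ν) + γ ν * R + ‖δ‖) := by
    rcases hq with rfl | rfl
    · refine (r.lipschitz i _ (r.Dbar_mem ν) _ (r.V_mem ν i) _ (r.X_mem ν i) _
        (r.X_mem (ν + 1) i)).2.1.trans (mul_le_mul_of_nonneg_left ?_ r.lip_nonneg)
      rw [norm_sub_rev (S.X ν i)]
      exact add_le_add_left hDV _
    · refine (r.lipschitz i _ (r.Dbar_mem ν) _ (r.V_mem ν i) _ (r.X_mem ν i) _
        (r.X_mem ν i)).2.1.trans (mul_le_mul_of_nonneg_left ?_ r.lip_nonneg)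
      rw [sub_self, norm_zero]
      exact add_le_add hDV (norm_nonneg _)
  have hpq : ‖P.gradX i (S.Dbar ν) (S.X ν i) - (q + (τX ν i - τ) • δ)‖
      ≤ ℓ * (spread (S.D ν) + γ ν * R + ‖δ‖) + (τhi + τ) * ‖δ‖ := by
    rw [← sub_sub]
    refine (norm_sub_le _ _).trans (add_le_add hgrad ?_)
    rw [norm_smul, Real.norm_eq_abs]
    gcongr
    rw [abs_le]
    constructor <;> linarith [r.τX_pos ν i, r.τX_upper ν i]
  have h2 : ‖a - S.X (ν + 1) i‖
      ≤ (ℓ * (spread (S.D ν) + γ ν * R + ‖δ‖) + (τhi + τ) * ‖δ‖) / τ :=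
    h1.trans (by gcongr)
  have h3 := norm_sub_le_norm_sub_add_norm_sub a (S.X (ν + 1) i) (S.X ν i)
  rw [gapX]
  linarith

lemma tendsto_gapX [Nonempty ι]
    (r : RegularRun P L E A κ γ S τD τX ft ht Z ℓ R c ε τlo τhi ρ T)
    {τ : ℝ} (hτ : 0 < τ) (i : ι) : Tendsto (S.gapX P τ i) atTop (𝓝 0) := by
  refine squeeze_zero (fun _ => norm_nonneg _) (r.gapX_le hτ i) ?_
  have hd := r.tendsto_spread_D
  have hg := r.tendsto_step.mul_const R
  have hx := r.tendsto_X_move i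
  have := (((((hd.add hg).add hx).const_mul ℓ).add (hx.const_mul (τhi + τ))).div_const τ).add hx
  simpa using this

lemma tendsto_DeltaX [Nonempty ι]
    (r : RegularRun P L E A κ γ S τD τX ft ht Z ℓ R c ε τlo τhi ρ T)
    {τ : ℝ} (hτ : 0 < τ) :
    Tendsto (fun ν => P.DeltaX τ (S.Dbar ν) (S.X ν)) atTop (𝓝 0) := by
  refine squeeze_zero (g := fun ν => ∑ i, S.gapX P τ i ν)
    (fun _ => Real.iSup_nonneg fun _ => maxAbs_nonneg _)
    (fun ν => ciSup_le fun i => (maxAbs_le_norm _).trans ?_) ?_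
  · exact Finset.single_le_sum (f := fun i => S.gapX P τ i ν) (fun _ _ => norm_nonneg _)
      (Finset.mem_univ i)
  · simpa using tendsto_finsetSum Finset.univ fun i _ => r.tendsto_gapX hτ i

/-- The same comparison for dictionaries: `Dt ν i` is a proximal point whose linear term differs
from `∇_D F` by the tracking error and by multiples of the direction. -/
lemma exists_gapD_le [Nonempty ι]
    (r : RegularRun P L E A κ γ S τD τX ft ht Z ℓ R c ε τlo τhi ρ T)
    {τ : ℝ} (hτ : 0 < τ) : ∃ C : ℝ, 0 ≤ C ∧ ∀ ν i,
      S.gapD P τ ν ≤ C * (‖S.Dt ν i - S.D ν i‖ + spread (S.D ν) + spread (S.Θ ν)) := by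
  set N := (Fintype.card ι : ℝ) with hN
  have hN0 : 0 ≤ N := by positivity
  have hℓ := r.lip_nonneg
  have hτhi : 0 ≤ τhi := by
    obtain ⟨i⟩ := ‹Nonempty ι›
    exact (r.τX_pos 0 i).le.trans (r.τX_upper 0 i)
  refine ⟨(N + N * ℓ + (ℓ + (τhi + τ))) / τ + 2, by positivity, fun ν i => ?_⟩
  obtain ⟨p, -, hp, hvi⟩ := r.D_step ν i
  obtain ⟨hmem, hhat⟩ := r.problem.hatD_variational hτ (r.Dbar_mem ν) (S.X ν)
  set a := argminOn P.Dset (P.hatDObj τ (S.Dbar ν) (S.X ν)) with ha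
  set u := S.Dt ν i - S.D ν i with hu
  set d := spread (S.D ν)
  set t := spread (S.Θ ν)
  have hd0 : 0 ≤ d := spread_nonneg _
  have ht0 : 0 ≤ t := spread_nonneg _
  have h1 := prox_variational_lipschitz (q := p + (τD ν i - τ) • u + N • S.Θ ν i)
    (y := S.D ν i) hτ hmem (r.Dt_mem ν i) hhat (fun w hw => by
      have := hvi w hw
      rw [← hu]
      rwa [show p + (τD ν i - τ) • u + N • S.Θ ν i + τ • u = p + τD ν i • u + N • S.Θ ν i by
        module])
  have htrack := r.norm_tracker_sub_gradDF_le ν i (r.Dbar_mem ν) (norm_D_sub_Dbar_le S ν)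
  have hb := norm_D_sub_Dbar_le S ν i
  have hpq : ‖P.gradDF (S.Dbar ν) (S.X ν) - (p + (τD ν i - τ) • u + N • S.Θ ν i)‖
      ≤ (N * t + N * (ℓ * d)) + (ℓ * ‖u‖ + (τhi + τ) * ‖u‖) := by
    have e : P.gradDF (S.Dbar ν) (S.X ν) - (p + (τD ν i - τ) • u + N • S.Θ ν i)
        = -(N • S.Θ ν i - P.gradDF (S.Dbar ν) (S.X ν)) - (p + (τD ν i - τ) • u) := by abel
    rw [e]
    refine (norm_sub_le _ _).trans (add_le_add ?_ ((norm_add_le _ _).trans (add_le_add hp ?_)))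
    · rw [norm_neg]; exact htrack
    · rw [norm_smul, Real.norm_eq_abs]
      gcongr
      rw [abs_le]
      constructor <;> linarith [r.τlo_pos, r.τD_lower ν i, r.τD_upper ν i]
  have h2 : ‖a - S.Dt ν i‖ ≤ ((N * t + N * (ℓ * d)) + (ℓ * ‖u‖ + (τhi + τ) * ‖u‖)) / τ + d := by
    refine h1.trans (add_le_add (by gcongr) ?_)
    rw [norm_sub_rev]; exact hb
  have h3 : ‖S.Dt ν i - S.Dbar ν‖ ≤ ‖u‖ + d := by
    linarith [norm_sub_le_norm_sub_add_norm_sub (S.Dt ν i) (S.D ν i) (S.Dbar ν)]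
  have h4 := norm_sub_le_norm_sub_add_norm_sub a (S.Dt ν i) (S.Dbar ν)
  have h5 : ((N * t + N * (ℓ * d)) + (ℓ * ‖u‖ + (τhi + τ) * ‖u‖)) / τ
      ≤ (N + N * ℓ + (ℓ + (τhi + τ))) / τ * (‖u‖ + d + t) := by
    rw [div_mul_eq_mul_div]
    gcongr
    have e : (N + N * ℓ + (ℓ + (τhi + τ))) * (‖u‖ + d + t)
      = ((N * t + N * (ℓ * d)) + (ℓ * ‖u‖ + (τhi + τ) * ‖u‖))
        + (N * (‖u‖ + d) + N * ℓ * (‖u‖ + t) + (ℓ + (τhi + τ)) * (d + t)) := by ring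
    rw [e]
    have : 0 ≤ N * (‖u‖ + d) + N * ℓ * (‖u‖ + t) + (ℓ + (τhi + τ)) * (d + t) := by positivity
    linarith
  rw [gapD, ← ha]
  have := norm_nonneg u
  linarith

/-- The dictionary merit value is square summable with respect to the step sizes. -/
lemma summable_step_mul_gapD_sq [Nonempty ι]
    (r : RegularRun P L E A κ γ S τD τX ft ht Z ℓ R c ε τlo τhi ρ T)
    {τ : ℝ} (hτ : 0 < τ) : Summable fun ν => γ ν * S.gapD P τ ν ^ 2 := by
  obtain ⟨C, hC, h⟩ := r.exists_gapD_le hτ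
  obtain ⟨-, hw, ht, -⟩ := r.summable_estimates
  have hsum := ((hw.add r.summable_spread_D_sq).add ht).mul_left (3 * C ^ 2)
  refine hsum.of_nonneg_of_le (fun ν => mul_nonneg (r.step.pos ν).le (sq_nonneg _)) fun ν => ?_
  obtain ⟨i⟩ := ‹Nonempty ι›
  set u := ‖S.Dt ν i - S.D ν i‖
  set d := spread (S.D ν)
  set t := spread (S.Θ ν)
  have h1 : S.gapD P τ ν ^ 2 ≤ (C * (u + d + t)) ^ 2 :=
    pow_le_pow_left₀ (norm_nonneg _) (h ν i) 2
  have h2 : (u + d + t) ^ 2 ≤ 3 * (u ^ 2 + d ^ 2 + t ^ 2) := by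
    nlinarith [sq_nonneg (u - d), sq_nonneg (u - t), sq_nonneg (d - t)]
  have h3 : u ^ 2 ≤ S.moveD ν :=
    Finset.single_le_sum (f := fun i => ‖S.Dt ν i - S.D ν i‖ ^ 2)
      (fun _ _ => sq_nonneg _) (Finset.mem_univ i)
  have h4 : S.gapD P τ ν ^ 2 ≤ 3 * C ^ 2 * (S.moveD ν + d ^ 2 + t ^ 2) := by
    refine h1.trans ?_
    rw [mul_pow, mul_comm (3 : ℝ), mul_assoc]
    gcongr
    linarith
  have hg := (r.step.pos ν).le
  have hg1 := r.step.le_one ν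
  calc γ ν * S.gapD P τ ν ^ 2 ≤ γ ν * (3 * C ^ 2 * (S.moveD ν + d ^ 2 + t ^ 2)) := by gcongr
    _ = 3 * C ^ 2 * (γ ν * S.moveD ν + γ ν * d ^ 2 + γ ν * t ^ 2) := by ring
    _ ≤ 3 * C ^ 2 * (γ ν * S.moveD ν + d ^ 2 + t ^ 2) := by
      gcongr
      · exact mul_le_of_le_one_left (sq_nonneg _) hg1
      · exact mul_le_of_le_one_left (sq_nonneg _) hg1

/-- Chebyshev's inequality for the measure with weights `γ`. -/
lemma summable_step_of_gapD_ge [Nonempty ι]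
    (r : RegularRun P L E A κ γ S τD τX ft ht Z ℓ R c ε τlo τhi ρ T)
    {τ : ℝ} (hτ : 0 < τ) {η : ℝ} (hη : 0 < η) :
    Summable fun ν => if η ≤ S.gapD P τ ν then γ ν else 0 := by
  refine ((r.summable_step_mul_gapD_sq hτ).div_const (η ^ 2)).of_nonneg_of_le (fun ν => ?_)
    fun ν => ?_
  · split_ifs
    exacts [(r.step.pos ν).le, le_rfl]
  · split_ifs with h
    · rw [le_div_iff₀ (by positivity)]
      have := r.step.pos ν
      gcongr
    · have := mul_nonneg (r.step.pos ν).le (sq_nonneg (S.gapD P τ ν))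
      positivity

/-- Otherwise the step sizes would be summable from some time on. -/
lemma frequently_gapD_lt [Nonempty ι]
    (r : RegularRun P L E A κ γ S τD τX ft ht Z ℓ R c ε τlo τhi ρ T)
    {τ : ℝ} (hτ : 0 < τ) {η : ℝ} (hη : 0 < η) : ∃ᶠ ν in atTop, S.gapD P τ ν < η := by
  intro hcon
  obtain ⟨m, hm⟩ := eventually_atTop.1 hcon
  have h1 := (summable_nat_add_iff m).2 (r.summable_step_of_gapD_ge hτ hη)
  have h2 : Summable fun ν => γ (ν + m) := h1.congr fun ν => by
    simp [not_lt.1 (hm (ν + m) (by omega))]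
  have h3 : Summable γ := (summable_nat_add_iff m).1 h2
  exact not_tendsto_nhds_of_tendsto_atTop r.step.sum_infinite _ h3.hasSum.tendsto_sum_nat

lemma liminf_DeltaD [Nonempty ι]
    (r : RegularRun P L E A κ γ S τD τX ft ht Z ℓ R c ε τlo τhi ρ T)
    {τ : ℝ} (hτ : 0 < τ) :
    liminf (fun ν => ((P.DeltaD τ (S.Dbar ν) (S.X ν) : ℝ) : EReal)) atTop = 0 := by
  refine le_antisymm (le_of_forall_gt_imp_ge_of_dense fun b hb => ?_) ?_
  · obtain ⟨η, hη0, hηb⟩ := EReal.lt_iff_exists_real_btwn.1 hb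
    refine liminf_le_of_frequently_le' ((r.frequently_gapD_lt hτ (EReal.coe_pos.1 hη0)).mono
      fun ν hν => le_trans ?_ hηb.le)
    exact EReal.coe_le_coe_iff.2 ((maxAbs_le_norm _).trans hν.le)
  · exact le_liminf_of_le (h := Eventually.of_forall fun ν =>
      EReal.coe_nonneg.2 (maxAbs_nonneg _))

/-- Limits along which both merit values vanish are stationary. -/
lemma isStationary_of_tendsto [Nonempty ι]
    (r : RegularRun P L E A κ γ S τD τX ft ht Z ℓ R c ε τlo τhi ρ T)
    {τ τ' : ℝ} (hτ : 0 < τ) (hτ' : 0 < τ') {l : Filter ℕ} [l.NeBot]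
    {p : RMat M K × ((i : ι) → RMat K (n i))}
    (hp : Tendsto (fun ν => (S.Dbar ν, S.X ν)) l (𝓝 p))
    (hD : Tendsto (S.gapD P τ) l (𝓝 0)) (hX : ∀ i, Tendsto (S.gapX P τ' i) l (𝓝 0)) :
    P.IsStationary p.1 p.2 := by
  have hpm : p ∈ P.Dset ×ˢ univ.pi Z :=
    r.isCompact_region.isClosed.mem_of_tendsto hp (Eventually.of_forall r.iterate_mem_region)
  have hp1 : p.1 ∈ P.Dset := hpm.1
  have hp2 : ∀ i, p.2 i ∈ Z i := fun i => hpm.2 i (mem_univ i)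
  have hp2' : ∀ i, p.2 i ∈ P.Xset i := fun i => r.Z_subset i (hp2 i)
  have hDl : Tendsto S.Dbar l (𝓝 p.1) := (continuous_fst.tendsto p).comp hp
  have hXl : ∀ i, Tendsto (fun ν => S.X ν i) l (𝓝 (p.2 i)) := fun i =>
    (((continuous_apply i).comp continuous_snd).tendsto p).comp hp
  have hDn : Tendsto (fun ν => ‖S.Dbar ν - p.1‖) l (𝓝 0) :=
    (tendsto_iff_norm_sub_tendsto_zero).1 hDl
  have hXn : ∀ i, Tendsto (fun ν => ‖S.X ν i - p.2 i‖) l (𝓝 0) := fun i =>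
    (tendsto_iff_norm_sub_tendsto_zero).1 (hXl i)
  refine ⟨hp1, hp2', fun y hy => ?_, fun i y hy => ?_⟩
  · set a : ℕ → RMat M K := fun ν => argminOn P.Dset (P.hatDObj τ (S.Dbar ν) (S.X ν)) with ha
    have hvi := fun ν => r.problem.hatD_variational hτ (r.Dbar_mem ν) (S.X ν)
    have hgap : Tendsto (fun ν => a ν - S.Dbar ν) l (𝓝 0) :=
      tendsto_zero_iff_norm_tendsto_zero.2 hD
    have hal : Tendsto a l (𝓝 p.1) := by
      simpa using hgap.add hDl
    have hgrad : Tendsto (fun ν => P.gradDF (S.Dbar ν) (S.X ν)) l (𝓝 (P.gradDF p.1 p.2)) := by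
      rw [tendsto_iff_norm_sub_tendsto_zero]
      refine squeeze_zero (fun _ => norm_nonneg _)
        (fun ν => r.norm_gradDF_sub_le (r.Dbar_mem ν) hp1 (r.X_mem ν) hp2) ?_
      simpa using tendsto_finsetSum Finset.univ fun i _ => (hDn.add (hXn i)).const_mul ℓ
    have hGc : ContinuousWithinAt P.G P.Dset p.1 :=
      ((r.problem.G_convex.continuousOn r.problem.O_open).mono r.problem.Dset_subset) p.1 hp1
    have hG : Tendsto (fun ν => P.G (a ν)) l (𝓝 (P.G p.1)) :=
      hGc.tendsto.comp (tendsto_nhdsWithin_iff.2 ⟨hal, Eventually.of_forall fun ν => (hvi ν).1⟩)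
    have hlim := (((hgrad.add (hgap.const_smul τ)).inner (𝕜 := ℝ)
      (tendsto_const_nhds (x := y) |>.sub hal)).add_const (P.G y)).sub hG
    rw [smul_zero, add_zero] at hlim
    exact ge_of_tendsto hlim (Eventually.of_forall fun ν => (hvi ν).2 y hy)
  · set a : ℕ → RMat K (n i) :=
      fun ν => argminOn (P.Xset i) (P.hatXObj τ' i (S.Dbar ν) (S.X ν i)) with ha
    have hvi := fun ν => r.problem.hatX_variational hτ' i (S.Dbar ν) (r.X_mem_Xset ν i)
    have hgap : Tendsto (fun ν => a ν - S.X ν i) l (𝓝 0) :=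
      tendsto_zero_iff_norm_tendsto_zero.2 (hX i)
    have hal : Tendsto a l (𝓝 (p.2 i)) := by
      simpa using hgap.add (hXl i)
    have hgrad : Tendsto (fun ν => P.gradX i (S.Dbar ν) (S.X ν i)) l
        (𝓝 (P.gradX i p.1 (p.2 i))) := by
      rw [tendsto_iff_norm_sub_tendsto_zero]
      refine squeeze_zero (fun _ => norm_nonneg _) (fun ν =>
        (r.lipschitz i _ (r.Dbar_mem ν) _ hp1 _ (r.X_mem ν i) _ (hp2 i)).2.1) ?_
      simpa using (hDn.add (hXn i)).const_mul ℓ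
    have hgc : ContinuousWithinAt (P.g i) (P.Xset i) (p.2 i) :=
      (((r.problem.g_convex i).continuousOn (r.problem.Oi_open i)).mono
        (r.problem.Xset_subset i)) _ (hp2' i)
    have hg : Tendsto (fun ν => P.g i (a ν)) l (𝓝 (P.g i (p.2 i))) :=
      hgc.tendsto.comp (tendsto_nhdsWithin_iff.2 ⟨hal, Eventually.of_forall fun ν => (hvi ν).1⟩)
    have hlim := (((hgrad.add (hgap.const_smul τ')).inner (𝕜 := ℝ)
      (tendsto_const_nhds (x := y) |>.sub hal)).add_const (P.g i y)).sub hg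
    rw [smul_zero, add_zero] at hlim
    exact ge_of_tendsto hlim (Eventually.of_forall fun ν => (hvi ν).2 y hy)

/-- An ultrafilter along which `gapD` vanishes exists because `gapD` is small infinitely often;
compactness makes the iterates converge along it, and `gapX` vanishes along every such filter. -/
lemma exists_stationary_cluster_point [Nonempty ι]
    (r : RegularRun P L E A κ γ S τD τX ft ht Z ℓ R c ε τlo τhi ρ T)
    {τ τ' : ℝ} (hτ : 0 < τ) (hτ' : 0 < τ') :
    ∃ p : RMat M K × ((i : ι) → RMat K (n i)),
      MapClusterPt p atTop (fun ν => (S.Dbar ν, S.X ν)) ∧ P.IsStationary p.1 p.2 := by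
  have hcl : MapClusterPt (0 : ℝ) atTop (S.gapD P τ) := by
    rw [mapClusterPt_iff_frequently]
    intro s hs
    obtain ⟨η, hη, hsub⟩ := Metric.mem_nhds_iff.1 hs
    refine (r.frequently_gapD_lt hτ hη).mono fun ν hν => hsub ?_
    rwa [Metric.mem_ball, Real.dist_eq, sub_zero, abs_of_nonneg (gapD_nonneg S P τ ν)]
  obtain ⟨W, hW, hWlim⟩ := mapClusterPt_iff_ultrafilter.1 hcl
  obtain ⟨p, -, hp⟩ := r.isCompact_region.ultrafilter_le_nhds
    (W.map fun ν => (S.Dbar ν, S.X ν))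
    (le_principal_iff.2 (Ultrafilter.mem_map.2 (univ_mem' r.iterate_mem_region)))
  refine ⟨p, mapClusterPt_iff_ultrafilter.2 ⟨W, hW, hp⟩, ?_⟩
  exact r.isStationary_of_tendsto hτ hτ' (l := W) hp hWlim
    fun i => (r.tendsto_gapX hτ' i).mono_left hW

end Merit

end RegularRun

end D4LIterates

/-! ### Full convergence under strong convexity -/

namespace D4LIterates

variable {ι : Type*} [Fintype ι] {M K : ℕ} {n : ι → ℕ}

/-- Total length of the change of the private variables in one iteration. -/
noncomputable def lengthX (S : D4LIterates ι M K n) (ν : ℕ) : ℝ :=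
  ∑ i, ‖S.X (ν + 1) i - S.X ν i‖

lemma lengthX_nonneg (S : D4LIterates ι M K n) (ν : ℕ) : 0 ≤ S.lengthX ν :=
  Finset.sum_nonneg fun _ _ => norm_nonneg _

namespace RegularRun

variable {P : DLProblem ι M K n} {L : ι → RMat M K → ℝ} {E : ℕ → ι → ι → Prop}
    {A : ℕ → Matrix ι ι ℝ} {κ : ℝ} {γ : ℕ → ℝ} {S : D4LIterates ι M K n} {τD τX : ℕ → ι → ℝ}
    {ft : ℕ → (i : ι) → RMat M K → ℝ} {ht : ℕ → (i : ι) → RMat K (n i) → ℝ}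
    {Z : (i : ι) → Set (RMat K (n i))} {ℓ R c ε τlo τhi ρ : ℝ} {T : ℕ}

section StrongConvexity

/-- With strongly convex regularizers and slowly varying proximal parameters the moves of the
private variables contract, up to the moves of the dictionaries. -/
lemma exists_lengthX_contraction [Nonempty ι]
    (r : RegularRun P L E A κ γ S τD τX ft ht Z ℓ R c ε τlo τhi ρ T) {μ : ι → ℝ}
    (hμ : ∀ i, 0 < μ i ∧ StrongConvexOn (P.Oi i) (μ i) (P.g i))
    (hlim : ∀ i, limsup (fun ν => |τX (ν + 1) i - τX ν i|) atTop < ⨅ j, μ j) :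
    ∃ (θ C : ℝ) (ν₀ : ℕ), 0 ≤ θ ∧ θ < 1 ∧ 0 ≤ C ∧ ∀ ν, ν₀ ≤ ν →
      S.lengthX (ν + 1) ≤ θ * S.lengthX ν + C * (spread (S.D ν) + γ ν + γ (ν + 1)) := by
  set μ₀ := ⨅ j, μ j with hμ₀
  have hμ₀le : ∀ i, μ₀ ≤ μ i := fun i => ciInf_le (finite_range μ).bddBelow i
  have hμ₀pos : 0 < μ₀ := by
    obtain ⟨i, hi⟩ := exists_eq_ciInf_of_finite (f := μ)
    rw [hμ₀, ← hi]
    exact (hμ i).1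
  have hτhi : 0 ≤ τhi := by
    obtain ⟨i⟩ := ‹Nonempty ι›
    exact (r.τX_pos 0 i).le.trans (r.τX_upper 0 i)
  obtain ⟨m, hm1, hm2⟩ : ∃ m, (∀ i, limsup (fun ν => |τX (ν + 1) i - τX ν i|) atTop < m) ∧
      m < μ₀ := by
    have h := (Finset.sup'_lt_iff Finset.univ_nonempty).2 fun i (_ : i ∈ Finset.univ) => hlim i
    obtain ⟨m, h1, h2⟩ := exists_between h
    exact ⟨m, fun i => (Finset.le_sup' (fun i => limsup (fun ν => |τX (ν + 1) i - τX ν i|) atTop)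
      (Finset.mem_univ i)).trans_lt h1, h2⟩
  have hev : ∀ᶠ ν in atTop, ∀ i, |τX (ν + 1) i - τX ν i| < m := by
    refine eventually_all.2 fun i => eventually_lt_of_limsup_lt (hm1 i) ?_
    -- A real `limsup` bounds the tail only for a bounded sequence; boundedness comes from `0 < τX ≤
    -- τhi`.
    refine isBoundedUnder_of ⟨τhi, fun ν => abs_le.2 ?_⟩
    constructor <;> linarith [r.τX_pos ν i, r.τX_pos (ν + 1) i, r.τX_upper ν i,
      r.τX_upper (ν + 1) i]
  obtain ⟨ν₁, hν₁⟩ := eventually_atTop.1 hev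
  have hm0 : 0 < m := by
    obtain ⟨i⟩ := ‹Nonempty ι›
    exact (abs_nonneg _).trans_lt (hν₁ ν₁ le_rfl i)
  have hℓ := r.lip_nonneg
  have hR := r.R_nonneg
  set N := (Fintype.card ι : ℝ) with hN
  have hN0 : 0 ≤ N := by positivity
  -- The one-step factor is `(σ + m) / (σ + μ₀)` with `σ = τX (ν + 1) i`; as `m < μ₀` it increases
  -- with `σ`, so its value at `τhi` is uniform.
  refine ⟨(τhi + m) / (τhi + μ₀), N * (ℓ / μ₀ * (1 + 2 * R)), max ν₁ 1, by positivity,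
    (div_lt_one (by positivity)).2 (by linarith), by positivity, fun ν hν => ?_⟩
  have hν1 : 1 ≤ ν := (le_max_right _ _).trans hν
  set e := spread (S.D ν) + γ ν + γ (ν + 1) with he
  have hg := (r.step.pos ν).le
  have hg' := (r.step.pos (ν + 1)).le
  have hd := spread_nonneg (S.D ν)
  have hstep : ∀ i, ‖S.X (ν + 1 + 1) i - S.X (ν + 1) i‖
      ≤ (τhi + m) / (τhi + μ₀) * ‖S.X (ν + 1) i - S.X ν i‖ + ℓ / μ₀ * (1 + 2 * R) * e := by
    intro i
    have hs := (hμ i).2.mono (hμ₀le i)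
    obtain ⟨q, hq, hvi⟩ := r.problem.X_variational i (r.V_mem ν i) (r.surr.ht_eq ν i) hs
      (r.run.X_update ν i)
    obtain ⟨q', hq', hvi'⟩ := r.problem.X_variational i (r.V_mem (ν + 1) i)
      (r.surr.ht_eq (ν + 1) i) hs (r.run.X_update (ν + 1) i)
    have hlow := r.τX_lower i ν hν1
    have hε := r.ε_pos
    have h1 := r.problem.X_successive_contraction i (r.Z_subset i) (ℓ := ℓ)
      (fun D hD D' hD' x hx => by
        have := (r.lipschitz i D hD D' hD' x hx x hx).2.1
        rwa [sub_self, norm_zero, add_zero] at this)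
      (r.V_mem ν i) (r.V_mem (ν + 1) i) (by linarith) (r.X_mem_Xset ν i) (r.X_mem (ν + 1) i)
      (r.X_mem (ν + 1 + 1) i) hq hq' hvi hvi' hℓ
    have hV : ‖S.V (ν + 1) i - S.V ν i‖ ≤ (1 + 2 * R) * e := by
      have := r.norm_V_succ_sub_V_le ν i
      have b1 : 0 ≤ R * γ (ν + 1) := by positivity
      have b2 : 0 ≤ R * spread (S.D ν) := by positivity
      have e1 : (1 + 2 * R) * e = spread (S.D ν) + 2 * (γ ν * R) + γ (ν + 1) * R
        + (γ ν + γ (ν + 1) + 2 * (R * spread (S.D ν)) + R * γ (ν + 1)) := by rw [he]; ring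
      rw [e1]
      linarith
    set δ' := ‖S.X (ν + 1 + 1) i - S.X (ν + 1) i‖
    set δ := ‖S.X (ν + 1) i - S.X ν i‖
    have hδ : 0 ≤ δ := norm_nonneg _
    set σ := τX (ν + 1) i with hσ
    have hσ0 : 0 < σ := r.τX_pos _ _
    have hσhi : σ ≤ τhi := r.τX_upper _ _
    have hτσ : τX ν i ≤ σ + m := by
      have := (abs_lt.1 (hν₁ ν ((le_max_left _ _).trans hν) i)).1
      linarith
    have h2 : (σ + μ₀) * δ' ≤ (σ + m) * δ + ℓ * ((1 + 2 * R) * e) := by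
      refine h1.trans (add_le_add ?_ ?_)
      · gcongr
      · gcongr
    have h3 : (σ + m) / (σ + μ₀) ≤ (τhi + m) / (τhi + μ₀) := by
      rw [div_le_div_iff₀ (by positivity) (by positivity)]
      nlinarith
    have h4 : ℓ * ((1 + 2 * R) * e) / (σ + μ₀) ≤ ℓ / μ₀ * (1 + 2 * R) * e := by
      rw [div_mul_eq_mul_div, div_mul_eq_mul_div, ← mul_assoc]
      gcongr
      linarith
    calc δ' ≤ ((σ + m) * δ + ℓ * ((1 + 2 * R) * e)) / (σ + μ₀) := by
          rw [le_div_iff₀ (by positivity)]; linarith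
      _ = (σ + m) / (σ + μ₀) * δ + ℓ * ((1 + 2 * R) * e) / (σ + μ₀) := by ring
      _ ≤ _ := by gcongr
  calc S.lengthX (ν + 1) ≤ ∑ i, ((τhi + m) / (τhi + μ₀) * ‖S.X (ν + 1) i - S.X ν i‖
        + ℓ / μ₀ * (1 + 2 * R) * e) := Finset.sum_le_sum fun i _ => hstep i
    _ = _ := by
      rw [Finset.sum_add_distrib, ← Finset.mul_sum, Finset.sum_const, Finset.card_univ,
        nsmul_eq_mul, lengthX]
      ring

/-- The exact proximal point depends Lipschitz-continuously on its center and gradient, so `gapD`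
changes no faster than the averaged dictionary and the private variables move. -/
lemma exists_gapD_variation [Nonempty ι]
    (r : RegularRun P L E A κ γ S τD τX ft ht Z ℓ R c ε τlo τhi ρ T) {τ : ℝ} (hτ : 0 < τ) :
    ∃ C : ℝ, 0 ≤ C ∧ ∀ ν, S.gapD P τ (ν + 1) ≤ S.gapD P τ ν
      + C * (spread (S.D ν) + γ ν + S.lengthX ν) := by
  have hℓ := r.lip_nonneg
  have hR := r.R_nonneg
  set N := (Fintype.card ι : ℝ) with hN
  have hN0 : 0 ≤ N := by positivity
  refine ⟨(N * ℓ / τ + 2) * (1 + 3 * R) + ℓ / τ, by positivity, fun ν => ?_⟩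
  have hg := (r.step.pos ν).le
  have hd := spread_nonneg (S.D ν)
  have hx := S.lengthX_nonneg ν
  have hb : ‖S.Dbar (ν + 1) - S.Dbar ν‖ ≤ (1 + 3 * R) * (spread (S.D ν) + γ ν) := by
    have h0 : S.Dbar (ν + 1) - S.Dbar ν
        = ∑ i, (1 / (Fintype.card ι : ℝ)) • (S.D (ν + 1) i - S.D ν i) := by
      rw [Dbar_eq, Dbar_eq, ← Finset.sum_sub_distrib]
      simp only [smul_sub]
    have h1 := norm_sub_average_le (ι := ι) (x := fun i => S.D (ν + 1) i - S.D ν i)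
      (w := fun _ => 1 / (Fintype.card ι : ℝ)) (v := 0) (fun _ => by positivity)
      uniform_weight_sum (r := spread (S.D ν) + 3 * (γ ν * R)) (fun i => by
        rw [zero_sub, norm_neg]; exact r.norm_D_succ_sub_D_le ν i)
    rw [zero_sub, norm_neg, ← h0] at h1
    have : 0 ≤ R * spread (S.D ν) := by positivity
    linarith
  obtain ⟨hm, hvi⟩ := r.problem.hatD_variational hτ (r.Dbar_mem ν) (S.X ν)
  obtain ⟨hm', hvi'⟩ := r.problem.hatD_variational hτ (r.Dbar_mem (ν + 1)) (S.X (ν + 1))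
  have h1 := prox_variational_lipschitz hτ hm' hm hvi' hvi
  have h2 := r.norm_gradDF_sub_le (r.Dbar_mem (ν + 1)) (r.Dbar_mem ν) (r.X_mem (ν + 1))
    (r.X_mem ν)
  rw [← Finset.mul_sum, Finset.sum_add_distrib, Finset.sum_const, Finset.card_univ,
    nsmul_eq_mul] at h2
  set a' := argminOn P.Dset (P.hatDObj τ (S.Dbar (ν + 1)) (S.X (ν + 1)))
  set a := argminOn P.Dset (P.hatDObj τ (S.Dbar ν) (S.X ν))
  set β := ‖S.Dbar (ν + 1) - S.Dbar ν‖ with hβ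
  have h3 : S.gapD P τ (ν + 1) ≤ ‖a' - a‖ + S.gapD P τ ν + β := by
    have e : a' - S.Dbar (ν + 1) = (a' - a) + (a - S.Dbar ν) - (S.Dbar (ν + 1) - S.Dbar ν) := by
      abel
    change ‖a' - S.Dbar (ν + 1)‖ ≤ ‖a' - a‖ + ‖a - S.Dbar ν‖ + β
    rw [e]
    exact (norm_sub_le _ _).trans (add_le_add_left (norm_add_le _ _) _)
  have h4 : ‖P.gradDF (S.Dbar (ν + 1)) (S.X (ν + 1)) - P.gradDF (S.Dbar ν) (S.X ν)‖ / τ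
      ≤ N * ℓ / τ * β + ℓ / τ * S.lengthX ν := by
    rw [div_le_iff₀ hτ]
    refine h2.trans (le_of_eq ?_)
    rw [lengthX, hN]
    field_simp
  have h5 : (N * ℓ / τ + 2) * β ≤ (N * ℓ / τ + 2) * ((1 + 3 * R) * (spread (S.D ν) + γ ν)) := by
    gcongr
  have h6 : 0 ≤ (N * ℓ / τ + 2) * (1 + 3 * R) * S.lengthX ν := by positivity
  have h7 : 0 ≤ ℓ / τ * (spread (S.D ν) + γ ν) := by positivity
  linarith

/-- Square summability does not bound path lengths; this linear form measures the spread over a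
block against the `γ`-mass of that block. -/
lemma sum_spread_D_le (r : RegularRun P L E A κ γ S τD τX ft ht Z ℓ R c ε τlo τhi ρ T)
    (m N : ℕ) : ∑ k ∈ Finset.range N, spread (S.D (m + k))
      ≤ (∑ k ∈ Finset.range T, spread (S.D (m + k))
        + 2 / c * (Fintype.card ι * R) * (T * ∑ k ∈ Finset.range N, γ (m + k))) / (1 - ρ) := by
  have hρ : 0 < 1 - ρ := by linarith [r.ρ_lt_one]
  refine (sum_range_le_of_window (T := T) (b := fun k =>
      2 / c * (Fintype.card ι * R) * ∑ s ∈ Finset.range T, γ (m + (k + s)))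
    (fun _ => spread_nonneg _) r.ρ_nonneg r.ρ_lt_one (fun k => ?_) N).trans ?_
  · have := r.spread_D_window (m + k)
    simpa only [add_assoc] using this
  · rw [← Finset.mul_sum]
    have hc := r.c_pos
    have hR := r.R_nonneg
    gcongr
    exact sum_range_window_le (u := fun k => γ (m + k)) (fun k => (r.step.pos _).le) T N

/-- Under strong convexity the dictionary merit value converges to zero. -/
theorem tendsto_gapD [Nonempty ι]
    (r : RegularRun P L E A κ γ S τD τX ft ht Z ℓ R c ε τlo τhi ρ T) {τ : ℝ} (hτ : 0 < τ)
    {μ : ι → ℝ} (hμ : ∀ i, 0 < μ i ∧ StrongConvexOn (P.Oi i) (μ i) (P.g i))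
    (hlim : ∀ i, limsup (fun ν => |τX (ν + 1) i - τX ν i|) atTop < ⨅ j, μ j) :
    Tendsto (S.gapD P τ) atTop (𝓝 0) := by
  obtain ⟨θ, C, ν₀, hθ0, hθ1, hC, hcontr⟩ := r.exists_lengthX_contraction hμ hlim
  obtain ⟨C₁, hC₁, hvar⟩ := r.exists_gapD_variation hτ
  have hρ : 0 < 1 - ρ := by linarith [r.ρ_lt_one]
  have hθ : 0 < 1 - θ := by linarith
  have hc := r.c_pos
  have hR := r.R_nonneg
  set A₁ := 1 / (1 - ρ) with hA₁
  set A₂ := 2 / c * (Fintype.card ι * R) * T / (1 - ρ) with hA₂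
  set A₃ := 1 / (1 - θ) with hA₃
  have hA₁0 : 0 ≤ A₁ := by positivity
  have hA₂0 : 0 ≤ A₂ := by positivity
  have hA₃0 : 0 ≤ A₃ := by positivity
  -- `β` collects the initial data of the two contractions on a block starting at `m`: the first `T`
  -- dictionary spreads and the first private move. Both vanish as `m` grows.
  set β : ℕ → ℝ := fun m => (1 + A₃ * C) * A₁ * ∑ k ∈ Finset.range T, spread (S.D (m + k))
    + A₃ * S.lengthX m with hβ
  have hlen : Tendsto S.lengthX atTop (𝓝 0) := by
    have h := tendsto_finsetSum Finset.univ fun i _ => r.tendsto_X_move i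
    rw [Finset.sum_const_zero] at h
    exact h
  have hβlim : Tendsto β atTop (𝓝 0) := by
    have h1 : Tendsto (fun m => ∑ k ∈ Finset.range T, spread (S.D (m + k))) atTop (𝓝 0) := by
      simpa using tendsto_finsetSum (Finset.range T) fun k _ =>
        r.tendsto_spread_D.comp (tendsto_add_atTop_nat k)
    simpa using (h1.const_mul ((1 + A₃ * C) * A₁)).add (hlen.const_mul A₃)
  have hsum : ∀ m N, ν₀ ≤ m →
      ∑ k ∈ Finset.range N, (spread (S.D (m + k)) + γ (m + k) + S.lengthX (m + k))
        ≤ β m + ((1 + A₃ * C) * A₂ + 1 + 2 * (A₃ * C)) * ∑ k ∈ Finset.range N, γ (m + k) := by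
    intro m N hm
    have h1 := r.sum_spread_D_le m N
    have hγ0 : ∀ k, 0 ≤ γ (m + k) := fun k => (r.step.pos _).le
    -- The private moves contract in every single step, hence window length one; the spreads that
    -- drive them are bounded by `h1`.
    have h2 := sum_range_le_of_window (a := fun k => S.lengthX (m + k)) (T := 1)
      (b := fun k => C * (spread (S.D (m + k)) + γ (m + k) + γ (m + (k + 1))))
      (fun _ => S.lengthX_nonneg _) hθ0 hθ1 (fun k => hcontr (m + k) (by omega)) N
    have h3 : ∑ k ∈ Finset.range (N - 1), γ (m + (k + 1)) ≤ ∑ k ∈ Finset.range N, γ (m + k) := by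
      rcases Nat.eq_zero_or_pos N with h0 | h0
      · subst h0; simp
      · exact sum_range_shift_le (u := fun k => γ (m + k)) hγ0 (by omega)
    have h4 : ∑ k ∈ Finset.range (N - 1), γ (m + k) ≤ ∑ k ∈ Finset.range N, γ (m + k) :=
      Finset.sum_le_sum_of_subset_of_nonneg (Finset.range_mono (by omega)) fun k _ _ => hγ0 k
    have h5 : ∑ k ∈ Finset.range (N - 1), spread (S.D (m + k))
        ≤ ∑ k ∈ Finset.range N, spread (S.D (m + k)) :=
      Finset.sum_le_sum_of_subset_of_nonneg (Finset.range_mono (by omega))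
        fun k _ _ => spread_nonneg _
    simp only [Finset.range_one, Finset.sum_singleton, add_zero, ← Finset.mul_sum,
      Finset.sum_add_distrib] at h2 ⊢
    set Γ := ∑ k ∈ Finset.range N, γ (m + k)
    set sd := ∑ k ∈ Finset.range N, spread (S.D (m + k))
    set Dn := ∑ k ∈ Finset.range T, spread (S.D (m + k)) with hDn
    have h6 : sd ≤ A₁ * Dn + A₂ * Γ := by
      refine h1.trans (le_of_eq ?_)
      rw [hA₁, hA₂]; field_simp
    have h7 : ∑ k ∈ Finset.range N, S.lengthX (m + k)
        ≤ A₃ * S.lengthX m + A₃ * C * (sd + 2 * Γ) := by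
      refine h2.trans ?_
      rw [div_eq_mul_one_div, ← hA₃]
      have : C * (∑ k ∈ Finset.range (N - 1), spread (S.D (m + k))
          + ∑ k ∈ Finset.range (N - 1), γ (m + k)
          + ∑ k ∈ Finset.range (N - 1), γ (m + (k + 1))) ≤ C * (sd + 2 * Γ) :=
        mul_le_mul_of_nonneg_left (by linarith) hC
      have := mul_le_mul_of_nonneg_right this hA₃0
      linarith
    have h8 := mul_le_mul_of_nonneg_left h6 (show 0 ≤ 1 + A₃ * C by positivity)
    simp only [hβ, ← hDn]
    linarith
  -- Shifted by `ν₀`, the time from which the private moves contract.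
  have key := tendsto_zero_of_no_oscillation (a := fun ν => S.gapD P τ (ν + ν₀))
    (s := fun ν => spread (S.D (ν + ν₀)) + γ (ν + ν₀) + S.lengthX (ν + ν₀))
    (γ := fun ν => γ (ν + ν₀)) (β := fun ν => β (ν + ν₀)) hC₁
    (show 0 ≤ (1 + A₃ * C) * A₂ + 1 + 2 * (A₃ * C) by positivity)
    (fun ν => gapD_nonneg S P τ _) (fun ν => (r.step.pos _).le)
    (r.tendsto_step.comp (tendsto_add_atTop_nat ν₀)) (hβlim.comp (tendsto_add_atTop_nat ν₀))
    (fun ν => by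
      have := hvar (ν + ν₀)
      rwa [add_right_comm] at this)
    (fun m N => by
      have := hsum (m + ν₀) N (by omega)
      simpa only [add_right_comm m ν₀] using this)
    (fun η hη => frequently_atTop.2 fun m => by
      obtain ⟨k, hk, hlt⟩ := frequently_atTop.1 (r.frequently_gapD_lt hτ hη) (m + ν₀)
      exact ⟨k - ν₀, by omega, by rwa [Nat.sub_add_cancel (by omega)]⟩)
    (fun η hη => (summable_nat_add_iff ν₀).2 (r.summable_step_of_gapD_ge hτ hη))
  exact (tendsto_add_atTop_iff_nat ν₀).1 key

end StrongConvexity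

end RegularRun

end D4LIterates

/-! ### The convergence theorem -/

theorem theorem1 {ι : Type*} [Fintype ι] [Nonempty ι] {M K : ℕ} {n : ι → ℕ}
    (P : DLProblem ι M K n) (L : ι → RMat M K → ℝ) (hP : P.Assumptions L)
    (E : ℕ → ι → ι → Prop) (hE : BStronglyConnected E)
    (A : ℕ → Matrix ι ι ℝ) (κ : ℝ) (hA : WeightAssumptions E A κ)
    (γ : ℕ → ℝ) (hγ : StepAssumptions γ)
    (S : D4LIterates ι M K n) (τD τX : ℕ → ι → ℝ)
    (ft : ℕ → (i : ι) → RMat M K → ℝ) (ht : ℕ → (i : ι) → RMat K (n i) → ℝ)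
    (hrun : S.IsRun P γ A ft ht)
    (hsurr : S.SurrogateAssumptions P τD τX ft ht)
    (hprox : S.ProxAssumptions L τD τX)
    (τhatD τhatX : ℝ) (hτhatD : 0 < τhatD) (hτhatX : 0 < τhatX) :
    -- the subproblems defining the merit functions have exactly one solution
    (∀ D ∈ P.Dset, ∀ X : (i : ι) → RMat K (n i), (∀ i, X i ∈ P.Xset i) →
      (∃! D', IsArgmin P.Dset (P.hatDObj τhatD D X) D') ∧
      ∀ i, ∃! X', IsArgmin (P.Xset i) (P.hatXObj τhatX i D (X i)) X') ∧
    -- (a) consensus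
    Tendsto S.consErr atTop (𝓝 0) ∧
    -- (b) convergence
    Bornology.IsBounded (range fun ν => (S.Dbar ν, S.X ν)) ∧
    (∃ u : ℝ, Tendsto (fun ν => P.U (S.Dbar ν) (S.X ν)) atTop (𝓝 u)) ∧
    Tendsto (fun ν => P.DeltaX τhatX (S.Dbar ν) (S.X ν)) atTop (𝓝 0) ∧
    liminf (fun ν => ((P.DeltaD τhatD (S.Dbar ν) (S.X ν) : ℝ) : EReal)) atTop = 0 ∧
    (∃ p : RMat M K × ((i : ι) → RMat K (n i)),
      MapClusterPt p atTop (fun ν => (S.Dbar ν, S.X ν)) ∧ P.IsStationary p.1 p.2) ∧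
    -- (b') strongly convex regularizers and stable proximal parameters
    (∀ μ : ι → ℝ, (∀ i, 0 < μ i ∧ StrongConvexOn (P.Oi i) (μ i) (P.g i)) →
      (∀ i, Summable fun ν => |τD (ν + 1) i - τD ν i|) →
      (∀ i, limsup (fun ν => |τX (ν + 1) i - τX ν i|) atTop < ⨅ j, μ j) →
      Tendsto (fun ν => max (P.DeltaD τhatD (S.Dbar ν) (S.X ν))
        (P.DeltaX τhatX (S.Dbar ν) (S.X ν))) atTop (𝓝 0) ∧
      ∀ p : RMat M K × ((i : ι) → RMat K (n i)),
        MapClusterPt p atTop (fun ν => (S.Dbar ν, S.X ν)) → P.IsStationary p.1 p.2) := by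
  obtain ⟨Z, ℓ, R, c, ε, τlo, τhi, ρ, T, r⟩ :=
    D4LIterates.exists_regularRun hP hE hA hγ hrun hsurr hprox
  refine ⟨fun D hD X hX => ⟨hP.existsUnique_hatD hτhatD hD X,
    fun i => hP.existsUnique_hatX hτhatX i D (hX i)⟩, r.tendsto_consErr, r.isBounded_iterates,
    r.exists_tendsto_U, r.tendsto_DeltaX hτhatX, r.liminf_DeltaD hτhatD,
    r.exists_stationary_cluster_point hτhatD hτhatX, fun μ hμ _ hlim => ?_⟩
  have hgap := r.tendsto_gapD hτhatD hμ hlim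
  refine ⟨?_, fun p hp => ?_⟩
  · have hD : Tendsto (fun ν => P.DeltaD τhatD (S.Dbar ν) (S.X ν)) atTop (𝓝 0) :=
      squeeze_zero (fun _ => maxAbs_nonneg _) (fun _ => maxAbs_le_norm _) hgap
    simpa using hD.max (r.tendsto_DeltaX hτhatX)
  -- Both merit values now vanish along the whole sequence, hence along any ultrafilter realizing a
  -- cluster point.
  · obtain ⟨W, hW, hWlim⟩ := mapClusterPt_iff_ultrafilter.1 hp
    exact r.isStationary_of_tendsto hτhatD hτhatX (l := W) hWlim (hgap.mono_left hW)
      fun i => (r.tendsto_gapX hτhatX i).mono_left hW
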